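/- **Setting.** Let $S$ be a regular scattering function with limit: $S$ is bounded and continuous on $\{0\le\operatorname{Im}\zeta\le\pi\}$, analytic in the interior, satisfies $\overline{S(\theta)}=S(\theta)^{-1}=S(\theta+i\pi)=S(-\theta)$ for $\theta\in\mathbb R$, continues to a bounded analytic function on $\{-\kappa<\operatorname{Im}\zeta<\pi+\kappa\}$ for some $\kappa>0$, and the limits $\lim_{\theta\to\pm\infty}S(\theta)$ exist. (They then coincide, and $S(\infty):=\lim_{\theta\to\infty}S(\theta)\in\{1,-1\}$.) Let $$S_0(p,q)=\begin{cases}S(\log p-\log q)&p,q>0\\ S(\log(-q)-\log(-p))&p,q<0\\ S(0)&p=q=0\\ S(\infty)&\text{otherwise.}\end{cases}$$ For a $\sigma$-finite measure $\mu$ on $\mathbb R$ and a measurable function $s:\mathbb R^2\to\mathbb C$ with $|s|=1$, $\overline{s(p,q)}=s(q,p)$, the $s$-symmetric Fock space over $L^2(\mathbb R,\mu)$ is the Hilbert sum of the closed subspaces $\mathcal H_n\subset L^2(\mathbb R^n,\mu^n)$ of all $\Psi_n$ with $\Psi_n(p_1,\dots,p_n)=s(p_{j+1},p_j)\Psi_n(p_1,\dots,p_{j+1},p_j,\dots,p_n)$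 for $1\le j<n$. Let $P_n$ be the orthogonal projection onto $\mathcal H_n$, $N$ the particle number operator, and $\mathcal D$ the dense subspace of vectors with finitely many non-zero components. On $\mathcal D$ the creation operators are $(a^\dagger(\psi)\Phi)_n=\sqrt n\,P_n(\psi\otimes\Phi_{n-1})$, and the annihilation operators are $a(\psi)=a^\dagger(\overline\psi)^*$ (restricted to $\mathcal D$). The antiunitary reflection is $(U(j)\Psi)_n(p_1,\dots,p_n)=\overline{\Psi_n(p_n,\dots,p_1)}$. *Massless model.* $\mathcal H_0$ is the $S_0$-symmetric Fock space over $L^2(\mathbb R,dp/|p|)$, with operators $z_0^\dagger,z_0$, reflection $U_0(j)$, finite particle subspace $\mathcal D_0$, and, for $x=(x_0,x_1)\in\mathbb R^2$, $\theta\in\mathbb R$, $(U_0(x,\theta)\Psi)_n(p_1,\dots,p_n)=e^{i\sum_k(|p_k|x_0-p_kx_1)}\Psi_n(\theta p_1,\dots,\theta p_n)$, where $\theta p:=\cosh\theta\,p-\sinh\theta\,|p|$. For $f\in\mathscr S(\mathbb R^2)$ let $f^{0\pm}(p)=\frac1{2\pi}\int f(x)e^{\pm i(|p|x_0-px_1)}d^2x$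 and $f^j(x)=\overline{f(-x)}$; if $f^{0\pm}\in L^2(\mathbb R,dp/|p|)$, put $\phi_0(f)=z_0^\dagger(f^{0+})+z_0(f^{0-})$ and $\phi_0'(f)=U_0(j)\phi_0(f^j)U_0(j)^{-1}$. *Chiral models.* $\mathcal H_l=\mathcal H_r$ are two copies of the Fock space over $L^2(\mathbb R,d\beta)$ that is symmetric with respect to $(\beta,\beta')\mapsto S(\beta-\beta')$, with operators $y^\dagger_{l/r},y_{l/r}$, reflections $U_{l/r}(j)$, number operators $N_{l/r}$, finite particle subspaces $\mathcal D$, and $(U_{l/r}(\xi,\lambda)\Psi)_n(\beta_1,\dots,\beta_n)=e^{i\xi(e^{\beta_1}+\dots+e^{\beta_n})}\Psi_n(\beta_1+\lambda,\dots,\beta_n+\lambda)$. Put $y^\dagger_l(\psi)'=U_l(j)y_l^\dagger(\overline\psi)U_l(j)$. For $h\in\mathscr S(\mathbb R)$ let $\hat h^\pm(\beta)=\pm\frac{ie^\beta}{\sqrt{2\pi}}\int h(\xi)e^{\pm ie^\beta\xi}d\xi$, $h^j(\xi)=\overline{h(-\xi)}$, $\phi_{l/r}(h)=y^\dagger_{l/r}(\hat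 h^+)+y_{l/r}(\hat h^-)$ and $\phi'_{l/r}(h)=U_{l/r}(j)\phi_{l/r}(h^j)U_{l/r}(j)$. Let $(v_l\psi)(p)=\psi(\log(-p))$ for $p<0$ and $0$ for $p\ge0$, and $(v_r\psi)(p)=\psi(\log p)$ for $p>0$ and $0$ for $p\le0$. For $g\in\mathscr S(\mathbb R^2)$ let $g_l(\xi)=\frac12\int g\big(\frac{\xi+\xi'}2,\frac{\xi-\xi'}2\big)d\xi'$ and $g_r(\xi)=\frac12\int g\big(\frac{\xi+\xi'}2,\frac{\xi'-\xi}2\big)d\xi'$; these are Schwartz functions. **Proposition.** There is a unitary $V:\mathcal H_l\otimes\mathcal H_r\to\mathcal H_0$ (Hilbert space tensor product) which maps the algebraic tensor product $\mathcal D\otimes\mathcal D$ into $\mathcal D_0$ and satisfies: 1. For all $\psi\in L^2(\mathbb R,d\beta)$, on $\mathcal D\otimes\mathcal D$: $V^*z_0^\dagger(v_l\psi)V=y_l^\dagger(\psi)'\otimes1$ and $V^*z_0^\dagger(v_r\psi)V=S(\infty)^{N_l}\otimes y_r^\dagger(\psi)$. 2. $V^*U_0(x,\theta)V=U_l(x_0+x_1,\theta)\otimes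 U_r(x_0-x_1,-\theta)$ for all $x\in\mathbb R^2$, $\theta\in\mathbb R$. 3. $V^*U_0(j)V=S(\infty)^{N_l\otimes N_r}\,(U_l(j)\otimes U_r(j))$, where $S(\infty)^{N_l\otimes N_r}$ acts on $\mathcal H_{l,n}\otimes\mathcal H_{r,m}$ as multiplication by $S(\infty)^{nm}$. 4. For all $f,g\in\mathscr S(\mathbb R^2)$ and $k\in\{0,1\}$ with $f=\partial g/\partial x_k$, the functions $f^{0\pm}$ lie in $L^2(\mathbb R,dp/|p|)$, and on $\mathcal D\otimes\mathcal D$ $$V^*\phi_0(f)V=-\tfrac1{\sqrt{2\pi}}\big(-\phi_l'(g_l)\otimes1+(-1)^k\,S(\infty)^{N_l}\otimes\phi_r(g_r)\big),$$ $$V^*\phi_0'(f)V=-\tfrac1{\sqrt{2\pi}}\big(\phi_l(g_l)\otimes S(\infty)^{N_r}-(-1)^k\,1\otimes\phi_r'(g_r)\big).$$ -/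

import Mathlib

open MeasureTheory Filter Topology
open scoped ComplexConjugate

/-- A scattering function: bounded and continuous on the closed strip `0 ≤ Im ζ ≤ π`, analytic in
its interior, with `conj S(θ) = S(θ)⁻¹ = S(θ + iπ) = S(-θ)` for real `θ`. Values outside the closed
strip are irrelevant. -/
structure IsScatteringFunction (S : ℂ → ℂ) : Prop where
  continuousOn : ContinuousOn S {ζ : ℂ | 0 ≤ ζ.im ∧ ζ.im ≤ Real.pi}
  bounded : ∃ C : ℝ, ∀ ζ : ℂ, 0 ≤ ζ.im → ζ.im ≤ Real.pi → ‖S ζ‖ ≤ C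
  analytic : DifferentiableOn ℂ S {ζ : ℂ | 0 < ζ.im ∧ ζ.im < Real.pi}
  ne_zero : ∀ θ : ℝ, S θ ≠ 0
  conj_eq_inv : ∀ θ : ℝ, conj (S θ) = (S θ)⁻¹
  inv_eq_crossing : ∀ θ : ℝ, (S θ)⁻¹ = S (θ + Real.pi * Complex.I)
  crossing_eq_neg : ∀ θ : ℝ, S (θ + Real.pi * Complex.I) = S (-θ)

/-- A scattering function is regular if it continues to a bounded analytic function on a strip
`-κ < Im ζ < π + κ` with `κ > 0`. -/
structure IsRegularScatteringFunction (S : ℂ → ℂ) : Prop extends IsScatteringFunction S where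
  continuation : ∃ κ : ℝ, 0 < κ ∧ ∃ F : ℂ → ℂ,
    DifferentiableOn ℂ F {ζ : ℂ | -κ < ζ.im ∧ ζ.im < Real.pi + κ} ∧
    (∃ C : ℝ, ∀ ζ : ℂ, -κ < ζ.im → ζ.im < Real.pi + κ → ‖F ζ‖ ≤ C) ∧
    ∀ ζ : ℂ, 0 ≤ ζ.im → ζ.im ≤ Real.pi → F ζ = S ζ

/-- A regular scattering function for which the limits of `S(θ)` as `θ → ±∞` exist. -/
structure ScatteringFunctionWithLimit where
  toFun : ℂ → ℂ
  regular : IsRegularScatteringFunction toFun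
  limit_atTop : ∃ a : ℂ, Tendsto (fun θ : ℝ => toFun θ) atTop (𝓝 a)
  limit_atBot : ∃ a : ℂ, Tendsto (fun θ : ℝ => toFun θ) atBot (𝓝 a)

namespace ScatteringFunctionWithLimit

variable (S : ScatteringFunctionWithLimit)

/-- The scattering function on the real line. -/
def onReal (θ : ℝ) : ℂ := S.toFun θ

/-- `S(∞)`, the limit of `S(θ)` for `θ → +∞` along the reals. -/
noncomputable def atInfinity : ℂ := limUnder atTop S.onReal

theorem tendsto_atTop : Tendsto S.onReal atTop (𝓝 S.atInfinity) :=
  tendsto_nhds_limUnder S.limit_atTop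

theorem conj_onReal (θ : ℝ) : conj (S.onReal θ) = S.onReal (-θ) := by
  have h := S.regular.toIsScatteringFunction
  unfold onReal
  rw [h.conj_eq_inv, h.inv_eq_crossing, h.crossing_eq_neg]; simp

theorem norm_onReal (θ : ℝ) : ‖S.onReal θ‖ = 1 := by
  have h := S.regular.toIsScatteringFunction
  have h1 : conj (S.onReal θ) * S.onReal θ = 1 := by
    unfold onReal
    rw [h.conj_eq_inv, inv_mul_cancel₀ (h.ne_zero θ)]
  have h2 := congrArg norm h1
  rw [norm_mul, RCLike.norm_conj, norm_one] at h2
  nlinarith [norm_nonneg (S.onReal θ)]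

theorem norm_atInfinity : ‖S.atInfinity‖ = 1 :=
  tendsto_nhds_unique S.tendsto_atTop.norm (by simp [norm_onReal])

theorem continuous_onReal : Continuous S.onReal := by
  have h := S.regular.continuousOn
  have : Continuous fun θ : ℝ => (θ : ℂ) := Complex.continuous_ofReal
  exact h.comp_continuous this (fun θ => by simp [Real.pi_pos.le])

/-- `S(∞)` is real; together with `|S(∞)| = 1` this gives `S(∞) = ±1`. -/
theorem conj_atInfinity : conj S.atInfinity = S.atInfinity := by
  have h := S.regular.toIsScatteringFunction
  set a := S.atInfinity with ha
  have hbot : Tendsto (fun θ : ℝ => S.toFun (θ + Real.pi * Complex.I)) atTop (𝓝 (conj a)) := by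
    have : (fun θ : ℝ => S.toFun (θ + Real.pi * Complex.I)) = fun θ => conj (S.onReal θ) := by
      funext θ
      rw [conj_onReal, h.crossing_eq_neg]; simp [onReal]
    rw [this]
    exact (Complex.continuous_conj.tendsto a).comp S.tendsto_atTop
  obtain ⟨C, hC⟩ := h.bounded
  by_contra hne
  set d := ‖conj a - a‖ with hd
  have hd0 : 0 < d := norm_pos_iff.2 (sub_ne_zero.2 hne)
  -- the product vanishing in the limit on both boundary lines
  set F : ℂ → ℂ := fun ζ => (S.toFun ζ - a) * (S.toFun ζ - conj a) with hF
  have hC0 : 0 ≤ C := (norm_nonneg _).trans (hC 0 (by simp) (by simp [Real.pi_pos.le]))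
  set M : ℝ := (C + 1) * (C + 1) with hM
  have hM0 : 0 < M := by positivity
  have hFM : ∀ ζ : ℂ, 0 ≤ ζ.im → ζ.im ≤ Real.pi → ‖F ζ‖ ≤ M := by
    intro ζ h0 h1
    have e1 : ‖S.toFun ζ - a‖ ≤ C + 1 :=
      (norm_sub_le _ _).trans (add_le_add (hC ζ h0 h1) S.norm_atInfinity.le)
    have e2 : ‖S.toFun ζ - conj a‖ ≤ C + 1 :=
      (norm_sub_le _ _).trans (add_le_add (hC ζ h0 h1) (by
        rw [RCLike.norm_conj]; exact S.norm_atInfinity.le))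
    rw [hF, norm_mul]
    exact mul_le_mul e1 e2 (norm_nonneg _) (by positivity)
  have hFc : ContinuousOn F {ζ : ℂ | 0 ≤ ζ.im ∧ ζ.im ≤ Real.pi} :=
    (h.continuousOn.sub continuousOn_const).mul (h.continuousOn.sub continuousOn_const)
  have hFd : DifferentiableOn ℂ F {ζ : ℂ | 0 < ζ.im ∧ ζ.im < Real.pi} :=
    (h.analytic.sub (differentiableOn_const _)).mul (h.analytic.sub (differentiableOn_const _))
  have hF0 : Tendsto (fun θ : ℝ => F θ) atTop (𝓝 0) := by
    have := (S.tendsto_atTop.sub_const a).mul (S.tendsto_atTop.sub_const (conj a))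
    simpa [hF, onReal, ← ha] using this
  have hFpi : Tendsto (fun θ : ℝ => F (θ + Real.pi * Complex.I)) atTop (𝓝 0) := by
    have := (hbot.sub_const a).mul (hbot.sub_const (conj a))
    simpa [hF] using this
  -- uniform smallness inside the strip
  have key : ∃ R₀ : ℝ, ∀ T : ℝ, R₀ ≤ T → ∀ y : ℝ, 0 ≤ y → y ≤ Real.pi →
      ‖F (T + y * Complex.I)‖ ≤ d ^ 2 / 16 := by
    set c : ℝ := d ^ 2 / 16 / (3 * Real.pi) with hc
    have hpi := Real.pi_pos
    have hc0 : 0 < c := by positivity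
    obtain ⟨R, hR⟩ : ∃ R : ℝ, ∀ θ : ℝ, R ≤ θ →
        ‖F θ‖ ≤ c ∧ ‖F (θ + Real.pi * Complex.I)‖ ≤ c := by
      have e1 := hF0.norm.eventually_le_const (u := c) (by simpa using hc0)
      have e2 := hFpi.norm.eventually_le_const (u := c) (by simpa using hc0)
      exact eventually_atTop.1 (e1.and e2)
    refine ⟨R + M / c, fun T hT y hy0 hy1 => ?_⟩
    set G : ℂ → ℂ := fun ζ => F (T + ζ) * (ζ + 2 * Real.pi * Complex.I)⁻¹ with hG
    have him : ∀ ζ : ℂ, (ζ + 2 * Real.pi * Complex.I).im = ζ.im + 2 * Real.pi := by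
      intro ζ; simp
    have hre : ∀ ζ : ℂ, (ζ + 2 * Real.pi * Complex.I).re = ζ.re := by
      intro ζ; simp
    have hlow : ∀ ζ : ℂ, 0 ≤ ζ.im → 2 * Real.pi ≤ ‖ζ + 2 * Real.pi * Complex.I‖ := by
      intro ζ hζ
      have := Complex.abs_im_le_norm (ζ + 2 * Real.pi * Complex.I)
      rw [him] at this
      have := le_abs_self (ζ.im + 2 * Real.pi)
      linarith
    have hlow1 : ∀ ζ : ℂ, 0 ≤ ζ.im → 1 ≤ ‖ζ + 2 * Real.pi * Complex.I‖ := by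
      intro ζ hζ
      have := hlow ζ hζ
      nlinarith [Real.pi_gt_three]
    have hnz : ∀ ζ : ℂ, 0 ≤ ζ.im → ζ + 2 * Real.pi * Complex.I ≠ 0 := by
      intro ζ hζ h0
      have := hlow1 ζ hζ
      rw [h0, norm_zero] at this
      linarith
    have hbd : ∀ ζ : ℂ, 0 ≤ ζ.im → ζ.im ≤ Real.pi → (R ≤ T + ζ.re → ‖F (T + ζ)‖ ≤ c) →
        ‖G ζ‖ ≤ c := by
      intro ζ h0 h1 hb
      rw [hG, norm_mul, norm_inv, ← div_eq_mul_inv, div_le_iff₀ (by linarith [hlow1 ζ h0])]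
      by_cases hζ : R ≤ T + ζ.re
      · have := hb hζ
        nlinarith [hlow1 ζ h0]
      · have e1 : ‖F (T + ζ)‖ ≤ M := hFM _ (by simpa using h0) (by simpa using h1)
        have e2 := Complex.abs_re_le_norm (ζ + 2 * Real.pi * Complex.I)
        rw [hre] at e2
        have e3 : M / c ≤ |ζ.re| := by
          push Not at hζ
          have := neg_le_abs ζ.re
          linarith
        have e4 : M ≤ |ζ.re| * c := (div_le_iff₀ hc0).1 e3
        nlinarith
    have hmem : ∀ ζ : ℂ, ((T : ℂ) + ζ).im = ζ.im := by intro ζ; simp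
    have hstrip : (Complex.im ⁻¹' Set.Ioo 0 Real.pi) = {ζ : ℂ | 0 < ζ.im ∧ ζ.im < Real.pi} := rfl
    have hclos : closure (Complex.im ⁻¹' Set.Ioo 0 Real.pi) ⊆
        {ζ : ℂ | 0 ≤ ζ.im ∧ ζ.im ≤ Real.pi} := by
      apply closure_minimal
      · intro ζ hζ; exact ⟨hζ.1.le, hζ.2.le⟩
      · exact (isClosed_le continuous_const Complex.continuous_im).inter
          (isClosed_le Complex.continuous_im continuous_const)
    have hGd : DiffContOnCl ℂ G (Complex.im ⁻¹' Set.Ioo 0 Real.pi) := by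
      constructor
      · apply DifferentiableOn.mul
        · apply hFd.comp (by fun_prop)
          intro ζ hζ
          simpa using hζ
        · apply DifferentiableOn.inv (by fun_prop)
          intro ζ hζ
          exact hnz ζ hζ.1.le
      · apply ContinuousOn.mono _ hclos
        apply ContinuousOn.mul
        · apply hFc.comp (by fun_prop)
          intro ζ hζ
          simpa using hζ
        · apply ContinuousOn.inv₀ (by fun_prop)
          intro ζ hζ
          exact hnz ζ hζ.1
    have hPL := PhragmenLindelof.horizontal_strip (a := 0) (b := Real.pi) (C := c)
      (z := (y : ℂ) * Complex.I) hGd ?_ ?_ ?_ (by simpa using hy0) (by simpa using hy1)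
    · rw [hG, norm_mul, norm_inv, ← div_eq_mul_inv] at hPL
      have e5 : ‖(y : ℂ) * Complex.I + 2 * Real.pi * Complex.I‖ = y + 2 * Real.pi := by
        have : (y : ℂ) * Complex.I + 2 * Real.pi * Complex.I
            = ((y + 2 * Real.pi : ℝ) : ℂ) * Complex.I := by push_cast; ring
        rw [this, norm_mul, Complex.norm_I, mul_one, Complex.norm_real, Real.norm_eq_abs,
          abs_of_nonneg (by positivity)]
      rw [e5, div_le_iff₀ (by positivity)] at hPL
      refine hPL.trans ?_
      have : c * (3 * Real.pi) = d ^ 2 / 16 := by rw [hc]; field_simp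
      nlinarith
    · refine ⟨0, by simp, 0, ?_⟩
      apply Asymptotics.IsBigO.of_bound M
      filter_upwards [mem_inf_of_right (mem_principal_self _)] with ζ hζ
      simp only [zero_mul, Real.exp_zero, norm_one, mul_one]
      rw [hG, norm_mul, norm_inv]
      have e1 : ‖F (T + ζ)‖ ≤ M := hFM _ (by simpa using hζ.1.le) (by simpa using hζ.2.le)
      have e2 := inv_le_one_of_one_le₀ (hlow1 ζ hζ.1.le)
      nlinarith [norm_nonneg (F (T + ζ)), inv_nonneg.2 (norm_nonneg (ζ + 2 * Real.pi * Complex.I))]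
    · intro ζ hζ
      apply hbd ζ hζ.ge (by rw [hζ]; exact hpi.le)
      intro hR1
      have := (hR _ hR1).1
      convert this using 3
      apply Complex.ext <;> simp [hζ]
    · intro ζ hζ
      apply hbd ζ (by rw [hζ]; exact hpi.le) hζ.le
      intro hR1
      have := (hR _ hR1).2
      convert this using 3
      apply Complex.ext <;> simp [hζ]
  obtain ⟨R₀, hR₀⟩ := key
  obtain ⟨R₁, hR₁⟩ := eventually_atTop.1
    ((Metric.tendsto_nhds.1 S.tendsto_atTop (d / 4) (by positivity)).and
      (Metric.tendsto_nhds.1 hbot (d / 4) (by positivity)))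
  set T := max R₀ R₁
  obtain ⟨h1, h2⟩ := hR₁ T (le_max_right _ _)
  rw [dist_eq_norm] at h1 h2
  have hcont : ContinuousOn (fun y : ℝ => ‖S.toFun (T + y * Complex.I) - a‖)
      (Set.Icc 0 Real.pi) := by
    apply ContinuousOn.norm
    apply ContinuousOn.sub _ continuousOn_const
    apply h.continuousOn.comp (by fun_prop)
    intro y hy
    simpa using hy
  have hmid : d / 2 ∈ Set.Icc ‖S.toFun (T + (0 : ℝ) * Complex.I) - a‖
      ‖S.toFun (T + Real.pi * Complex.I) - a‖ := by
    constructor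
    · simp only [Complex.ofReal_zero, zero_mul, add_zero]
      have : ‖S.toFun T - a‖ < d / 4 := h1
      linarith
    · have : d ≤ ‖S.toFun (T + Real.pi * Complex.I) - conj a‖
          + ‖S.toFun (T + Real.pi * Complex.I) - a‖ := by
        rw [hd, ← norm_neg (S.toFun (T + Real.pi * Complex.I) - conj a)]
        refine le_trans (le_of_eq ?_) (norm_add_le _ _)
        congr 1; ring
      linarith
  obtain ⟨y, hy, hy2⟩ := intermediate_value_Icc Real.pi_pos.le hcont hmid
  have hy3 := hR₀ T (le_max_left _ _) y hy.1 hy.2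
  simp only at hy2
  have h5 : d ≤ ‖S.toFun (T + y * Complex.I) - conj a‖ + ‖S.toFun (T + y * Complex.I) - a‖ := by
    rw [hd, ← norm_neg (S.toFun (T + y * Complex.I) - conj a)]
    refine le_trans (le_of_eq ?_) (norm_add_le _ _)
    congr 1; ring
  rw [hF, norm_mul, hy2] at hy3
  rw [hy2] at h5
  nlinarith

theorem atInfinity_sq : S.atInfinity ^ 2 = 1 := by
  have h := Complex.mul_conj S.atInfinity
  rw [conj_atInfinity, Complex.normSq_eq_norm_sq, norm_atInfinity] at h
  rw [pow_two, h]; simp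

end ScatteringFunctionWithLimit

namespace Zamolodchikov

/-! ### Unimodular multiplication and substitution operators on `L²` -/

section LpOperators

variable {α : Type*} [MeasurableSpace α] {ν : Measure α}

theorem memLp_unimodular_mul {u : α → ℂ} (hu : Measurable u) (hu1 : ∀ x, ‖u x‖ = 1)
    (f : Lp ℂ 2 ν) : MemLp (fun x => u x * f x) 2 ν :=
  (Lp.memLp f).of_le (hu.aestronglyMeasurable.mul (Lp.aestronglyMeasurable f))
    (Eventually.of_forall fun x => by simp [hu1])

/-- The isometry `(M f)(x) = u(x) f(x)` of `L²(ν)`, for `|u| = 1`. -/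
noncomputable def unimodularMul (u : α → ℂ) (hu : Measurable u) (hu1 : ∀ x, ‖u x‖ = 1) :
    Lp ℂ 2 ν →ₗᵢ[ℂ] Lp ℂ 2 ν where
  toFun f := (memLp_unimodular_mul hu hu1 f).toLp
  map_add' f g := by
    apply Lp.ext
    filter_upwards [(memLp_unimodular_mul hu hu1 (f + g)).coeFn_toLp,
      (memLp_unimodular_mul hu hu1 f).coeFn_toLp, (memLp_unimodular_mul hu hu1 g).coeFn_toLp,
      Lp.coeFn_add f g, Lp.coeFn_add (memLp_unimodular_mul hu hu1 f).toLp
        (memLp_unimodular_mul hu hu1 g).toLp] with x h1 h2 h3 h4 h5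
    rw [h1, h5, Pi.add_apply, h2, h3, h4, Pi.add_apply, mul_add]
  map_smul' c f := by
    apply Lp.ext
    filter_upwards [(memLp_unimodular_mul hu hu1 (c • f)).coeFn_toLp,
      (memLp_unimodular_mul hu hu1 f).coeFn_toLp, Lp.coeFn_smul c f,
      Lp.coeFn_smul c (memLp_unimodular_mul hu hu1 f).toLp] with x h1 h2 h3 h4
    rw [h1, RingHom.id_apply, h4, Pi.smul_apply, h2, h3, Pi.smul_apply, smul_eq_mul, smul_eq_mul,
      mul_left_comm]
  norm_map' f := by
    change ‖(memLp_unimodular_mul hu hu1 f).toLp‖ = ‖f‖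
    rw [Lp.norm_toLp, Lp.norm_def]
    congr 1
    exact eLpNorm_congr_norm_ae (Eventually.of_forall fun x => by simp [hu1])

theorem coeFn_unimodularMul {u : α → ℂ} (hu : Measurable u) (hu1 : ∀ x, ‖u x‖ = 1)
    (f : Lp ℂ 2 ν) : unimodularMul u hu hu1 f =ᵐ[ν] fun x => u x * f x :=
  (memLp_unimodular_mul hu hu1 f).coeFn_toLp

/-- The isometry `(W f)(x) = u(x) f(e x)` of `L²(ν)`, for `|u| = 1` and `e` preserving `ν`. -/
noncomputable def weightedComp (u : α → ℂ) (hu : Measurable u) (hu1 : ∀ x, ‖u x‖ = 1)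
    (e : α → α) (he : MeasurePreserving e ν ν) : Lp ℂ 2 ν →ₗᵢ[ℂ] Lp ℂ 2 ν :=
  (unimodularMul u hu hu1).comp (Lp.compMeasurePreservingₗᵢ ℂ e he)

theorem coeFn_weightedComp {u : α → ℂ} (hu : Measurable u) (hu1 : ∀ x, ‖u x‖ = 1)
    {e : α → α} (he : MeasurePreserving e ν ν) (f : Lp ℂ 2 ν) :
    weightedComp u hu hu1 e he f =ᵐ[ν] fun x => u x * f (e x) := by
  filter_upwards [coeFn_unimodularMul hu hu1 (Lp.compMeasurePreserving e he f),
    Lp.coeFn_compMeasurePreserving f he] with x h1 h2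
  exact h1.trans (by rw [h2]; rfl)

/-- The antilinear isometry `(C f)(x) = conj (f (e x))` of `L²(ν)`, for `e` preserving `ν`. -/
noncomputable def conjComp (e : α → α) (he : MeasurePreserving e ν ν) :
    Lp ℂ 2 ν →ₛₗᵢ[starRingEnd ℂ] Lp ℂ 2 ν where
  toFun f := star (Lp.compMeasurePreserving e he f)
  map_add' f g := by
    apply Lp.ext
    filter_upwards [Lp.coeFn_star (Lp.compMeasurePreserving e he (f + g)),
      Lp.coeFn_star (Lp.compMeasurePreserving e he f),
      Lp.coeFn_star (Lp.compMeasurePreserving e he g),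
      Lp.coeFn_add (star (Lp.compMeasurePreserving e he f))
        (star (Lp.compMeasurePreserving e he g)),
      Lp.coeFn_add (Lp.compMeasurePreserving e he f)
        (Lp.compMeasurePreserving e he g)] with x h1 h2 h3 h4 h5
    rw [h1, h4, Pi.add_apply, h2, h3]
    rw [Pi.star_apply, map_add, h5]
    simp
  map_smul' c f := by
    apply Lp.ext
    have hs : Lp.compMeasurePreserving e he (c • f) = c • Lp.compMeasurePreserving e he f :=
      (Lp.compMeasurePreservingₗ (E := ℂ) (p := 2) ℂ e he).map_smul c f
    filter_upwards [Lp.coeFn_star (Lp.compMeasurePreserving e he (c • f)),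
      Lp.coeFn_star (Lp.compMeasurePreserving e he f),
      Lp.coeFn_smul (starRingEnd ℂ c) (star (Lp.compMeasurePreserving e he f)),
      Lp.coeFn_smul c (Lp.compMeasurePreserving e he f)] with x h1 h2 h3 h4
    rw [h1, h3, Pi.smul_apply, h2, Pi.star_apply, hs, h4]
    simp
  norm_map' f := by
    change ‖star (Lp.compMeasurePreserving e he f)‖ = ‖f‖
    rw [← Lp.norm_compMeasurePreserving f he, Lp.norm_def, Lp.norm_def]
    congr 1
    apply eLpNorm_congr_norm_ae
    filter_upwards [Lp.coeFn_star (Lp.compMeasurePreserving e he f)] with x h1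
    rw [h1]; simp

theorem coeFn_conjComp {e : α → α} (he : MeasurePreserving e ν ν) (f : Lp ℂ 2 ν) :
    conjComp e he f =ᵐ[ν] fun x => conj (f (e x)) := by
  filter_upwards [Lp.coeFn_star (Lp.compMeasurePreserving e he f),
    Lp.coeFn_compMeasurePreserving f he] with x h1 h2
  exact h1.trans (by rw [Pi.star_apply, h2]; rfl)

end LpOperators

/-! ### The Fock space symmetrized by a two-body factor -/

/-- A two-particle exchange factor `s(p, q)`: measurable, of modulus one, and with
`conj s(p, q) = s(q, p)`, hence `s(q, p) = s(p, q)⁻¹`. -/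
structure ExchangeFactor where
  toFun : ℝ → ℝ → ℂ
  measurable : Measurable fun x : ℝ × ℝ => toFun x.1 x.2
  norm_eq_one : ∀ p q, ‖toFun p q‖ = 1
  conj_symm : ∀ p q, conj (toFun p q) = toFun q p

theorem ExchangeFactor.measurable_pair (s : ExchangeFactor) {n : ℕ} (a b : Fin n) :
    Measurable fun p : Fin n → ℝ => s.toFun (p a) (p b) :=
  s.measurable.comp (Measurable.prodMk (measurable_pi_apply a) (measurable_pi_apply b))

section Fock

variable (μ : Measure ℝ) [SigmaFinite μ] (s : ExchangeFactor)

/-- `L²(ℝⁿ, μⁿ)`, the `n`-fold Hilbert tensor power of `L²(ℝ, μ)`. -/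
abbrev L2Power (n : ℕ) : Type := Lp ℂ 2 (Measure.pi fun _ : Fin n => μ)

theorem measurePreserving_perm {n : ℕ} (σ : Equiv.Perm (Fin n)) :
    MeasurePreserving (fun (p : Fin n → ℝ) i => p (σ i))
      (Measure.pi fun _ : Fin n => μ) (Measure.pi fun _ : Fin n => μ) := by
  have h := measurePreserving_piCongrLeft (α := fun _ : Fin n => ℝ) (fun _ => μ) σ.symm
  convert h using 1
  funext p i
  have := Equiv.piCongrLeft_apply_apply (fun _ : Fin n => ℝ) σ.symm p (σ i)
  simp only [Equiv.symm_apply_apply] at this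
  exact this.symm

/-- The operator `D_n(τ_j)`:
`(D_n(τ_j)Ψ)(p_1,…,p_n) = s(p_{j+1}, p_j) Ψ(p_1,…,p_{j+1},p_j,…,p_n)`
(positions are counted from zero in the code). -/
noncomputable def exchange (n j : ℕ) (hj : j + 1 < n) : L2Power μ n →ₗᵢ[ℂ] L2Power μ n :=
  weightedComp (fun p : Fin n → ℝ => s.toFun (p ⟨j + 1, hj⟩) (p ⟨j, by omega⟩))
    (s.measurable_pair ⟨j + 1, hj⟩ ⟨j, by omega⟩) (fun _ => s.norm_eq_one _ _)
    (fun p i => p (Equiv.swap ⟨j, by omega⟩ ⟨j + 1, hj⟩ i))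
    (measurePreserving_perm μ _)

/-- The `n`-particle space: the vectors of `L²(ℝⁿ, μⁿ)` that are invariant under all the
`D_n(τ_j)`, hence under the representation of the symmetric group that these generate. -/
noncomputable def nParticle (n : ℕ) : Submodule ℂ (L2Power μ n) where
  carrier := {Ψ | ∀ (j : ℕ) (hj : j + 1 < n), exchange μ s n j hj Ψ = Ψ}
  add_mem' := by
    intro a b ha hb j hj
    rw [map_add, ha j hj, hb j hj]
  zero_mem' := by
    intro j hj
    rw [map_zero]
  smul_mem' := by
    intro c a ha j hj
    rw [map_smul, ha j hj]

theorem isClosed_nParticle (n : ℕ) : IsClosed (nParticle μ s n : Set (L2Power μ n)) := by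
  have : (nParticle μ s n : Set (L2Power μ n)) =
      ⋂ (j : ℕ) (hj : j + 1 < n), {Ψ | exchange μ s n j hj Ψ = Ψ} := by
    ext Ψ; simp [nParticle]
  rw [this]
  exact isClosed_iInter fun j => isClosed_iInter fun hj =>
    isClosed_eq (exchange μ s n j hj).continuous continuous_id

noncomputable instance instCompleteSpaceNParticle (n : ℕ) : CompleteSpace (nParticle μ s n) :=
  (isClosed_nParticle μ s n).completeSpace_coe

theorem mem_nParticle_iff {n : ℕ} {Ψ : L2Power μ n} :
    Ψ ∈ nParticle μ s n ↔ ∀ (j : ℕ) (hj : j + 1 < n),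
      ∀ᵐ p ∂(Measure.pi fun _ : Fin n => μ),
        s.toFun (p ⟨j + 1, hj⟩) (p ⟨j, by omega⟩) *
          Ψ (fun i => p (Equiv.swap ⟨j, by omega⟩ ⟨j + 1, hj⟩ i)) = Ψ p := by
  have key : ∀ (j : ℕ) (hj : j + 1 < n), exchange μ s n j hj Ψ = Ψ ↔
      ∀ᵐ p ∂(Measure.pi fun _ : Fin n => μ),
        s.toFun (p ⟨j + 1, hj⟩) (p ⟨j, by omega⟩) *
          Ψ (fun i => p (Equiv.swap ⟨j, by omega⟩ ⟨j + 1, hj⟩ i)) = Ψ p := by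
    intro j hj
    have hc : exchange μ s n j hj Ψ =ᵐ[_] _ := coeFn_weightedComp _ _ _ Ψ
    constructor
    · intro h
      rw [h] at hc
      filter_upwards [hc] with p hp using hp.symm
    · intro h
      apply Lp.ext
      filter_upwards [hc, h] with p h1 h2
      rw [h1, h2]
  exact forall₂_congr key

/-- The `s`-symmetric Fock space `⨁_n H_n` (Hilbert space direct sum). -/
def Fock : Type := lp (fun n : ℕ => nParticle μ s n) 2

noncomputable instance instNormedAddCommGroupFock : NormedAddCommGroup (Fock μ s) :=
  inferInstanceAs (NormedAddCommGroup (lp (fun n : ℕ => nParticle μ s n) 2))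

noncomputable instance instInnerProductSpaceFock : InnerProductSpace ℂ (Fock μ s) :=
  inferInstanceAs (InnerProductSpace ℂ (lp (fun n : ℕ => nParticle μ s n) 2))

noncomputable instance instCompleteSpaceFock : CompleteSpace (Fock μ s) :=
  inferInstanceAs (CompleteSpace (lp (fun n : ℕ => nParticle μ s n) 2))

variable {μ s} in
/-- The `n`-particle component `Ψ_n` of a Fock space vector. -/
def Fock.component (Ψ : Fock μ s) (n : ℕ) : nParticle μ s n :=
  (show lp (fun n : ℕ => nParticle μ s n) 2 from Ψ).1 n

variable {μ s} in
theorem Fock.ext {Ψ Φ : Fock μ s} (h : ∀ n, Ψ.component n = Φ.component n) : Ψ = Φ :=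
  lp.ext (E := fun n : ℕ => nParticle μ s n) (funext h)

/-- An `n`-particle vector as a vector of the Fock space. -/
noncomputable def Fock.single (n : ℕ) (Ψ : nParticle μ s n) : Fock μ s :=
  (lp.single 2 n Ψ : lp (fun n : ℕ => nParticle μ s n) 2)

/-- The subspace of vectors of finite particle number. -/
def finiteParticle : Submodule ℂ (Fock μ s) where
  carrier := {Ψ | ∃ N : ℕ, ∀ n, N ≤ n → Ψ.component n = 0}
  add_mem' := by
    rintro a b ⟨N, hN⟩ ⟨M, hM⟩
    refine ⟨max N M, fun n hn => ?_⟩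
    change a.component n + b.component n = 0
    rw [hN n (le_of_max_le_left hn), hM n (le_of_max_le_right hn), add_zero]
  zero_mem' := ⟨0, fun n _ => rfl⟩
  smul_mem' := by
    rintro c a ⟨N, hN⟩
    refine ⟨N, fun n hn => ?_⟩
    change c • a.component n = 0
    rw [hN n hn, smul_zero]

/-- The finite particle vector with given components. -/
def ofComponents (f : ∀ n, nParticle μ s n) (hf : ∃ N : ℕ, ∀ n, N ≤ n → f n = 0) :
    finiteParticle μ s :=
  ⟨(⟨f, by
    obtain ⟨N, hN⟩ := hf
    apply memℓp_gen
    apply summable_of_ne_finset_zero (s := Finset.range N)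
    intro n hn
    rw [hN n (by simpa using hn)]
    simp⟩ : lp (fun n : ℕ => nParticle μ s n) 2), hf⟩

variable {μ} in
theorem memLp_tensor (ψ : Lp ℂ 2 μ) {n : ℕ} (Φ : L2Power μ n) :
    MemLp (fun p : Fin (n + 1) → ℝ => ψ (p 0) * Φ (fun i => p i.succ)) 2
      (Measure.pi fun _ : Fin (n + 1) => μ) ∧
    eLpNorm (fun p : Fin (n + 1) → ℝ => ψ (p 0) * Φ (fun i => p i.succ)) 2
      (Measure.pi fun _ : Fin (n + 1) => μ) ≤ eLpNorm ψ 2 μ * eLpNorm Φ 2 (Measure.pi fun _ : Fin n => μ) := by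
  have hmp := measurePreserving_piFinSuccAbove (fun _ : Fin (n + 1) => μ) 0
  have hm : AEStronglyMeasurable (fun x : ℝ × (Fin n → ℝ) => ψ x.1 * Φ x.2)
      (μ.prod (Measure.pi fun _ : Fin n => μ)) :=
    (Lp.aestronglyMeasurable ψ).comp_fst.mul (Lp.aestronglyMeasurable Φ).comp_snd
  have hcomp : (fun p : Fin (n + 1) → ℝ => ψ (p 0) * Φ (fun i => p i.succ)) =
      (fun x : ℝ × (Fin n → ℝ) => ψ x.1 * Φ x.2) ∘
        (MeasurableEquiv.piFinSuccAbove (fun _ : Fin (n + 1) => ℝ) 0) := by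
    funext p; rfl
  have hle : eLpNorm (fun p : Fin (n + 1) → ℝ => ψ (p 0) * Φ (fun i => p i.succ)) 2
      (Measure.pi fun _ : Fin (n + 1) => μ) ≤ eLpNorm ψ 2 μ * eLpNorm Φ 2 (Measure.pi fun _ : Fin n => μ) := by
    rw [hcomp, eLpNorm_comp_measurePreserving hm hmp]
    have h2 : ∀ {β : Type} [MeasurableSpace β] (m : Measure β) (g : β → ℂ),
        eLpNorm g 2 m = (∫⁻ x, ‖g x‖ₑ ^ (2 : ℝ) ∂m) ^ (1 / 2 : ℝ) := by
      intro β _ m g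
      rw [eLpNorm_eq_lintegral_rpow_enorm_toReal (by simp) (by simp)]
      simp
    rw [h2, h2, h2, ← ENNReal.mul_rpow_of_nonneg _ _ (by norm_num)]
    apply le_of_eq
    congr 1
    simp only [enorm_mul, ENNReal.mul_rpow_of_nonneg _ _ (by norm_num : (0 : ℝ) ≤ 2)]
    exact lintegral_prod_mul ((Lp.aestronglyMeasurable ψ).enorm.pow_const _)
      ((Lp.aestronglyMeasurable Φ).enorm.pow_const _)
  refine ⟨⟨?_, hle.trans_lt ?_⟩, hle⟩
  · rw [hcomp]
    exact hm.comp_measurePreserving hmp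
  · exact ENNReal.mul_lt_top (Lp.memLp ψ).2 (Lp.memLp Φ).2

variable {μ} in
/-- `Φ ↦ ψ ⊗ Φ`, where `(ψ ⊗ Φ)(p_1,…,p_{n+1}) = ψ(p_1) Φ(p_2,…,p_{n+1})`. -/
noncomputable def tensorLeft (ψ : Lp ℂ 2 μ) (n : ℕ) : L2Power μ n →L[ℂ] L2Power μ (n + 1) :=
  LinearMap.mkContinuous
    { toFun := fun Φ => (memLp_tensor ψ Φ).1.toLp
      map_add' := by
        intro f g
        have hq : Measure.QuasiMeasurePreserving (fun (p : Fin (n + 1) → ℝ) (i : Fin n) => p i.succ)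
            (Measure.pi fun _ : Fin (n + 1) => μ) (Measure.pi fun _ : Fin n => μ) :=
          Measure.quasiMeasurePreserving_snd.comp
            (measurePreserving_piFinSuccAbove (fun _ : Fin (n + 1) => μ) 0).quasiMeasurePreserving
        apply Lp.ext
        filter_upwards [(memLp_tensor ψ (f + g)).1.coeFn_toLp, (memLp_tensor ψ f).1.coeFn_toLp,
          (memLp_tensor ψ g).1.coeFn_toLp, hq.ae (Lp.coeFn_add f g),
          Lp.coeFn_add (memLp_tensor ψ f).1.toLp (memLp_tensor ψ g).1.toLp] with p h1 h2 h3 h4 h5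
        rw [h1, h5, Pi.add_apply, h2, h3, h4, Pi.add_apply, mul_add]
      map_smul' := by
        intro c f
        have hq : Measure.QuasiMeasurePreserving (fun (p : Fin (n + 1) → ℝ) (i : Fin n) => p i.succ)
            (Measure.pi fun _ : Fin (n + 1) => μ) (Measure.pi fun _ : Fin n => μ) :=
          Measure.quasiMeasurePreserving_snd.comp
            (measurePreserving_piFinSuccAbove (fun _ : Fin (n + 1) => μ) 0).quasiMeasurePreserving
        apply Lp.ext
        filter_upwards [(memLp_tensor ψ (c • f)).1.coeFn_toLp, (memLp_tensor ψ f).1.coeFn_toLp,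
          hq.ae (Lp.coeFn_smul c f),
          Lp.coeFn_smul c (memLp_tensor ψ f).1.toLp] with p h1 h2 h3 h4
        rw [h1, RingHom.id_apply, h4, Pi.smul_apply, h2, h3, Pi.smul_apply, smul_eq_mul,
          smul_eq_mul, mul_left_comm] }
    ‖ψ‖ (by
      intro f
      change ‖(memLp_tensor ψ f).1.toLp‖ ≤ _
      rw [Lp.norm_toLp, Lp.norm_def, Lp.norm_def, ← ENNReal.toReal_mul]
      exact ENNReal.toReal_mono (ENNReal.mul_lt_top (Lp.memLp ψ).2 (Lp.memLp f).2).ne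
        (memLp_tensor ψ f).2)

variable {μ} in
theorem coeFn_tensorLeft (ψ : Lp ℂ 2 μ) (n : ℕ) (Φ : L2Power μ n) :
    tensorLeft ψ n Φ =ᵐ[Measure.pi fun _ : Fin (n + 1) => μ] fun p => ψ (p 0) * Φ (fun i => p i.succ) :=
  (memLp_tensor ψ Φ).1.coeFn_toLp

variable {μ} in
/-- The creation operator on the `n`-particle space, `Φ ↦ √(n+1) P_{n+1}(ψ ⊗ Φ)`, where `P_{n+1}`
is the orthogonal projection onto the `(n+1)`-particle space. -/
noncomputable def createN (ψ : Lp ℂ 2 μ) (n : ℕ) : nParticle μ s n →L[ℂ] nParticle μ s (n + 1) :=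
  (Real.sqrt (n + 1) : ℂ) •
    ((nParticle μ s (n + 1)).orthogonalProjectionOnto ∘L tensorLeft ψ n ∘L
      (nParticle μ s n).subtypeL)

variable {μ} in
/-- The annihilation operator on the `(n+1)`-particle space, the adjoint of the creation operator
of the complex conjugate `ψ̄` on the `n`-particle space. -/
noncomputable def annihilateN (ψ : Lp ℂ 2 μ) (n : ℕ) :
    nParticle μ s (n + 1) →L[ℂ] nParticle μ s n :=
  ContinuousLinearMap.adjoint (createN s (star ψ) n)

/-- The components of `z†(ψ)Φ`. -/
noncomputable def createComponents {μ : Measure ℝ} [SigmaFinite μ] (s : ExchangeFactor)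
    (ψ : Lp ℂ 2 μ) (Φ : ∀ n, nParticle μ s n) : ∀ n, nParticle μ s n
  | 0 => 0
  | n + 1 => createN s ψ n (Φ n)

variable {μ} in
/-- The creation operator `z†(ψ)` on finite particle vectors:
`(z†(ψ)Φ)_n = √n P_n(ψ ⊗ Φ_{n-1})`. -/
noncomputable def creation (ψ : Lp ℂ 2 μ) : finiteParticle μ s →ₗ[ℂ] finiteParticle μ s where
  toFun Φ := ofComponents μ s (createComponents s ψ (Φ : Fock μ s).component) (by
    obtain ⟨N, hN⟩ := Φ.2
    refine ⟨N + 1, fun n hn => ?_⟩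
    cases n with
    | zero => omega
    | succ n =>
      change createN s ψ n ((Φ : Fock μ s).component n) = 0
      rw [hN n (by omega), map_zero])
  map_add' := by
    intro a b
    apply Subtype.ext; apply Fock.ext; intro n
    cases n with
    | zero => exact (add_zero (0 : nParticle μ s 0)).symm
    | succ n => exact map_add (createN s ψ n) _ _
  map_smul' := by
    intro c a
    apply Subtype.ext; apply Fock.ext; intro n
    cases n with
    | zero => exact (smul_zero (A := nParticle μ s 0) c).symm
    | succ n => exact map_smul (createN s ψ n) c _

variable {μ} in
/-- The annihilation operator `z(ψ)` on finite particle vectors, the restriction to these of the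
adjoint of `z†(ψ̄)`. -/
noncomputable def annihilation (ψ : Lp ℂ 2 μ) :
    finiteParticle μ s →ₗ[ℂ] finiteParticle μ s where
  toFun Φ := ofComponents μ s (fun n => annihilateN s ψ n ((Φ : Fock μ s).component (n + 1))) (by
    obtain ⟨N, hN⟩ := Φ.2
    exact ⟨N, fun n hn => by rw [hN (n + 1) (by omega), map_zero]⟩)
  map_add' := by
    intro a b
    apply Subtype.ext; apply Fock.ext; intro n
    exact map_add (annihilateN s ψ n) _ _
  map_smul' := by
    intro c a
    apply Subtype.ext; apply Fock.ext; intro n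
    exact map_smul (annihilateN s ψ n) c _

variable {μ} in
/-- `annihilation ψ` is the adjoint of `creation ψ̄` on the finite particle vectors. -/
theorem inner_creation_eq_inner_annihilation (ψ : Lp ℂ 2 μ) (Φ Ψ : finiteParticle μ s) :
    inner ℂ (creation s (star ψ) Φ : Fock μ s) (Ψ : Fock μ s) =
      inner ℂ (Φ : Fock μ s) (annihilation s ψ Ψ : Fock μ s) := by
  have hl := lp.inner_eq_tsum (𝕜 := ℂ) (G := fun n : ℕ => nParticle μ s n)
    (creation s (star ψ) Φ : Fock μ s) (Ψ : Fock μ s)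
  have hr := lp.inner_eq_tsum (𝕜 := ℂ) (G := fun n : ℕ => nParticle μ s n)
    (Φ : Fock μ s) (annihilation s ψ Ψ : Fock μ s)
  refine hl.trans (Eq.trans ?_ hr.symm)
  have hs := lp.summable_inner (𝕜 := ℂ) (G := fun n : ℕ => nParticle μ s n)
    (creation s (star ψ) Φ : Fock μ s) (Ψ : Fock μ s)
  rw [hs.tsum_eq_zero_add]
  have h0 : inner ℂ ((creation s (star ψ) Φ : Fock μ s).component 0)
    ((Ψ : Fock μ s).component 0) = 0 := inner_zero_left _
  refine (congrArg (· + _) h0).trans ((zero_add _).trans ?_)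
  apply tsum_congr
  intro n
  exact (ContinuousLinearMap.adjoint_inner_right (createN s (star ψ) n) _ _).symm

/-! ### Operators on the Fock space that act particle number by particle number -/

variable {μ s} in
/-- The operator `(TΨ)_n = T_n Ψ_n`, for (anti)linear isometries `T_n` of the `n`-particle
spaces. -/
noncomputable def fockMap {σ : ℂ →+* ℂ} (T : ∀ n, nParticle μ s n →ₛₗᵢ[σ] nParticle μ s n) :
    Fock μ s →ₛₗᵢ[σ] Fock μ s where
  toFun Ψ := (⟨fun n => T n (Ψ.component n), by
    have h := lp.memℓp (show lp (fun n : ℕ => nParticle μ s n) 2 from Ψ)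
    rw [memℓp_gen_iff (by simp)] at h
    apply memℓp_gen
    simp only [LinearIsometry.norm_map]
    exact h⟩ : lp (fun n : ℕ => nParticle μ s n) 2)
  map_add' Ψ Φ := by
    apply Fock.ext; intro n
    exact map_add (T n) _ _
  map_smul' c Ψ := by
    apply Fock.ext; intro n
    exact (T n).map_smulₛₗ c _
  norm_map' Ψ := by
    refine (lp.norm_eq_tsum_rpow (E := fun n : ℕ => nParticle μ s n) (by simp) _).trans
      (Eq.trans ?_ (lp.norm_eq_tsum_rpow (E := fun n : ℕ => nParticle μ s n) (by simp) Ψ).symm)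
    congr 2
    funext n
    exact congrArg (· ^ ENNReal.toReal 2) ((T n).norm_map (Ψ.component n))

variable {μ s} in
/-- The restriction of `fockMap T` to the finite particle vectors. -/
noncomputable def fockMapFinite {σ : ℂ →+* ℂ}
    (T : ∀ n, nParticle μ s n →ₛₗᵢ[σ] nParticle μ s n) :
    finiteParticle μ s →ₛₗ[σ] finiteParticle μ s where
  toFun Ψ := ⟨fockMap T Ψ, by
    obtain ⟨N, hN⟩ := Ψ.2
    refine ⟨N, fun n hn => ?_⟩
    change T n ((Ψ : Fock μ s).component n) = 0
    rw [hN n hn, map_zero]⟩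
  map_add' Ψ Φ := Subtype.ext (map_add (fockMap T) _ _)
  map_smul' c Ψ := Subtype.ext ((fockMap T).map_smulₛₗ c _)

variable {μ s} in
/-- An (anti)linear isometry of `L²(ℝⁿ, μⁿ)` that preserves the `n`-particle space, restricted to
it. -/
noncomputable def restrictNParticle {σ : ℂ →+* ℂ} {n : ℕ} (T : L2Power μ n →ₛₗᵢ[σ] L2Power μ n)
    (hT : ∀ Ψ ∈ nParticle μ s n, T Ψ ∈ nParticle μ s n) :
    nParticle μ s n →ₛₗᵢ[σ] nParticle μ s n where
  toFun Ψ := ⟨T Ψ, hT Ψ Ψ.2⟩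
  map_add' _ _ := Subtype.ext (map_add T _ _)
  map_smul' c _ := Subtype.ext (T.map_smulₛₗ c _)
  norm_map' _ := T.norm_map _

/-- `Ψ_n ↦ εⁿ Ψ_n` on the `n`-particle space. -/
noncomputable def numberPowN (ε : ℂ) (hε : ‖ε‖ = 1) (n : ℕ) :
    nParticle μ s n →ₗᵢ[ℂ] nParticle μ s n where
  toLinearMap := ε ^ n • LinearMap.id
  norm_map' Ψ := by simp [norm_smul, hε]

/-- The operator `ε^N` on the Fock space, where `N` is the particle number operator. -/
noncomputable def numberPow (ε : ℂ) (hε : ‖ε‖ = 1) : Fock μ s →ₗᵢ[ℂ] Fock μ s :=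
  fockMap (numberPowN μ s ε hε)

/-- The restriction of `ε^N` to the finite particle vectors. -/
noncomputable def numberPowFinite (ε : ℂ) (hε : ‖ε‖ = 1) :
    finiteParticle μ s →ₗ[ℂ] finiteParticle μ s :=
  fockMapFinite (numberPowN μ s ε hε)

/-- The second quantized operator
`Ψ_n(p_1,…,p_n) ↦ exp(i ∑_j w(p_j)) Ψ_n(b p_1,…,b p_n)` on `L²(ℝⁿ, μⁿ)`. -/
noncomputable def symmetryL2 (w : ℝ → ℝ) (hw : Measurable w) (b : ℝ → ℝ)
    (hb : MeasurePreserving b μ μ) (n : ℕ) : L2Power μ n →ₗᵢ[ℂ] L2Power μ n :=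
  weightedComp (fun p : Fin n → ℝ => Complex.exp (Complex.I * ((∑ j, w (p j) : ℝ) : ℂ)))
    (Complex.measurable_exp.comp (measurable_const.mul (Complex.measurable_ofReal.comp
      (Finset.measurable_sum _ fun j _ => hw.comp (measurable_pi_apply j)))))
    (fun p => by rw [mul_comm]; exact Complex.norm_exp_ofReal_mul_I _)
    (fun p j => b (p j)) (measurePreserving_pi _ _ fun _ => hb)

theorem symmetryL2_mem (w : ℝ → ℝ) (hw : Measurable w) (b : ℝ → ℝ)
    (hb : MeasurePreserving b μ μ) (hs : ∀ p q, s.toFun (b p) (b q) = s.toFun p q) (n : ℕ) :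
    ∀ Ψ ∈ nParticle μ s n, symmetryL2 μ w hw b hb n Ψ ∈ nParticle μ s n := by
  intro Ψ hΨ
  rw [mem_nParticle_iff] at hΨ ⊢
  intro j hj
  have hc : symmetryL2 μ w hw b hb n Ψ =ᵐ[_] _ := coeFn_weightedComp _ _ _ Ψ
  have hmp := measurePreserving_perm μ (n := n) (Equiv.swap ⟨j, by omega⟩ ⟨j + 1, hj⟩)
  have hmb := measurePreserving_pi (fun _ : Fin n => μ) (fun _ : Fin n => μ) (fun _ => hb)
  filter_upwards [hc, hmp.quasiMeasurePreserving.ae hc,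
    hmb.quasiMeasurePreserving.ae (hΨ j hj)] with p h1 h2 h3
  rw [h1, h2, ← h3, hs]
  have : ∑ i, w (p (Equiv.swap (⟨j, by omega⟩ : Fin n) ⟨j + 1, hj⟩ i)) = ∑ i, w (p i) :=
    Equiv.sum_comp (Equiv.swap (⟨j, by omega⟩ : Fin n) ⟨j + 1, hj⟩) fun i => w (p i)
  rw [this]
  ring

/-- The reflection `Ψ_n(p_1,…,p_n) ↦ conj Ψ_n(p_n,…,p_1)` on `L²(ℝⁿ, μⁿ)`. -/
noncomputable def reflectionL2 (n : ℕ) : L2Power μ n →ₛₗᵢ[starRingEnd ℂ] L2Power μ n :=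
  conjComp (fun p j => p (Fin.revPerm j)) (measurePreserving_perm μ Fin.revPerm)

theorem reflectionL2_mem (n : ℕ) :
    ∀ Ψ ∈ nParticle μ s n, reflectionL2 μ n Ψ ∈ nParticle μ s n := by
  intro Ψ hΨ
  rw [mem_nParticle_iff] at hΨ ⊢
  intro j hj
  have hc : reflectionL2 μ n Ψ =ᵐ[_] _ := coeFn_conjComp _ Ψ
  have hmp := measurePreserving_perm μ (n := n) (Equiv.swap ⟨j, by omega⟩ ⟨j + 1, hj⟩)
  have hmr := measurePreserving_perm μ (n := n) Fin.revPerm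
  have hj' : (n - 2 - j) + 1 < n := by omega
  filter_upwards [hc, hmp.quasiMeasurePreserving.ae hc,
    hmr.quasiMeasurePreserving.ae (hΨ (n - 2 - j) hj')] with p h1 h2 h3
  rw [h1, h2, ← h3]
  have e1 : Fin.revPerm (⟨n - 2 - j + 1, hj'⟩ : Fin n) = ⟨j, by omega⟩ := by
    apply Fin.ext; simp [Fin.revPerm, Fin.rev]; omega
  have e2 : Fin.revPerm (⟨n - 2 - j, by omega⟩ : Fin n) = ⟨j + 1, hj⟩ := by
    apply Fin.ext; simp [Fin.revPerm, Fin.rev]; omega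
  have e3 : ∀ i, Fin.revPerm (Equiv.swap (⟨n - 2 - j, by omega⟩ : Fin n) ⟨n - 2 - j + 1, hj'⟩ i) =
      Equiv.swap (⟨j, by omega⟩ : Fin n) ⟨j + 1, hj⟩ (Fin.revPerm i) := by
    intro i
    rw [← e1, ← e2, Equiv.swap_comm (Fin.revPerm _) (Fin.revPerm _)]
    exact ((Fin.revPerm (n := n)).injective.swap_apply _ _ _).symm
  rw [e1, e2]
  simp only [e3]
  rw [map_mul, s.conj_symm]

/-- The second quantized symmetry operator
`(UΨ)_n(p_1,…,p_n) = exp(i ∑_j w(p_j)) Ψ_n(b p_1,…,b p_n)` on the Fock space. -/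
noncomputable def symmetry (w : ℝ → ℝ) (hw : Measurable w) (b : ℝ → ℝ)
    (hb : MeasurePreserving b μ μ) (hs : ∀ p q, s.toFun (b p) (b q) = s.toFun p q) :
    Fock μ s →ₗᵢ[ℂ] Fock μ s :=
  fockMap fun n => restrictNParticle (symmetryL2 μ w hw b hb n) (symmetryL2_mem μ s w hw b hb hs n)

/-- The antiunitary reflection `(U(j)Ψ)_n(p_1,…,p_n) = conj Ψ_n(p_n,…,p_1)` on the Fock space. -/
noncomputable def reflection : Fock μ s →ₛₗᵢ[starRingEnd ℂ] Fock μ s :=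
  fockMap fun n => restrictNParticle (reflectionL2 μ n) (reflectionL2_mem μ s n)

/-- The restriction of the reflection to the finite particle vectors. -/
noncomputable def reflectionFinite :
    finiteParticle μ s →ₛₗ[starRingEnd ℂ] finiteParticle μ s :=
  fockMapFinite fun n => restrictNParticle (reflectionL2 μ n) (reflectionL2_mem μ s n)

variable {μ s} in
/-- The conjugated operator `U(j) A U(j)` on the finite particle vectors; note
`U(j)⁻¹ = U(j)`. -/
noncomputable def reflected (A : finiteParticle μ s →ₗ[ℂ] finiteParticle μ s) :
    finiteParticle μ s →ₗ[ℂ] finiteParticle μ s :=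
  (reflectionFinite μ s).comp (A.comp (reflectionFinite μ s))

end Fock

end Zamolodchikov

namespace Zamolodchikov

/-! ### Hilbert tensor products -/

section Tensor

open scoped TensorProduct

/-- The Hilbert space tensor product: the completion of the algebraic tensor product. -/
abbrev HilbertTensor (E F : Type*) [NormedAddCommGroup E] [InnerProductSpace ℂ E]
    [NormedAddCommGroup F] [InnerProductSpace ℂ F] : Type _ :=
  UniformSpace.Completion (E ⊗[ℂ] F)

variable {E F : Type*} [NormedAddCommGroup E] [InnerProductSpace ℂ E]
    [NormedAddCommGroup F] [InnerProductSpace ℂ F]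

/-- `A ⊗ B` on the Hilbert tensor product, for bounded linear operators `A`, `B`. -/
noncomputable def tensorOp (A : E →L[ℂ] E) (B : F →L[ℂ] F) :
    HilbertTensor E F →L[ℂ] HilbertTensor E F :=
  (TensorProduct.mapL A B).completion

theorem inner_antilinear (A : E →ₛₗᵢ[starRingEnd ℂ] E) (u v : E) :
    inner ℂ (A u) (A v) = conj (inner ℂ u v) := by
  rw [inner_eq_sum_norm_sq_div_four, inner_eq_sum_norm_sq_div_four u v]
  have hI : ∀ w : E, (RCLike.I : ℂ) • A w = - A ((RCLike.I : ℂ) • w) := by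
    intro w
    rw [A.map_smulₛₗ]; simp
  have h4 : conj (4 : ℂ) = 4 := map_ofNat (starRingEnd ℂ) 4
  rw [hI, ← map_add, ← map_sub, sub_neg_eq_add, ← sub_eq_add_neg, ← map_add, ← map_sub]
  simp only [LinearIsometry.norm_map]
  simp [h4]
  ring

theorem inner_map_antilinear (A : E →ₛₗᵢ[starRingEnd ℂ] E) (B : F →ₛₗᵢ[starRingEnd ℂ] F)
    (x y : E ⊗[ℂ] F) :
    inner ℂ (TensorProduct.map A.toLinearMap B.toLinearMap x)
      (TensorProduct.map A.toLinearMap B.toLinearMap y) = conj (inner ℂ x y) := by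
  induction x using TensorProduct.induction_on with
  | zero => simp
  | add a b ha hb => rw [map_add, inner_add_left, ha, hb, inner_add_left, map_add]
  | tmul a b =>
    induction y using TensorProduct.induction_on with
    | zero => simp
    | add c d hc hd => rw [map_add, inner_add_right, hc, hd, inner_add_right, map_add]
    | tmul c d =>
      rw [TensorProduct.map_tmul, TensorProduct.map_tmul, TensorProduct.inner_tmul,
        TensorProduct.inner_tmul, map_mul]
      exact congrArg₂ (· * ·) (inner_antilinear A a c) (inner_antilinear B b d)

/-- `A ⊗ B` on the algebraic tensor product, for antilinear isometries `A`, `B`. -/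
noncomputable def antitensorAlg (A : E →ₛₗᵢ[starRingEnd ℂ] E) (B : F →ₛₗᵢ[starRingEnd ℂ] F) :
    (E ⊗[ℂ] F) →ₛₗᵢ[starRingEnd ℂ] (E ⊗[ℂ] F) where
  toLinearMap := TensorProduct.map A.toLinearMap B.toLinearMap
  norm_map' x := by
    have h := inner_map_antilinear A B x x
    have h5 := inner_self_eq_norm_sq_to_K (𝕜 := ℂ) x
    have h6 := inner_self_eq_norm_sq_to_K (𝕜 := ℂ)
      (TensorProduct.map A.toLinearMap B.toLinearMap x)
    rw [h5] at h
    have h := h6.symm.trans h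
    have h2 : ‖TensorProduct.map A.toLinearMap B.toLinearMap x‖ ^ 2 = ‖x‖ ^ 2 := by
      have h3 : conj (((‖x‖ : ℝ) : ℂ) ^ 2) = ((‖x‖ : ℝ) : ℂ) ^ 2 := by simp
      have h7 := h.trans h3
      exact Complex.ofReal_injective (by push_cast; exact h7)
    exact (sq_eq_sq₀ (norm_nonneg _) (norm_nonneg _)).1 h2

/-- `A ⊗ B` on the Hilbert tensor product, for antilinear isometries `A`, `B`. -/
noncomputable def antitensorOp (A : E →ₛₗᵢ[starRingEnd ℂ] E) (B : F →ₛₗᵢ[starRingEnd ℂ] F) :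
    HilbertTensor E F →SL[starRingEnd ℂ] HilbertTensor E F :=
  (antitensorAlg A B).toContinuousLinearMap.completion

/-- The inclusion of the algebraic tensor product `D ⊗ D'` of two subspaces into the Hilbert
tensor product. -/
noncomputable def tensorIncl (D : Submodule ℂ E) (D' : Submodule ℂ F) :
    (D ⊗[ℂ] D') →ₗ[ℂ] HilbertTensor E F :=
  (UniformSpace.Completion.toComplL (𝕜 := ℂ) (E := E ⊗[ℂ] F)).toLinearMap ∘ₗ
    TensorProduct.mapIncl D D'

/-- `½ (1 ⊗ 1 + A ⊗ 1 + 1 ⊗ B - A ⊗ B)`. -/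
noncomputable def parityTwist (A : E →L[ℂ] E) (B : F →L[ℂ] F) :
    HilbertTensor E F →L[ℂ] HilbertTensor E F :=
  (1 / 2 : ℂ) • (ContinuousLinearMap.id ℂ _ + tensorOp A (ContinuousLinearMap.id ℂ F)
    + tensorOp (ContinuousLinearMap.id ℂ E) B - tensorOp A B)

theorem parityTwist_tmul {A : E →L[ℂ] E} {B : F →L[ℂ] F} {x : E} {y : F} {a b : ℂ}
    (hx : A x = a • x) (hy : B y = b • y) :
    parityTwist A B ((x ⊗ₜ[ℂ] y : E ⊗[ℂ] F) : HilbertTensor E F) =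
      (1 / 2 * (1 + a + b - a * b)) • ((x ⊗ₜ[ℂ] y : E ⊗[ℂ] F) : HilbertTensor E F) := by
  simp only [parityTwist, tensorOp, smul_apply, sub_apply, add_apply,
    ContinuousLinearMap.id_apply, ContinuousLinearMap.completion_apply_coe,
    TensorProduct.mapL_tmul, hx, hy, TensorProduct.tmul_smul,
    ← TensorProduct.smul_tmul', UniformSpace.Completion.coe_smul]
  module

end Tensor

section Twist

open scoped TensorProduct

variable (μ : Measure ℝ) [SigmaFinite μ] (s : ExchangeFactor)

/-- For a sign `ε = ±1`, the operator `ε^{N ⊗ N}` on the tensor square of a Fock space. As the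
parity of `n m` is determined by the parities of `n` and `m`, it is
`½ (1 ⊗ 1 + ε^N ⊗ 1 + 1 ⊗ ε^N - ε^N ⊗ ε^N)`. -/
noncomputable def doubleNumberPow (ε : ℂ) (hε : ‖ε‖ = 1) :
    HilbertTensor (Fock μ s) (Fock μ s) →L[ℂ] HilbertTensor (Fock μ s) (Fock μ s) :=
  parityTwist (numberPow μ s ε hε).toContinuousLinearMap
    (numberPow μ s ε hε).toContinuousLinearMap

theorem numberPow_single (ε : ℂ) (hε : ‖ε‖ = 1) (n : ℕ) (Ψ : nParticle μ s n) :
    numberPow μ s ε hε (Fock.single μ s n Ψ) = ε ^ n • Fock.single μ s n Ψ := by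
  apply Fock.ext
  intro m
  change ε ^ m • (Fock.single μ s n Ψ).component m = ε ^ n • (Fock.single μ s n Ψ).component m
  by_cases h : m = n
  · rw [h]
  · have hz : (Fock.single μ s n Ψ).component m = 0 :=
      lp.single_apply_ne (E := fun n => nParticle μ s n) 2 n Ψ h
    rw [hz, smul_zero, smul_zero]

/-- `ε^{N ⊗ N}` acts on `n`- and `m`-particle vectors as multiplication by `ε^{n m}`. -/
theorem doubleNumberPow_single_tmul (ε : ℂ) (hε : ‖ε‖ = 1) (hε2 : ε ^ 2 = 1) (n m : ℕ)
    (Ψ : nParticle μ s n) (Φ : nParticle μ s m) :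
    doubleNumberPow μ s ε hε
        ((Fock.single μ s n Ψ ⊗ₜ[ℂ] Fock.single μ s m Φ :
          Fock μ s ⊗[ℂ] Fock μ s) : HilbertTensor (Fock μ s) (Fock μ s)) =
      ε ^ (n * m) • ((Fock.single μ s n Ψ ⊗ₜ[ℂ] Fock.single μ s m Φ :
          Fock μ s ⊗[ℂ] Fock μ s) : HilbertTensor (Fock μ s) (Fock μ s)) := by
  rw [doubleNumberPow, parityTwist_tmul (a := ε ^ n) (b := ε ^ m)
    (numberPow_single μ s ε hε n Ψ) (numberPow_single μ s ε hε m Φ)]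
  congr 1
  rcases Nat.even_or_odd n with ⟨k, hk⟩ | ⟨k, hk⟩
  · have e1 : ε ^ n = 1 := by rw [hk, ← two_mul, pow_mul, hε2, one_pow]
    rw [pow_mul, e1, one_pow]; ring
  · have e1 : ε ^ n = ε := by rw [hk, pow_add, pow_mul, hε2, one_pow, one_mul, pow_one]
    rw [pow_mul, e1]
    rcases Nat.even_or_odd m with ⟨l, hl⟩ | ⟨l, hl⟩
    · have e2 : ε ^ m = 1 := by rw [hl, ← two_mul, pow_mul, hε2, one_pow]
      rw [e2]; ring
    · have e2 : ε ^ m = ε := by rw [hl, pow_add, pow_mul, hε2, one_pow, one_mul, pow_one]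
      rw [e2]
      linear_combination (-1 / 2 : ℂ) * hε2

end Twist

end Zamolodchikov

namespace Zamolodchikov

open scoped SchwartzMap

variable (S : ScatteringFunctionWithLimit)

/-! ### Test functions -/

/-- `f^j(x) = conj f(-x)`. -/
noncomputable def reflectTest {E : Type*} [NormedAddCommGroup E] [NormedSpace ℝ E]
    (f : 𝓢(E, ℂ)) : 𝓢(E, ℂ) :=
  SchwartzMap.postcompCLM (𝕜 := ℝ) (Complex.conjCLE : ℂ →L[ℝ] ℂ)
    (SchwartzMap.compCLMOfContinuousLinearEquiv ℝ (ContinuousLinearEquiv.neg ℝ) f)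

theorem reflectTest_apply {E : Type*} [NormedAddCommGroup E] [NormedSpace ℝ E]
    (f : 𝓢(E, ℂ)) (x : E) : reflectTest f x = conj (f (-x)) := rfl

/-- `σ i e^β (2π)^{-1/2} ∫ f(ξ) exp(σ i e^β ξ) dξ`; for `σ = ±1` this is the frequency component
`f̂^±(β)`. -/
noncomputable def hatFun (σ : ℝ) (f : 𝓢(ℝ, ℂ)) (β : ℝ) : ℂ :=
  σ * Complex.I * Real.exp β / Real.sqrt (2 * Real.pi) *
    ∫ ξ : ℝ, f ξ * Complex.exp (σ * Complex.I * Real.exp β * ξ)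

theorem memLp_hatFun {σ : ℝ} (hσ : |σ| = 1) (f : 𝓢(ℝ, ℂ)) : MemLp (hatFun σ f) 2 volume := by
  set F : 𝓢(ℝ, ℂ) := FourierTransform.fourier f with hF
  have hpi := Real.pi_pos
  have hint : ∀ β : ℝ, ∫ ξ : ℝ, f ξ * Complex.exp (σ * Complex.I * Real.exp β * ξ) =
      F (-(σ * Real.exp β / (2 * Real.pi))) := by
    intro β
    rw [hF, SchwartzMap.fourier_coe, Real.fourier_eq']
    congr 1
    funext ξ
    rw [smul_eq_mul, mul_comm]
    congr 2
    have : ((2 * Real.pi : ℝ) : ℂ) ≠ 0 := by exact_mod_cast (by positivity : (2 * Real.pi) ≠ 0)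
    simp only [RCLike.inner_apply, conj_trivial]
    push_cast
    field_simp
  have hform : hatFun σ f = fun β : ℝ => σ * Complex.I * Real.exp β / Real.sqrt (2 * Real.pi) *
      F (-(σ * Real.exp β / (2 * Real.pi))) := by
    funext β
    rw [hatFun, hint]
  have hcont : Continuous (hatFun σ f) := by
    rw [hform]
    have := F.continuous
    fun_prop
  obtain ⟨C₀, hC₀⟩ := F.decay 0 0
  obtain ⟨C₂, hC₂⟩ := F.decay 2 0
  simp only [pow_zero, one_mul, norm_iteratedFDeriv_zero] at hC₀ hC₂
  set C : ℝ := C₀ + (2 * Real.pi) ^ 2 * C₂ with hC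
  have hC₀0 : 0 ≤ C₀ := (norm_nonneg _).trans (hC₀.2 0)
  have hC₂0 : 0 ≤ C₂ := (by positivity : (0 : ℝ) ≤ _).trans (hC₂.2 0)
  have hbound : ∀ β : ℝ, ‖hatFun σ f β‖ ≤ C * Real.exp (-|β|) := by
    intro β
    have hs : (1 : ℝ) ≤ Real.sqrt (2 * Real.pi) := by
      rw [Real.one_le_sqrt]; nlinarith [Real.pi_gt_three]
    set w := -(σ * Real.exp β / (2 * Real.pi)) with hw
    have hn : ‖hatFun σ f β‖ ≤ Real.exp β * ‖F w‖ := by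
      rw [hform]
      simp only [norm_mul, norm_div, Complex.norm_real, Complex.norm_I, Real.norm_eq_abs, hσ,
        Real.abs_exp, mul_one, one_mul, abs_of_nonneg (Real.sqrt_nonneg _)]
      rw [hw]
      gcongr
      exact div_le_self (Real.exp_pos _).le hs
    have hwn : ‖w‖ = Real.exp β / (2 * Real.pi) := by
      rw [hw, norm_neg, Real.norm_eq_abs, abs_div, abs_mul, hσ, Real.abs_exp, one_mul,
        abs_of_pos (by positivity)]
    refine hn.trans ?_
    rcases le_total β 0 with hβ | hβ
    · rw [abs_of_nonpos hβ, neg_neg, mul_comm]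
      have := hC₀.2 w
      gcongr
      rw [hC]
      nlinarith [sq_nonneg (2 * Real.pi)]
    · rw [abs_of_nonneg hβ]
      have h2 := hC₂.2 w
      rw [hwn] at h2
      have h3 : Real.exp β * ‖F w‖ =
          (2 * Real.pi) ^ 2 * ((Real.exp β / (2 * Real.pi)) ^ 2 * ‖F w‖) * Real.exp (-β) := by
        rw [Real.exp_neg]
        field_simp
      rw [h3]
      gcongr
      rw [hC]
      nlinarith [sq_nonneg (2 * Real.pi)]
  rw [memLp_two_iff_integrable_sq_norm hcont.aestronglyMeasurable]
  have hint2 : Integrable (fun β : ℝ => C ^ 2 * 2 * (1 + β ^ 2)⁻¹) volume :=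
    integrable_inv_one_add_sq.const_mul _
  refine hint2.mono' (by fun_prop) (Eventually.of_forall fun β => ?_)
  have h1 := hbound β
  have hexp : Real.exp (-|β|) ≤ 2 * (1 + β ^ 2)⁻¹ := by
    have h2 := Real.quadratic_le_exp_of_nonneg (abs_nonneg β)
    rw [sq_abs] at h2
    rw [Real.exp_neg, ← div_eq_mul_inv, inv_eq_one_div, div_le_div_iff₀ (Real.exp_pos _)
      (by positivity)]
    nlinarith [abs_nonneg β]
  have hexp1 : Real.exp (-|β|) ≤ 1 := Real.exp_le_one_iff.2 (by simp)
  have hexp0 := Real.exp_pos (-|β|)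
  rw [Real.norm_eq_abs, abs_of_nonneg (by positivity)]
  calc ‖hatFun σ f β‖ ^ 2 ≤ (C * Real.exp (-|β|)) ^ 2 := by gcongr
    _ = C ^ 2 * (Real.exp (-|β|) * Real.exp (-|β|)) := by ring
    _ ≤ C ^ 2 * (1 * (2 * (1 + β ^ 2)⁻¹)) := by gcongr
    _ = C ^ 2 * 2 * (1 + β ^ 2)⁻¹ := by ring

/-- `f̂^+` as a vector of `L²(ℝ, dβ)`. -/
noncomputable def hatPlus (f : 𝓢(ℝ, ℂ)) : Lp ℂ 2 (volume : Measure ℝ) :=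
  (memLp_hatFun (σ := 1) (by simp) f).toLp

/-- `f̂^-` as a vector of `L²(ℝ, dβ)`. -/
noncomputable def hatMinus (f : 𝓢(ℝ, ℂ)) : Lp ℂ 2 (volume : Measure ℝ) :=
  (memLp_hatFun (σ := -1) (by simp) f).toLp

/-- `(2π)⁻¹ ∫ f(x) exp(σ i (|p| x₀ - p x₁)) d²x`; for `σ = ±1` this is `f^{0±}(p)`, the
restriction of the Fourier transform of `f` to the upper or lower light cone. -/
noncomputable def massShell (σ : ℝ) (f : 𝓢(ℝ × ℝ, ℂ)) (p : ℝ) : ℂ :=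
  1 / (2 * Real.pi) *
    ∫ x : ℝ × ℝ, f x * Complex.exp (σ * Complex.I * (|p| * x.1 - p * x.2 : ℝ))

/-- `g_l(ξ) = ½ ∫ g((ξ+ξ')/2, (ξ-ξ')/2) dξ'`. -/
noncomputable def leftTest (g : ℝ × ℝ → ℂ) (ξ : ℝ) : ℂ :=
  1 / 2 * ∫ ξ' : ℝ, g ((ξ + ξ') / 2, (ξ - ξ') / 2)

/-- `g_r(ξ) = ½ ∫ g((ξ+ξ')/2, (ξ'-ξ)/2) dξ'`. -/
noncomputable def rightTest (g : ℝ × ℝ → ℂ) (ξ : ℝ) : ℂ :=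
  1 / 2 * ∫ ξ' : ℝ, g ((ξ + ξ') / 2, (ξ' - ξ) / 2)

/-- The coordinate directions of `ℝ²`: `0` is time, `1` is space. -/
def coordVec (k : Fin 2) : ℝ × ℝ := if k = 0 then (1, 0) else (0, 1)

/-! ### The chiral model -/

/-- The exchange factor `(β, β') ↦ S(β - β')`. -/
noncomputable def chiralFactor : ExchangeFactor where
  toFun β β' := S.onReal (β - β')
  measurable := (S.continuous_onReal.comp (continuous_fst.sub continuous_snd)).measurable
  norm_eq_one _ _ := S.norm_onReal _
  conj_symm β β' := by rw [S.conj_onReal, neg_sub]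

/-- The `S`-symmetric Fock space over `L²(ℝ, dβ)`. -/
abbrev ChiralFock : Type := Fock volume (chiralFactor S)

/-- The finite particle vectors of the chiral Fock space. -/
noncomputable abbrev ChiralFinite : Submodule ℂ (ChiralFock S) := finiteParticle volume (chiralFactor S)

/-- `(U(ξ,lam)Ψ)_n(β_1,…,β_n) = exp(iξ(e^{β_1}+…+e^{β_n})) Ψ_n(β_1+lam,…,β_n+lam)`. -/
noncomputable def chiralU (ξ lam : ℝ) : ChiralFock S →ₗᵢ[ℂ] ChiralFock S :=
  symmetry volume (chiralFactor S) (fun β => ξ * Real.exp β) (by fun_prop) (fun β => β + lam)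
    (measurePreserving_add_right volume lam) (fun β β' => by simp [chiralFactor])

/-- `(U(j)Ψ)_n(β_1,…,β_n) = conj Ψ_n(β_n,…,β_1)`. -/
noncomputable def chiralUj : ChiralFock S →ₛₗᵢ[starRingEnd ℂ] ChiralFock S :=
  reflection volume (chiralFactor S)

/-- `S(∞)^N` on the chiral Fock space. -/
noncomputable def chiralNumberPow : ChiralFinite S →ₗ[ℂ] ChiralFinite S :=
  numberPowFinite volume (chiralFactor S) S.atInfinity S.norm_atInfinity

/-- The chiral creation operator `y†(ψ)`. -/
noncomputable def yDagger (ψ : Lp ℂ 2 (volume : Measure ℝ)) : ChiralFinite S →ₗ[ℂ] ChiralFinite S :=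
  creation (chiralFactor S) ψ

/-- The chiral annihilation operator `y(ψ)`. -/
noncomputable def yOp (ψ : Lp ℂ 2 (volume : Measure ℝ)) : ChiralFinite S →ₗ[ℂ] ChiralFinite S :=
  annihilation (chiralFactor S) ψ

/-- `y†(ψ)' = U(j) y†(ψ̄) U(j)`. -/
noncomputable def yDaggerPrime (ψ : Lp ℂ 2 (volume : Measure ℝ)) :
    ChiralFinite S →ₗ[ℂ] ChiralFinite S :=
  reflected (yDagger S (star ψ))

/-- The half-line field `φ(f) = y†(f̂^+) + y(f̂^-)`. -/
noncomputable def chiralField (f : 𝓢(ℝ, ℂ)) : ChiralFinite S →ₗ[ℂ] ChiralFinite S :=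
  yDagger S (hatPlus f) + yOp S (hatMinus f)

/-- The opposite half-line field `φ'(f) = U(j) φ(f^j) U(j)`. -/
noncomputable def chiralFieldPrime (f : 𝓢(ℝ, ℂ)) : ChiralFinite S →ₗ[ℂ] ChiralFinite S :=
  reflected (chiralField S (reflectTest f))

/-! ### The massless two-dimensional model -/

/-- The measure `dp/|p|` on the real line. -/
noncomputable def masslessMeasure : Measure ℝ :=
  volume.withDensity fun p => ENNReal.ofReal |p|⁻¹

noncomputable instance instSigmaFiniteMasslessMeasure : SigmaFinite masslessMeasure :=
  SigmaFinite.withDensity_ofReal _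

theorem masslessMeasure_restrict_Ioi :
    masslessMeasure.restrict (Set.Ioi 0) = volume.map Real.exp := by
  ext t ht
  rw [Measure.restrict_apply ht, Measure.map_apply Real.measurable_exp ht, masslessMeasure,
    withDensity_apply _ (ht.inter measurableSet_Ioi)]
  have himg : t ∩ Set.Ioi 0 = Real.exp '' (Real.exp ⁻¹' t) := by
    rw [Set.image_preimage_eq_inter_range, Real.range_exp]
  rw [himg, lintegral_image_eq_lintegral_abs_deriv_mul (Real.measurable_exp ht)
    (fun x _ => (Real.hasDerivAt_exp x).hasDerivWithinAt) Real.exp_injective.injOn]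
  have : ∀ x : ℝ, ENNReal.ofReal |Real.exp x| * ENNReal.ofReal |Real.exp x|⁻¹ = 1 := by
    intro x
    rw [← ENNReal.ofReal_mul (abs_nonneg _), mul_inv_cancel₀ (by positivity), ENNReal.ofReal_one]
  simp only [this, setLIntegral_one]

theorem masslessMeasure_restrict_Iio :
    masslessMeasure.restrict (Set.Iio 0) = volume.map fun β => -Real.exp β := by
  have hm : Measurable fun β : ℝ => -Real.exp β := by fun_prop
  ext t ht
  rw [Measure.restrict_apply ht, Measure.map_apply hm ht, masslessMeasure,
    withDensity_apply _ (ht.inter measurableSet_Iio)]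
  have himg : t ∩ Set.Iio 0 = (fun β => -Real.exp β) '' ((fun β => -Real.exp β) ⁻¹' t) := by
    rw [Set.image_preimage_eq_inter_range]
    congr 1
    ext p
    constructor
    · intro hp
      exact ⟨Real.log (-p), by
        change -Real.exp (Real.log (-p)) = p
        rw [Real.exp_log (neg_pos.2 hp), neg_neg]⟩
    · rintro ⟨β, rfl⟩
      simp [Real.exp_pos]
  rw [himg, lintegral_image_eq_lintegral_abs_deriv_mul (f := fun β => -Real.exp β) (hm ht)
    (fun x _ => (Real.hasDerivAt_exp x).fun_neg.hasDerivWithinAt)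
    (fun x _ y _ h => Real.exp_injective (neg_injective h))]
  have : ∀ x : ℝ, ENNReal.ofReal |-Real.exp x| * ENNReal.ofReal |-Real.exp x|⁻¹ = 1 := by
    intro x
    rw [← ENNReal.ofReal_mul (abs_nonneg _), mul_inv_cancel₀ (by simp),
      ENNReal.ofReal_one]
  simp only [this, setLIntegral_one]

theorem masslessMeasure_eq :
    masslessMeasure = volume.map Real.exp + volume.map fun β => -Real.exp β := by
  rw [← masslessMeasure_restrict_Ioi, ← masslessMeasure_restrict_Iio]
  have h0 : masslessMeasure {(0 : ℝ)} = 0 :=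
    withDensity_absolutelyContinuous _ _ (measure_singleton 0)
  have hd : Disjoint (Set.Ioi (0 : ℝ)) (Set.Iio 0) :=
    Set.disjoint_left.2 fun x (h1 : 0 < x) (h2 : x < 0) => lt_asymm h1 h2
  rw [← Measure.restrict_union hd measurableSet_Iio]
  have : (Set.Ioi (0 : ℝ) ∪ Set.Iio 0) = {(0 : ℝ)}ᶜ := by
    rw [Set.union_comm, Set.Iio_union_Ioi]
  rw [this, Measure.restrict_eq_self_of_ae_mem]
  exact compl_mem_ae_iff.2 h0

/-- The boosted momentum `θp = cosh θ · p - sinh θ · |p|`. -/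
noncomputable def boost (θ p : ℝ) : ℝ := Real.cosh θ * p - Real.sinh θ * |p|

theorem boost_of_nonneg (θ : ℝ) {p : ℝ} (hp : 0 ≤ p) : boost θ p = Real.exp (-θ) * p := by
  rw [boost, abs_of_nonneg hp, ← sub_mul, Real.cosh_sub_sinh]

theorem boost_of_nonpos (θ : ℝ) {p : ℝ} (hp : p ≤ 0) : boost θ p = Real.exp θ * p := by
  rw [boost, abs_of_nonpos hp, mul_neg, sub_neg_eq_add, ← add_mul, Real.cosh_add_sinh]

theorem boost_pos_iff (θ p : ℝ) : 0 < boost θ p ↔ 0 < p := by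
  rcases le_total 0 p with h | h
  · rw [boost_of_nonneg θ h]; exact mul_pos_iff_of_pos_left (Real.exp_pos _)
  · rw [boost_of_nonpos θ h]; exact mul_pos_iff_of_pos_left (Real.exp_pos _)

theorem boost_neg_iff (θ p : ℝ) : boost θ p < 0 ↔ p < 0 := by
  rcases le_total 0 p with h | h
  · rw [boost_of_nonneg θ h]; exact smul_neg_iff_of_pos_left (Real.exp_pos _)
  · rw [boost_of_nonpos θ h]; exact smul_neg_iff_of_pos_left (Real.exp_pos _)

theorem boost_eq_zero_iff (θ p : ℝ) : boost θ p = 0 ↔ p = 0 := by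
  rcases le_total 0 p with h | h
  · rw [boost_of_nonneg θ h]; simp
  · rw [boost_of_nonpos θ h]; simp

theorem measurable_boost (θ : ℝ) : Measurable (boost θ) := by
  unfold boost; fun_prop

theorem measurePreserving_boost (θ : ℝ) :
    MeasurePreserving (boost θ) masslessMeasure masslessMeasure := by
  refine ⟨measurable_boost θ, ?_⟩
  have hm : Measurable fun β : ℝ => -Real.exp β := by fun_prop
  have h1 : boost θ ∘ Real.exp = Real.exp ∘ fun β => β + -θ := by
    funext β
    simp only [Function.comp_apply, boost_of_nonneg θ (Real.exp_pos β).le]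
    rw [← Real.exp_add, add_comm]
  have h2 : (boost θ ∘ fun β => -Real.exp β) = (fun β => -Real.exp β) ∘ fun β => β + θ := by
    funext β
    simp only [Function.comp_apply, boost_of_nonpos θ (neg_nonpos.2 (Real.exp_pos β).le)]
    rw [mul_neg, ← Real.exp_add, add_comm]
  rw [masslessMeasure_eq, Measure.map_add _ _ (measurable_boost θ),
    Measure.map_map (measurable_boost θ) Real.measurable_exp,
    Measure.map_map (measurable_boost θ) hm, h1, h2,
    ← Measure.map_map Real.measurable_exp (by fun_prop),
    ← Measure.map_map hm (by fun_prop), map_add_right_eq_self, map_add_right_eq_self]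

/-- The massless exchange factor `S_0(p, q)`, the limit of
`S(arsinh((p ω_q - q ω_p) / m²))`, `ω_p = (p² + m²)^{1/2}`, as `m → 0`. -/
noncomputable def masslessFun (p q : ℝ) : ℂ :=
  if 0 < p ∧ 0 < q then S.onReal (Real.log p - Real.log q)
  else if p < 0 ∧ q < 0 then S.onReal (Real.log (-q) - Real.log (-p))
  else if p = 0 ∧ q = 0 then S.onReal 0
  else S.atInfinity

/-- `S_0` as an exchange factor. -/
noncomputable def masslessFactor : ExchangeFactor where
  toFun := masslessFun S
  measurable := by
    have hS := S.continuous_onReal.measurable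
    unfold masslessFun
    refine Measurable.ite ?_ (hS.comp (by fun_prop)) (Measurable.ite ?_ (hS.comp (by fun_prop))
      (Measurable.ite ?_ measurable_const measurable_const))
    · exact (measurableSet_lt measurable_const measurable_fst).inter
        (measurableSet_lt measurable_const measurable_snd)
    · exact (measurableSet_lt measurable_fst measurable_const).inter
        (measurableSet_lt measurable_snd measurable_const)
    · exact (measurableSet_eq_fun measurable_fst measurable_const).inter
        (measurableSet_eq_fun measurable_snd measurable_const)
  norm_eq_one p q := by
    unfold masslessFun
    split_ifs <;> simp only [S.norm_onReal, S.norm_atInfinity]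
  conj_symm p q := by
    unfold masslessFun
    simp only [and_comm (a := 0 < q), and_comm (a := q < 0), and_comm (a := q = 0)]
    split_ifs
    · rw [S.conj_onReal, neg_sub]
    · rw [S.conj_onReal, neg_sub]
    · rw [S.conj_onReal, neg_zero]
    · exact S.conj_atInfinity

theorem masslessFactor_boost (θ p q : ℝ) :
    (masslessFactor S).toFun (boost θ p) (boost θ q) = (masslessFactor S).toFun p q := by
  change masslessFun S _ _ = masslessFun S _ _
  unfold masslessFun
  simp only [boost_pos_iff, boost_neg_iff, boost_eq_zero_iff]
  split_ifs with h1 h2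
  · rw [boost_of_nonneg θ h1.1.le, boost_of_nonneg θ h1.2.le,
      Real.log_mul (Real.exp_pos _).ne' h1.1.ne', Real.log_mul (Real.exp_pos _).ne' h1.2.ne',
      add_sub_add_left_eq_sub]
  · rw [boost_of_nonpos θ h2.1.le, boost_of_nonpos θ h2.2.le, ← mul_neg, ← mul_neg,
      Real.log_mul (Real.exp_pos _).ne' (neg_ne_zero.2 h2.1.ne),
      Real.log_mul (Real.exp_pos _).ne' (neg_ne_zero.2 h2.2.ne), add_sub_add_left_eq_sub]
  · rfl
  · rfl

/-- The `S_0`-symmetric Fock space over `L²(ℝ, dp/|p|)`. -/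
abbrev MasslessFock : Type := Fock masslessMeasure (masslessFactor S)

/-- The finite particle vectors of the massless Fock space. -/
noncomputable abbrev MasslessFinite : Submodule ℂ (MasslessFock S) :=
  finiteParticle masslessMeasure (masslessFactor S)

/-- `(U_0(x,θ)Ψ)_n(p_1,…,p_n) = exp(i ∑_j (|p_j| x₀ - p_j x₁)) Ψ_n(θp_1,…,θp_n)`. -/
noncomputable def masslessU (x : ℝ × ℝ) (θ : ℝ) : MasslessFock S →ₗᵢ[ℂ] MasslessFock S :=
  symmetry masslessMeasure (masslessFactor S) (fun p => |p| * x.1 - p * x.2) (by fun_prop)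
    (boost θ) (measurePreserving_boost θ) (masslessFactor_boost S θ)

/-- `(U_0(j)Ψ)_n(p_1,…,p_n) = conj Ψ_n(p_n,…,p_1)`. -/
noncomputable def masslessUj : MasslessFock S →ₛₗᵢ[starRingEnd ℂ] MasslessFock S :=
  reflection masslessMeasure (masslessFactor S)

/-- The massless creation operator `z_0†(φ)`. -/
noncomputable def zDagger (φ : Lp ℂ 2 masslessMeasure) :
    MasslessFinite S →ₗ[ℂ] MasslessFinite S :=
  creation (masslessFactor S) φ

/-- The massless annihilation operator `z_0(φ)`. -/
noncomputable def zOp (φ : Lp ℂ 2 masslessMeasure) : MasslessFinite S →ₗ[ℂ] MasslessFinite S :=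
  annihilation (masslessFactor S) φ

open Classical in
/-- `f^{0±}` as a single particle vector. It is one only if it is square integrable with respect
to `dp/|p|`, and this fails for general test functions; zero is a placeholder otherwise. -/
noncomputable def massShellVec (σ : ℝ) (f : 𝓢(ℝ × ℝ, ℂ)) : Lp ℂ 2 masslessMeasure :=
  if h : MemLp (massShell σ f) 2 masslessMeasure then h.toLp else 0

/-- The field `φ_0(f) = z_0†(f^{0+}) + z_0(f^{0-})`. -/
noncomputable def masslessField (f : 𝓢(ℝ × ℝ, ℂ)) : MasslessFinite S →ₗ[ℂ] MasslessFinite S :=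
  zDagger S (massShellVec 1 f) + zOp S (massShellVec (-1) f)

/-- The field `φ_0'(f) = U_0(j) φ_0(f^j) U_0(j)⁻¹`. -/
noncomputable def masslessFieldPrime (f : 𝓢(ℝ × ℝ, ℂ)) :
    MasslessFinite S →ₗ[ℂ] MasslessFinite S :=
  reflected (masslessField S (reflectTest f))

/-! ### The two single particle embeddings -/

theorem measurePreserving_log_neg :
    MeasurePreserving (fun p : ℝ => Real.log (-p)) (masslessMeasure.restrict (Set.Iio 0))
      volume := by
  refine ⟨by fun_prop, ?_⟩
  rw [masslessMeasure_restrict_Iio, Measure.map_map (by fun_prop) (by fun_prop)]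
  have : ((fun p : ℝ => Real.log (-p)) ∘ fun β => -Real.exp β) = id := by
    funext β; simp
  rw [this, Measure.map_id]

theorem measurePreserving_log :
    MeasurePreserving Real.log (masslessMeasure.restrict (Set.Ioi 0)) volume := by
  refine ⟨Real.measurable_log, ?_⟩
  rw [masslessMeasure_restrict_Ioi, Measure.map_map Real.measurable_log Real.measurable_exp]
  have : Real.log ∘ Real.exp = id := by
    funext β; simp
  rw [this, Measure.map_id]

theorem memLp_leftEmbed (ψ : Lp ℂ 2 (volume : Measure ℝ)) :
    MemLp (fun p : ℝ => if p < 0 then ψ (Real.log (-p)) else 0) 2 masslessMeasure :=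
  (memLp_indicator_iff_restrict measurableSet_Iio).2
    ((Lp.memLp ψ).comp_measurePreserving measurePreserving_log_neg)

theorem memLp_rightEmbed (ψ : Lp ℂ 2 (volume : Measure ℝ)) :
    MemLp (fun p : ℝ => if 0 < p then ψ (Real.log p) else 0) 2 masslessMeasure :=
  (memLp_indicator_iff_restrict measurableSet_Ioi).2
    ((Lp.memLp ψ).comp_measurePreserving measurePreserving_log)

/-- `(v_l ψ)(p) = ψ(log(-p))` for `p < 0`, and `0` for `p ≥ 0`. -/
noncomputable def leftEmbed (ψ : Lp ℂ 2 (volume : Measure ℝ)) : Lp ℂ 2 masslessMeasure :=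
  (memLp_leftEmbed ψ).toLp

/-- `(v_r ψ)(p) = ψ(log p)` for `p > 0`, and `0` for `p ≤ 0`. -/
noncomputable def rightEmbed (ψ : Lp ℂ 2 (volume : Measure ℝ)) : Lp ℂ 2 masslessMeasure :=
  (memLp_rightEmbed ψ).toLp

/-! ### Operator identities on finite particle vectors -/

open scoped TensorProduct

/-- `V* A V = B` on the algebraic tensor product `D ⊗ D` of the spaces of finite particle vectors:
`V` maps `D ⊗ D` into the domain of `A`, and `V* A V t = B t` for all `t` in `D ⊗ D`. -/
def ConjugateOnFinite
    (V : HilbertTensor (ChiralFock S) (ChiralFock S) ≃ₗᵢ[ℂ] MasslessFock S)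
    (A : MasslessFinite S →ₗ[ℂ] MasslessFinite S)
    (B : (ChiralFinite S ⊗[ℂ] ChiralFinite S) →ₗ[ℂ] (ChiralFinite S ⊗[ℂ] ChiralFinite S)) :
    Prop :=
  ∀ t : ChiralFinite S ⊗[ℂ] ChiralFinite S,
    ∃ h : V (tensorIncl (ChiralFinite S) (ChiralFinite S) t) ∈ MasslessFinite S,
      V.symm (A ⟨V (tensorIncl (ChiralFinite S) (ChiralFinite S) t), h⟩ : MasslessFock S) =
        tensorIncl (ChiralFinite S) (ChiralFinite S) (B t)

end Zamolodchikov

open Zamolodchikov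
open scoped SchwartzMap

/-! Write ε = S(∞) = ±1. In the massless model two momenta of opposite sign are exchanged with the
constant factor ε, and two of equal sign with a value of S at a difference of rapidities log |p|. An
exchange symmetric function of n momenta is therefore determined by its values at momenta sorted by
sign, negative ones first, and these values depend on two groups of rapidities, each of which obeys
the chiral exchange relation on its own. For negative momenta `masslessFun` takes the difference of
rapidities in the opposite order, so their rapidities are read from right to left.

This dictates the formula `pairWave` for V(A ⊗ B). At a list of n momenta, k of them negative, it is
C(n,k)^(-1/2) ε^i A(negPart) B(posPart), where i counts the pairs in which a positive entry precedes
a negative one. It has the massless exchange symmetry by `exchangeAt_pairWave`. Since dp/|p| is the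
sum of the images of dβ under exp and -exp, the product measure is a sum over the sets T of
positions of negative entries (`pi_masslessMeasure_eq`). The C(n,k) sets of size k contribute
equally to an inner product, which cancels the normalization, and the sum over n is a Cauchy
product; this is `inner_pairVec`. Surjectivity is `eq_zero_of_inner_pairVec`: the sorted values of a
vector orthogonal to the range are orthogonal to all products of symmetric functions, hence, being
symmetric in each group, to all products of square integrable functions.

The operators are compared on pair vectors. A boost shifts the rapidities of the two groups in
opposite directions. The reflection reverses the list, which turns i into km - i for k negative and
m positive entries and so produces ε^(N⊗N). In a matrix element of a creation operator the
symmetrizing projection may be dropped. A negative first momentum becomes the last entry of the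
reversed left moving list, as for the reflected operator `yDaggerPrime`. A positive one becomes the
first entry on the right, but precedes k negative entries, whence the factor ε^k. Annihilation
operators follow by taking adjoints.

For the fields, integration by parts turns f = ∂g into multiplication by a momentum, and in light
cone coordinates the mass shell integrals become one-dimensional Fourier integrals of g_l and g_r
(`massShell_fderiv_ae`). The identity for the primed field results from the unprimed one by
conjugation with the twisted reflection. As the chiral fields change particle number by one, this
moves the factor ε^N from one side of the tensor product to the other. -/

namespace Zamolodchikov

/-! ### Wave functions on lists -/

section Lists

/-- The pointwise exchange relation of a function on lists, at the list `l`. -/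
def ExchangeAt (s : ExchangeFactor) (G : List ℝ → ℂ) (l : List ℝ) : Prop :=
  ∀ l₁ a b l₂, l = l₁ ++ a :: b :: l₂ → G l = s.toFun b a * G (l₁ ++ b :: a :: l₂)

/-- Dictionary between a decomposition of a list around two neighbours and the transposition of
positions that enters `exchange`. -/
theorem ofFn_swap {n : ℕ} {x : Fin n → ℝ} {l₁ l₂ : List ℝ} {a b : ℝ}
    (h : List.ofFn x = l₁ ++ a :: b :: l₂) :
    ∃ hj : l₁.length + 1 < n, x ⟨l₁.length, by omega⟩ = a ∧ x ⟨l₁.length + 1, hj⟩ = b ∧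
      List.ofFn (fun i => x (Equiv.swap ⟨l₁.length, by omega⟩ ⟨l₁.length + 1, hj⟩ i)) =
        l₁ ++ b :: a :: l₂ := by
  have hn : n = l₁.length + (l₂.length + 2) := by
    have := congrArg List.length h
    simpa using this
  have hj : l₁.length + 1 < n := by omega
  have hx : ∀ i : Fin n, x i = (l₁ ++ a :: b :: l₂)[i.1]'(by simp; omega) := by
    intro i
    have : (List.ofFn x)[i.1]'(by simp) = x i := by simp
    rw [← this]
    congr 1
  have ha : x ⟨l₁.length, by omega⟩ = a := by rw [hx]; simp
  have hb : x ⟨l₁.length + 1, hj⟩ = b := by rw [hx]; simp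
  refine ⟨hj, ha, hb, ?_⟩
  apply List.ext_getElem
  · simp; omega
  intro i h1 h2
  rw [List.getElem_ofFn]
  have hi : i < n := by simpa using h1
  by_cases e1 : i = l₁.length
  · subst e1
    rw [Equiv.swap_apply_left, hb]; simp
  by_cases e2 : i = l₁.length + 1
  · subst e2
    rw [Equiv.swap_apply_right, ha]; simp
  rw [Equiv.swap_apply_of_ne_of_ne (by simpa [Fin.ext_iff] using e1)
    (by simpa [Fin.ext_iff] using e2), hx]
  simp only
  rcases lt_or_ge i l₁.length with h3 | h3
  · rw [List.getElem_append_left h3, List.getElem_append_left h3]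
  · rw [List.getElem_append_right h3, List.getElem_append_right h3]
    obtain ⟨d, rfl⟩ : ∃ d, i = l₁.length + (d + 2) := ⟨i - l₁.length - 2, by omega⟩
    simp

/-- Allows the symmetry to be handled on lists, where filtering, reversing and concatenating involve
no dependent lengths. -/
theorem exchangeAt_ofFn_iff (s : ExchangeFactor) (G : List ℝ → ℂ) {n : ℕ} (x : Fin n → ℝ) :
    ExchangeAt s G (List.ofFn x) ↔ ∀ (j : ℕ) (hj : j + 1 < n),
      G (List.ofFn x) = s.toFun (x ⟨j + 1, hj⟩) (x ⟨j, by omega⟩) *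
        G (List.ofFn fun i => x (Equiv.swap ⟨j, by omega⟩ ⟨j + 1, hj⟩ i)) := by
  constructor
  · intro h j hj
    set l := List.ofFn x with hl
    have hlen : l.length = n := by simp [hl]
    have hd : l = l.take j ++ l[j] :: l[j + 1] :: l.drop (j + 2) := by
      have h1 : l.drop j = l[j] :: l.drop (j + 1) := List.drop_eq_getElem_cons (by omega)
      have h2 : l.drop (j + 1) = l[j + 1] :: l.drop (j + 2) := List.drop_eq_getElem_cons (by omega)
      rw [← h2, ← h1, List.take_append_drop]
    obtain ⟨hj', ha, hb, hsw⟩ := ofFn_swap (hl.symm.trans hd)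
    have hjl : (l.take j).length = j := by simp; omega
    simp only [hjl] at ha hb hsw
    rw [hsw, ha, hb]
    exact h _ _ _ _ hd
  · intro h l₁ a b l₂ hd
    obtain ⟨hj, ha, hb, hsw⟩ := ofFn_swap hd
    rw [h _ hj, hsw, ha, hb]

/-- A property of lists that holds almost everywhere, for every length, when the entries are
distributed according to `μ`. -/
def ListAE (μ : Measure ℝ) [SigmaFinite μ] (P : List ℝ → Prop) : Prop :=
  ∀ n : ℕ, ∀ᵐ x ∂(Measure.pi fun _ : Fin n => μ), P (List.ofFn x)

variable {μ : Measure ℝ} [SigmaFinite μ]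

theorem ListAE.and {P Q : List ℝ → Prop} (hP : ListAE μ P) (hQ : ListAE μ Q) :
    ListAE μ fun l => P l ∧ Q l :=
  fun n => (hP n).and (hQ n)

theorem ListAE.mono {P Q : List ℝ → Prop} (hP : ListAE μ P) (h : ∀ l, P l → Q l) : ListAE μ Q :=
  fun n => (hP n).mono fun _ hx => h _ hx

/-- Permutations lift along `map`. Applied to the list of positions, this realizes a rearrangement
of entries by a permutation of indices, even if entries repeat. -/
theorem exists_perm_map_eq {α β : Type*} {f : α → β} {l k : List β} (h : l.Perm k) :
    ∀ m : List α, m.map f = k → ∃ m' : List α, m'.Perm m ∧ m'.map f = l := by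
  induction h with
  | nil => intro m hm; exact ⟨m, .refl _, hm⟩
  | cons a _ ih =>
    intro m hm
    obtain ⟨c, m, rfl, rfl, h2⟩ := List.map_eq_cons_iff.1 hm
    obtain ⟨m', h3, rfl⟩ := ih m h2
    exact ⟨c :: m', h3.cons c, rfl⟩
  | swap a b l =>
    intro m hm
    obtain ⟨c, m, rfl, rfl, h2⟩ := List.map_eq_cons_iff.1 hm
    obtain ⟨d, m, rfl, rfl, rfl⟩ := List.map_eq_cons_iff.1 h2
    exact ⟨d :: c :: m, .swap _ _ _, rfl⟩
  | trans _ _ ih₁ ih₂ =>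
    intro m hm
    obtain ⟨m', h3, h4⟩ := ih₂ m hm
    obtain ⟨m'', h5, h6⟩ := ih₁ m' h4
    exact ⟨m'', h5.trans h3, h6⟩

/-- A list almost everywhere has a property together with all its permutations. -/
theorem ListAE.perm {P : List ℝ → Prop} (hP : ListAE μ P) :
    ListAE μ fun l => ∀ l', l'.Perm l → P l' := by
  intro n
  -- There are finitely many permutations and each preserves the product measure, so one null set
  -- serves for all of them.
  have h : ∀ᵐ x ∂(Measure.pi fun _ : Fin n => μ), ∀ σ : Equiv.Perm (Fin n),
      P (List.ofFn fun i => x (σ i)) :=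
    ae_all_iff.2 fun σ => (measurePreserving_perm μ σ).quasiMeasurePreserving.ae (hP n)
  filter_upwards [h] with x hx l' hl'
  have h2 : l'.Perm ((List.finRange n).map x) := by rwa [← List.ofFn_eq_map]
  obtain ⟨m, hm1, rfl⟩ := exists_perm_map_eq h2 _ rfl
  have hlen : m.length = n := by rw [hm1.length_eq, List.length_finRange]
  have hnd : m.Nodup := hm1.nodup_iff.2 (List.nodup_finRange n)
  have hinj : Function.Injective fun i : Fin n => m.get (i.cast hlen.symm) :=
    (List.nodup_iff_injective_get.1 hnd).comp (Fin.cast_injective _)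
  have := hx (Equiv.ofBijective _ (Finite.injective_iff_bijective.1 hinj))
  convert this using 1
  apply List.ext_getElem
  · simp [hlen]
  · intro i h1 h2
    simp

end Lists

/-! ### Fock space vectors as functions on lists. -/

section Wave

variable {μ : Measure ℝ} [SigmaFinite μ] {s : ExchangeFactor}

/-- The components of a Fock space vector as one function on lists. -/
noncomputable def Fock.wave (Ψ : Fock μ s) (l : List ℝ) : ℂ :=
  (Ψ.component l.length : L2Power μ l.length) l.get

/-- The length of `List.ofFn x` is `n` only up to a propositional equality, so the identity is
transported through the sigma type of tuples. -/
theorem Fock.wave_ofFn (Ψ : Fock μ s) {n : ℕ} (x : Fin n → ℝ) :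
    Ψ.wave (List.ofFn x) = (Ψ.component n : L2Power μ n) x := by
  have h : (⟨(List.ofFn x).length, (List.ofFn x).get⟩ : Σ n, Fin n → ℝ) = ⟨n, x⟩ :=
    List.equivSigmaTuple.right_inv ⟨n, x⟩
  exact congrArg (fun t : Σ n, Fin n → ℝ => (Ψ.component t.1 : L2Power μ t.1) t.2) h

theorem Fock.ext_wave {Ψ Φ : Fock μ s} (h : ListAE μ fun l => Ψ.wave l = Φ.wave l) : Ψ = Φ := by
  apply Fock.ext
  intro n
  apply Subtype.ext
  apply Lp.ext
  filter_upwards [h n] with x hx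
  rwa [wave_ofFn, wave_ofFn] at hx

theorem Fock.exchangeAt_wave (Ψ : Fock μ s) : ListAE μ (ExchangeAt s Ψ.wave) := by
  intro n
  have h := (mem_nParticle_iff μ s).1 (Ψ.component n).2
  have h2 : ∀ᵐ x ∂(Measure.pi fun _ : Fin n => μ), ∀ (j : ℕ) (hj : j + 1 < n),
      s.toFun (x ⟨j + 1, hj⟩) (x ⟨j, by omega⟩) *
          (Ψ.component n : L2Power μ n) (fun i => x (Equiv.swap ⟨j, by omega⟩ ⟨j + 1, hj⟩ i)) =
        (Ψ.component n : L2Power μ n) x :=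
    ae_all_iff.2 fun j => ae_all_iff.2 fun hj => h j hj
  filter_upwards [h2] with x hx
  rw [exchangeAt_ofFn_iff]
  intro j hj
  rw [wave_ofFn, wave_ofFn]
  exact (hx j hj).symm

/-- Converse of `Fock.exchangeAt_wave`. It is stated for an arbitrary `G` because it is applied to
`pairWave` and to fibers of sorted wave functions. -/
theorem toLp_mem_nParticle {G : List ℝ → ℂ} {n : ℕ}
    (hG : MemLp (fun x => G (List.ofFn x)) 2 (Measure.pi fun _ : Fin n => μ))
    (he : ∀ᵐ x ∂(Measure.pi fun _ : Fin n => μ), ExchangeAt s G (List.ofFn x)) :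
    hG.toLp ∈ nParticle μ s n := by
  rw [mem_nParticle_iff]
  intro j hj
  have hmp := measurePreserving_perm μ (n := n) (Equiv.swap ⟨j, by omega⟩ ⟨j + 1, hj⟩)
  filter_upwards [he, hG.coeFn_toLp, hmp.quasiMeasurePreserving.ae hG.coeFn_toLp] with x h1 h2 h3
  rw [h2, h3]
  exact ((exchangeAt_ofFn_iff s G x).1 h1 j hj).symm

theorem Fock.inner_eq (Ψ Φ : Fock μ s) :
    inner ℂ Ψ Φ = ∑' n, inner ℂ (Ψ.component n) (Φ.component n) :=
  lp.inner_eq_tsum (𝕜 := ℂ) (G := fun n : ℕ => nParticle μ s n) Ψ Φ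

theorem Fock.inner_component (Ψ Φ : Fock μ s) (n : ℕ) :
    inner ℂ (Ψ.component n) (Φ.component n) =
      ∫ x, conj (Ψ.wave (List.ofFn x)) * Φ.wave (List.ofFn x)
        ∂(Measure.pi fun _ : Fin n => μ) := by
  rw [Submodule.coe_inner, L2.inner_def]
  congr 1
  funext x
  rw [wave_ofFn, wave_ofFn, RCLike.inner_apply, mul_comm]

end Wave

end Zamolodchikov

namespace Zamolodchikov

/-! ### Left and right moving parts of a list of momenta -/

/-- The rapidities of the negative entries of a list, in reversed order. -/
noncomputable def negPart (l : List ℝ) : List ℝ :=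
  ((l.filter fun p => p < 0).map fun p => Real.log (-p)).reverse

/-- The rapidities of the positive entries of a list. -/
noncomputable def posPart (l : List ℝ) : List ℝ :=
  (l.filter fun p => 0 < p).map Real.log

/-- `ε` to the number of pairs of entries in which a positive one precedes a negative one. -/
noncomputable def phase (ε : ℂ) : List ℝ → ℂ
  | [] => 1
  | p :: l => (if 0 < p then ε ^ (negPart l).length else 1) * phase ε l

@[simp] theorem negPart_nil : negPart [] = [] := rfl
@[simp] theorem posPart_nil : posPart [] = [] := rfl
@[simp] theorem phase_nil (ε : ℂ) : phase ε [] = 1 := rfl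

theorem negPart_cons_neg {p : ℝ} (hp : p < 0) (l : List ℝ) :
    negPart (p :: l) = negPart l ++ [Real.log (-p)] := by
  simp [negPart, hp]

theorem negPart_cons_nonneg {p : ℝ} (hp : 0 ≤ p) (l : List ℝ) :
    negPart (p :: l) = negPart l := by
  simp [negPart, hp]

theorem posPart_cons_pos {p : ℝ} (hp : 0 < p) (l : List ℝ) :
    posPart (p :: l) = Real.log p :: posPart l := by
  simp [posPart, hp]

theorem posPart_cons_nonpos {p : ℝ} (hp : p ≤ 0) (l : List ℝ) :
    posPart (p :: l) = posPart l := by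
  simp [posPart, hp]

theorem phase_cons_pos (ε : ℂ) {p : ℝ} (hp : 0 < p) (l : List ℝ) :
    phase ε (p :: l) = ε ^ (negPart l).length * phase ε l := by
  simp [phase, hp]

theorem phase_cons_nonpos (ε : ℂ) {p : ℝ} (hp : p ≤ 0) (l : List ℝ) :
    phase ε (p :: l) = phase ε l := by
  simp [phase, hp]

theorem negPart_append (l₁ l₂ : List ℝ) : negPart (l₁ ++ l₂) = negPart l₂ ++ negPart l₁ := by
  simp [negPart]

theorem posPart_append (l₁ l₂ : List ℝ) : posPart (l₁ ++ l₂) = posPart l₁ ++ posPart l₂ := by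
  simp [posPart]

theorem negPart_reverse (l : List ℝ) : negPart l.reverse = (negPart l).reverse := by
  simp [negPart, List.filter_reverse]

theorem posPart_reverse (l : List ℝ) : posPart l.reverse = (posPart l).reverse := by
  simp [posPart, List.filter_reverse]

theorem negPart_perm {l l' : List ℝ} (h : l.Perm l') : (negPart l).Perm (negPart l') := by
  unfold negPart
  exact (List.reverse_perm _).trans (((h.filter _).map _).trans (List.reverse_perm _).symm)

/-- The pairs not internal to either list consist of a positive entry of `l₁` and a negative entry
of `l₂`. -/
theorem phase_append (ε : ℂ) (l₁ l₂ : List ℝ) :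
    phase ε (l₁ ++ l₂) =
      ε ^ ((negPart l₂).length * (posPart l₁).length) * (phase ε l₁ * phase ε l₂) := by
  induction l₁ with
  | nil => simp
  | cons p l ih =>
    rw [List.cons_append]
    rcases lt_or_ge 0 p with hp | hp
    · rw [phase_cons_pos ε hp, phase_cons_pos ε hp, posPart_cons_pos hp, ih, negPart_append,
        List.length_append, List.length_cons]
      ring
    · rw [phase_cons_nonpos ε hp, phase_cons_nonpos ε hp, posPart_cons_nonpos hp, ih]

/-- Reversal exchanges the pairs in which the positive entry comes first with those in which it
comes second. Together these are all pairs of opposite signs, and exponents matter only modulo 2. -/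
theorem phase_reverse {ε : ℂ} (hε : ε ^ 2 = 1) (l : List ℝ) :
    phase ε l.reverse = ε ^ ((negPart l).length * (posPart l).length) * phase ε l := by
  have h2 : ∀ k : ℕ, ε ^ (k + k) = 1 := fun k => by rw [← two_mul, pow_mul, hε, one_pow]
  induction l with
  | nil => simp
  | cons p l ih =>
    rw [List.reverse_cons, phase_append, ih, posPart_reverse, List.length_reverse]
    rcases lt_trichotomy p 0 with hp | rfl | hp
    · rw [phase_cons_nonpos ε hp.le l, phase_cons_nonpos ε hp.le, negPart_cons_neg hp,
        negPart_cons_neg hp, posPart_cons_nonpos hp.le]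
      simp only [negPart_nil, phase_nil, List.length_append, List.length_cons, List.length_nil,
        List.nil_append]
      ring
    · rw [phase_cons_nonpos ε le_rfl l, phase_cons_nonpos ε le_rfl, negPart_cons_nonneg le_rfl,
        negPart_cons_nonneg le_rfl, posPart_cons_nonpos le_rfl]
      simp
    · rw [phase_cons_pos ε hp l, phase_cons_pos ε hp, negPart_cons_nonneg hp.le,
        negPart_cons_nonneg hp.le, posPart_cons_pos hp]
      simp only [negPart_nil, phase_nil, List.length_cons, List.length_nil, zero_mul, pow_zero,
        one_mul, mul_one, mul_add]
      rw [pow_add]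
      have := h2 (negPart l).length
      rw [pow_add] at this
      linear_combination (-(ε ^ ((negPart l).length * (posPart l).length) * phase ε l)) * this

theorem phase_sq {ε : ℂ} (hε : ε ^ 2 = 1) (l : List ℝ) : phase ε l * phase ε l = 1 := by
  induction l with
  | nil => simp
  | cons p l ih =>
    unfold phase
    split_ifs
    · have : (ε ^ (negPart l).length) ^ 2 = 1 := by rw [← pow_mul, mul_comm, pow_mul, hε, one_pow]
      linear_combination (phase ε l * phase ε l) * this + ih
    · linear_combination ih

theorem conj_phase {ε : ℂ} (hε : conj ε = ε) (l : List ℝ) : conj (phase ε l) = phase ε l := by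
  induction l with
  | nil => simp
  | cons p l ih => unfold phase; split_ifs <;> simp [ih, hε]

/-- A boost preserves signs and scales negative momenta by exp θ, positive ones by exp (-θ); hence
the opposite shifts here and in `posPart_map_boost`. -/
theorem negPart_map_boost (θ : ℝ) (l : List ℝ) :
    negPart (l.map (boost θ)) = (negPart l).map (· + θ) := by
  induction l with
  | nil => rfl
  | cons p l ih =>
    rw [List.map_cons]
    rcases lt_or_ge p 0 with hp | hp
    · rw [negPart_cons_neg ((boost_neg_iff θ p).2 hp), negPart_cons_neg hp, ih, List.map_append,
        boost_of_nonpos θ hp.le, ← mul_neg, Real.log_mul (Real.exp_pos _).ne' (by linarith),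
        Real.log_exp, add_comm θ]
      rfl
    · rw [negPart_cons_nonneg (not_lt.1 fun h => hp.not_gt ((boost_neg_iff θ p).1 h)),
        negPart_cons_nonneg hp, ih]

theorem posPart_map_boost (θ : ℝ) (l : List ℝ) :
    posPart (l.map (boost θ)) = (posPart l).map (· + -θ) := by
  induction l with
  | nil => rfl
  | cons p l ih =>
    rw [List.map_cons]
    rcases lt_or_ge 0 p with hp | hp
    · rw [posPart_cons_pos ((boost_pos_iff θ p).2 hp), posPart_cons_pos hp, ih, List.map_cons,
        boost_of_nonneg θ hp.le, Real.log_mul (Real.exp_pos _).ne' hp.ne', Real.log_exp,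
        add_comm (-θ)]
    · rw [posPart_cons_nonpos (not_lt.1 fun h => hp.not_gt ((boost_pos_iff θ p).1 h)),
        posPart_cons_nonpos hp, ih]

theorem phase_map_boost (ε : ℂ) (θ : ℝ) (l : List ℝ) : phase ε (l.map (boost θ)) = phase ε l := by
  induction l with
  | nil => rfl
  | cons p l ih =>
    rw [List.map_cons]
    unfold phase
    rw [ih, negPart_map_boost, List.length_map]
    simp only [boost_pos_iff]

/-- A single term |p| x₀ - p x₁ is |p| (x₀ + x₁) for p < 0 and |p| (x₀ - x₁) for p > 0, so each
group sees only one light ray coordinate. -/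
theorem sum_map_momentum (x : ℝ × ℝ) (l : List ℝ) :
    (l.map fun p => |p| * x.1 - p * x.2).sum =
      ((negPart l).map fun β => (x.1 + x.2) * Real.exp β).sum +
        ((posPart l).map fun β => (x.1 - x.2) * Real.exp β).sum := by
  induction l with
  | nil => simp
  | cons p l ih =>
    rw [List.map_cons, List.sum_cons, ih]
    rcases lt_trichotomy p 0 with hp | rfl | hp
    · rw [negPart_cons_neg hp, posPart_cons_nonpos hp.le, abs_of_neg hp]
      simp only [List.map_append, List.sum_append, List.map_cons, List.map_nil, List.sum_cons,
        List.sum_nil, Real.exp_log (neg_pos.2 hp)]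
      ring
    · rw [negPart_cons_nonneg le_rfl, posPart_cons_nonpos le_rfl]
      simp
    · rw [negPart_cons_nonneg hp.le, posPart_cons_pos hp, abs_of_pos hp]
      simp only [List.map_cons, List.sum_cons, Real.exp_log hp]
      ring

theorem map_negPart (l : List ℝ) :
    (negPart l).reverse.map (fun β => -Real.exp β) = l.filter fun p => p < 0 := by
  induction l with
  | nil => simp
  | cons p l ih =>
    rcases lt_or_ge p 0 with hp | hp
    · rw [negPart_cons_neg hp, List.filter_cons_of_pos (by simpa using hp), ← ih]
      simp [Real.exp_log (neg_pos.2 hp), -Real.log_neg_eq_log]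
    · rw [negPart_cons_nonneg hp, ih, List.filter_cons_of_neg (by simpa using hp)]

theorem map_posPart (l : List ℝ) :
    (posPart l).map Real.exp = l.filter fun p => 0 < p := by
  induction l with
  | nil => simp
  | cons p l ih =>
    rcases lt_or_ge 0 p with hp | hp
    · rw [posPart_cons_pos hp, List.filter_cons_of_pos (by simpa using hp), ← ih]
      simp [Real.exp_log hp]
    · rw [posPart_cons_nonpos hp, ih, List.filter_cons_of_neg (by simpa using hp)]

/-- Left moving rapidities followed by right moving ones, as a list of momenta. -/
noncomputable def joinParts (L R : List ℝ) : List ℝ :=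
  L.reverse.map (fun β => -Real.exp β) ++ R.map Real.exp

/-- Zero entries have to be excluded because both filters discard them; they occur only on a null
set, by `listAE_ne_zero`. -/
theorem joinParts_perm {l : List ℝ} (h0 : ∀ p ∈ l, p ≠ 0) :
    (joinParts (negPart l) (posPart l)).Perm l := by
  unfold joinParts
  rw [map_negPart, map_posPart]
  have h : (l.filter fun p => 0 < p) = l.filter fun p => !decide (p < 0) := by
    apply List.filter_congr
    intro p hp
    have := h0 p hp
    grind
  rw [h]
  exact List.filter_append_perm _ _

/-! ### The exchange relation of pair functions, and sorting by sign. -/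

section Factor

variable (S : ScatteringFunctionWithLimit)

theorem masslessFactor_of_neg {p q : ℝ} (hp : p < 0) (hq : q < 0) :
    (masslessFactor S).toFun p q = S.onReal (Real.log (-q) - Real.log (-p)) := by
  change masslessFun S p q = _
  simp [masslessFun, hp, hq, hp.le]

theorem masslessFactor_of_pos {p q : ℝ} (hp : 0 < p) (hq : 0 < q) :
    (masslessFactor S).toFun p q = S.onReal (Real.log p - Real.log q) := by
  change masslessFun S p q = _
  simp [masslessFun, hp, hq]

theorem masslessFactor_of_neg_of_pos {p q : ℝ} (hp : p < 0) (hq : 0 < q) :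
    (masslessFactor S).toFun p q = S.atInfinity := by
  change masslessFun S p q = _
  simp [masslessFun, hp.not_gt, hq.not_gt, hp.ne]

theorem masslessFactor_of_pos_of_neg {p q : ℝ} (hp : 0 < p) (hq : q < 0) :
    (masslessFactor S).toFun p q = S.atInfinity := by
  change masslessFun S p q = _
  simp [masslessFun, hp.not_gt, hq.not_gt, hp.ne']

/-- The function on lists of momenta that corresponds to a pair of functions on lists of
rapidities. -/
noncomputable def pairWave (A B : List ℝ → ℂ) (l : List ℝ) : ℂ :=
  ((Real.sqrt (l.length.choose (negPart l).length) : ℝ) : ℂ)⁻¹ *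
    (phase S.atInfinity l * (A (negPart l) * B (posPart l)))

/-- Neighbours of equal sign remain neighbours in one of the two parts, and the phase does not see
their exchange. Neighbours of opposite signs leave both parts unchanged, and their exchange changes
the phase by one factor ε. The normalization depends only on the numbers of entries. -/
theorem exchangeAt_pairWave {A B : List ℝ → ℂ} {l : List ℝ} (h0 : ∀ p ∈ l, p ≠ 0)
    (hA : ExchangeAt (chiralFactor S) A (negPart l))
    (hB : ExchangeAt (chiralFactor S) B (posPart l)) :
    ExchangeAt (masslessFactor S) (pairWave S A B) l := by
  rintro l₁ a b l₂ rfl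
  have hε := S.atInfinity_sq
  have ha : a ≠ 0 := h0 a (by simp)
  have hb : b ≠ 0 := h0 b (by simp)
  have hlen : (l₁ ++ b :: a :: l₂).length = (l₁ ++ a :: b :: l₂).length := by simp
  have hneg : (negPart (l₁ ++ b :: a :: l₂)).length = (negPart (l₁ ++ a :: b :: l₂)).length :=
    (negPart_perm ((List.Perm.swap a b l₂).append_left l₁)).length_eq
  unfold pairWave
  rw [hlen, hneg, phase_append, phase_append S.atInfinity l₁ (b :: a :: l₂)]
  have hneg' : (negPart (b :: a :: l₂)).length = (negPart (a :: b :: l₂)).length :=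
    (negPart_perm (List.Perm.swap a b l₂)).length_eq
  rw [hneg']
  generalize ((Real.sqrt ((l₁ ++ a :: b :: l₂).length.choose
    (negPart (l₁ ++ a :: b :: l₂)).length) : ℝ) : ℂ)⁻¹ = d
  rcases lt_or_gt_of_ne ha with ha | ha <;> rcases lt_or_gt_of_ne hb with hb | hb
  -- In the reversed list the rapidity of `b` stands before that of `a`. The chiral factor is thus
  -- S(log(-a) - log(-b)), which is the massless factor at (b, a).
  · have e := hA (negPart l₂) (Real.log (-b)) (Real.log (-a)) (negPart l₁) (by
      rw [negPart_append, negPart_cons_neg ha, negPart_cons_neg hb]; simp)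
    have e2 : negPart (l₁ ++ b :: a :: l₂) =
        negPart l₂ ++ Real.log (-a) :: Real.log (-b) :: negPart l₁ := by
      rw [negPart_append, negPart_cons_neg hb, negPart_cons_neg ha]; simp
    have e3 : posPart (l₁ ++ b :: a :: l₂) = posPart (l₁ ++ a :: b :: l₂) := by
      simp only [posPart_append, posPart_cons_nonpos ha.le, posPart_cons_nonpos hb.le]
    have e4 : (chiralFactor S).toFun (Real.log (-a)) (Real.log (-b)) =
      S.onReal (Real.log (-a) - Real.log (-b)) := rfl
    rw [e, e2, e3, masslessFactor_of_neg S hb ha, e4]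
    simp only [phase_cons_nonpos _ ha.le, phase_cons_nonpos _ hb.le]
    ring
  · have e2 : negPart (l₁ ++ b :: a :: l₂) = negPart (l₁ ++ a :: b :: l₂) := by
      simp only [negPart_append, negPart_cons_neg ha, negPart_cons_nonneg hb.le]
    have e3 : posPart (l₁ ++ b :: a :: l₂) = posPart (l₁ ++ a :: b :: l₂) := by
      simp only [posPart_append, posPart_cons_nonpos ha.le, posPart_cons_pos hb]
    rw [e2, e3, masslessFactor_of_pos_of_neg S hb ha]
    simp only [phase_cons_nonpos _ ha.le, phase_cons_pos _ hb, negPart_cons_neg ha,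
      negPart_cons_nonneg hb.le, List.length_append, List.length_cons, List.length_nil,
      zero_add, pow_succ]
    generalize S.atInfinity ^ (((negPart l₂).length + 1) * (posPart l₁).length) = c
    -- The given order is the sorted one. The exchanged list acquires an ε in its phase, which meets
    -- the ε of the exchange factor.
    linear_combination (-d * c * phase S.atInfinity l₁ *
      S.atInfinity ^ (negPart l₂).length * phase S.atInfinity l₂ *
      A (negPart (l₁ ++ a :: b :: l₂)) * B (posPart (l₁ ++ a :: b :: l₂))) * hε
  · have e2 : negPart (l₁ ++ b :: a :: l₂) = negPart (l₁ ++ a :: b :: l₂) := by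
      simp only [negPart_append, negPart_cons_neg hb, negPart_cons_nonneg ha.le]
    have e3 : posPart (l₁ ++ b :: a :: l₂) = posPart (l₁ ++ a :: b :: l₂) := by
      simp only [posPart_append, posPart_cons_nonpos hb.le, posPart_cons_pos ha]
    rw [e2, e3, masslessFactor_of_neg_of_pos S hb ha]
    simp only [phase_cons_nonpos _ hb.le, phase_cons_pos _ ha, negPart_cons_neg hb,
      negPart_cons_nonneg ha.le, List.length_append, List.length_cons, List.length_nil,
      zero_add, pow_succ]
    ring
  · have e := hB (posPart l₁) (Real.log a) (Real.log b) (posPart l₂) (by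
      rw [posPart_append, posPart_cons_pos ha, posPart_cons_pos hb])
    have e2 : posPart (l₁ ++ b :: a :: l₂) =
        posPart l₁ ++ Real.log b :: Real.log a :: posPart l₂ := by
      rw [posPart_append, posPart_cons_pos hb, posPart_cons_pos ha]
    have e3 : negPart (l₁ ++ b :: a :: l₂) = negPart (l₁ ++ a :: b :: l₂) := by
      simp only [negPart_append, negPart_cons_nonneg ha.le, negPart_cons_nonneg hb.le]
    have e4 : (chiralFactor S).toFun (Real.log b) (Real.log a) =
      S.onReal (Real.log b - Real.log a) := rfl
    rw [e, e2, e3, masslessFactor_of_pos S hb ha, e4]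
    simp only [phase_cons_pos _ ha, phase_cons_pos _ hb, negPart_cons_nonneg ha.le,
      negPart_cons_nonneg hb.le]
    ring

/-- Each negative entry that `p` passes costs one factor ε. Requiring the relation at all
rearrangements of the list makes the hypothesis stable under the induction. -/
theorem exchange_past_negatives {Φ : List ℝ → ℂ} {p : ℝ} (hp : 0 < p) (N : List ℝ) :
    ∀ pre R : List ℝ, (∀ a ∈ N, a < 0) →
      (∀ l, l.Perm (pre ++ p :: (N ++ R)) → ExchangeAt (masslessFactor S) Φ l) →
      Φ (pre ++ p :: (N ++ R)) = S.atInfinity ^ N.length * Φ (pre ++ (N ++ p :: R)) := by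
  induction N with
  | nil => intro pre R _ _; simp
  | cons a N ih =>
    intro pre R hN hΦ
    have ha : a < 0 := hN a (by simp)
    have h1 := hΦ _ (.refl _) pre p a (N ++ R) rfl
    rw [masslessFactor_of_neg_of_pos S ha hp] at h1
    have h2 := ih (pre ++ [a]) R (fun b hb => hN b (by simp [hb])) (fun l hl => hΦ l (by
      refine hl.trans ?_
      simpa using (List.Perm.swap p a (N ++ R)).append_left pre))
    simp only [List.append_assoc, List.cons_append, List.nil_append] at h2 h1 ⊢
    rw [h1, h2, List.length_cons, pow_succ]
    ring

/-- Sorting by signs multiplies an exchange symmetric function by the phase. -/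
theorem eq_phase_mul_sorted {Φ : List ℝ → ℂ} (l : List ℝ) :
    ∀ pre : List ℝ, (∀ p ∈ l, p ≠ 0) →
      (∀ l', l'.Perm (pre ++ l) → ExchangeAt (masslessFactor S) Φ l') →
      Φ (pre ++ l) = phase S.atInfinity l * Φ (pre ++ joinParts (negPart l) (posPart l)) := by
  induction l with
  | nil => intro pre _ _; simp [joinParts]
  | cons p l ih =>
    intro pre h0 hΦ
    have h0' : ∀ q ∈ l, q ≠ 0 := fun q hq => h0 q (List.mem_cons_of_mem _ hq)
    -- The tail is sorted behind the fixed prefix `pre ++ [p]`. Afterwards a negative `p` is already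
    -- in place, and a positive one has to pass the negative entries of the tail, which is the head
    -- factor in `phase`.
    have h1 := ih (pre ++ [p]) h0' (fun l' hl' => hΦ l' (by simpa using hl'))
    have hperm := joinParts_perm h0'
    simp only [List.append_assoc, List.cons_append, List.nil_append] at h1
    unfold joinParts at h1 hperm ⊢
    rw [map_negPart, map_posPart] at h1 hperm ⊢
    rcases lt_or_gt_of_ne (h0 p List.mem_cons_self) with hp | hp
    · rw [h1, phase_cons_nonpos _ hp.le, List.filter_cons_of_pos (by simpa using hp),
        List.filter_cons_of_neg (by simpa using hp.le), List.cons_append]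
    · rw [h1, phase_cons_pos _ hp, List.filter_cons_of_neg (by simpa using hp.le),
        List.filter_cons_of_pos (by simpa using hp),
        exchange_past_negatives S hp _ pre _ (by simp) (fun l' hl' => hΦ l' (hl'.trans
          ((hperm.cons p).append_left pre)))]
      have : (l.filter fun p => p < 0).length = (negPart l).length := by simp [negPart]
      rw [this]
      ring

end Factor

end Zamolodchikov

namespace Zamolodchikov

/-! ### Decomposition of the massless product measure by sign patterns -/

section Pattern

variable {n : ℕ}

/-- The momenta with rapidities `x` that are negative exactly at the positions in `T`. -/
noncomputable def signExp (T : Finset (Fin n)) (x : Fin n → ℝ) : Fin n → ℝ :=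
  fun i => if i ∈ T then -Real.exp (x i) else Real.exp (x i)

/-- An injective continuous map between Polish spaces is a measurable embedding, so integrals and
almost everywhere statements can be pulled back along it without measurability hypotheses. -/
theorem measurableEmbedding_signExp (T : Finset (Fin n)) : MeasurableEmbedding (signExp T) := by
  refine Continuous.measurableEmbedding ?_ ?_
  · refine continuous_pi fun i => ?_
    unfold signExp
    split_ifs <;> fun_prop
  · intro x y h
    funext i
    have := congrFun h i
    unfold signExp at this
    split_ifs at this
    · exact Real.exp_injective (neg_injective this)
    · exact Real.exp_injective this

/-- On a box, the product of the sums from `masslessMeasure_eq` expands into a sum over the sets of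
coordinates at which the summand of -exp is chosen. -/
theorem pi_masslessMeasure_eq (n : ℕ) :
    (Measure.pi fun _ : Fin n => masslessMeasure) =
      ∑ T : Finset (Fin n), (Measure.pi fun _ : Fin n => (volume : Measure ℝ)).map (signExp T) := by
  have hm : Measurable fun β : ℝ => -Real.exp β := by fun_prop
  apply Measure.pi_eq
  intro s hs
  rw [Measure.finsetSum_apply]
  have h1 : ∀ i, masslessMeasure (s i) =
      volume ((fun β : ℝ => -Real.exp β) ⁻¹' s i) + volume (Real.exp ⁻¹' s i) := by
    intro i
    rw [masslessMeasure_eq, Measure.add_apply, Measure.map_apply Real.measurable_exp (hs i),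
      Measure.map_apply hm (hs i), add_comm]
  simp only [h1]
  rw [Finset.prod_add, Finset.powerset_univ]
  refine Finset.sum_congr rfl fun T _ => ?_
  rw [(measurableEmbedding_signExp T).map_apply]
  have h2 : signExp T ⁻¹' Set.univ.pi s = Set.univ.pi fun i =>
      if i ∈ T then (fun β : ℝ => -Real.exp β) ⁻¹' s i else Real.exp ⁻¹' s i := by
    ext x
    simp only [Set.mem_preimage, Set.mem_univ_pi, signExp]
    refine forall_congr' fun i => ?_
    split_ifs <;> rfl
  rw [h2, Measure.pi_pi]
  simp only [apply_ite volume]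
  rw [Finset.prod_ite]
  congr 2
  · ext i; simp
  · ext i; simp

theorem ae_massless_iff {P : (Fin n → ℝ) → Prop} :
    (∀ᵐ p ∂(Measure.pi fun _ : Fin n => masslessMeasure), P p) ↔
      ∀ T, ∀ᵐ x ∂(Measure.pi fun _ : Fin n => (volume : Measure ℝ)), P (signExp T x) := by
  rw [pi_masslessMeasure_eq, ae_finsetSum_measure_iff]
  simp only [Finset.mem_univ, true_implies, (measurableEmbedding_signExp _).ae_map_iff]

theorem aestronglyMeasurable_massless_iff {f : (Fin n → ℝ) → ℂ} :
    AEStronglyMeasurable f (Measure.pi fun _ : Fin n => masslessMeasure) ↔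
      ∀ T, AEStronglyMeasurable (fun x => f (signExp T x))
        (Measure.pi fun _ : Fin n => (volume : Measure ℝ)) := by
  rw [pi_masslessMeasure_eq, ← Measure.sum_fintype, aestronglyMeasurable_sum_measure_iff]
  simp only [(measurableEmbedding_signExp _).aestronglyMeasurable_map_iff]
  rfl

theorem memLp_two_massless_iff {f : (Fin n → ℝ) → ℂ} :
    MemLp f 2 (Measure.pi fun _ : Fin n => masslessMeasure) ↔
      ∀ T, MemLp (fun x => f (signExp T x)) 2
        (Measure.pi fun _ : Fin n => (volume : Measure ℝ)) := by
  constructor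
  · intro h T
    rw [pi_masslessMeasure_eq] at h
    exact (measurableEmbedding_signExp T).memLp_map_measure_iff.1 (h.mono_measure
      (Finset.single_le_sum (f := fun T : Finset (Fin n) => (Measure.pi fun _ : Fin n =>
        (volume : Measure ℝ)).map (signExp T)) (fun _ _ => Measure.zero_le _) (Finset.mem_univ T)))
  · intro h
    have hm := aestronglyMeasurable_massless_iff.2 fun T => (h T).1
    rw [memLp_two_iff_integrable_sq_norm hm, pi_masslessMeasure_eq, integrable_finsetSum_measure]
    intro T _
    rw [(measurableEmbedding_signExp T).integrable_map_iff]
    exact (memLp_two_iff_integrable_sq_norm (h T).1).1 (h T)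

theorem integral_massless {f : (Fin n → ℝ) → ℂ}
    (hf : Integrable f (Measure.pi fun _ : Fin n => masslessMeasure)) :
    ∫ p, f p ∂(Measure.pi fun _ : Fin n => masslessMeasure) =
      ∑ T, ∫ x, f (signExp T x) ∂(Measure.pi fun _ : Fin n => (volume : Measure ℝ)) := by
  rw [pi_masslessMeasure_eq, integrable_finsetSum_measure] at hf
  rw [pi_masslessMeasure_eq, integral_finsetSum_measure hf]
  simp only [(measurableEmbedding_signExp _).integral_map]

/-- The positions of the negative entries, in reversed order. -/
def negIdx (T : Finset (Fin n)) : List (Fin n) := ((List.finRange n).filter (· ∈ T)).reverse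

/-- The positions of the positive entries. -/
def posIdx (T : Finset (Fin n)) : List (Fin n) := (List.finRange n).filter (· ∉ T)

theorem signExp_ne_zero (T : Finset (Fin n)) (x : Fin n → ℝ) :
    ∀ p ∈ List.ofFn (signExp T x), p ≠ 0 := by
  intro p hp
  obtain ⟨i, rfl⟩ := (List.mem_ofFn' _ _).1 hp
  unfold signExp
  split_ifs
  · simp
  · exact (Real.exp_pos _).ne'

theorem negPart_signExp (T : Finset (Fin n)) (x : Fin n → ℝ) :
    negPart (List.ofFn (signExp T x)) = (negIdx T).map x := by
  unfold negPart negIdx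
  rw [List.ofFn_eq_map, List.filter_map, List.map_map, List.map_reverse]
  have h : (List.finRange n).filter ((fun p : ℝ => decide (p < 0)) ∘ signExp T x) =
      (List.finRange n).filter (· ∈ T) := by
    apply List.filter_congr
    intro i _
    by_cases hi : i ∈ T
    · simp [signExp, hi, Real.exp_pos]
    · simp [signExp, hi, (Real.exp_pos _).le]
  rw [h]
  congr 1
  apply List.map_congr_left
  intro i hi
  have hi : i ∈ T := by simpa using hi
  simp [signExp, hi]

theorem posPart_signExp (T : Finset (Fin n)) (x : Fin n → ℝ) :
    posPart (List.ofFn (signExp T x)) = (posIdx T).map x := by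
  unfold posPart posIdx
  rw [List.ofFn_eq_map, List.filter_map, List.map_map]
  have h : (List.finRange n).filter ((fun p : ℝ => decide (0 < p)) ∘ signExp T x) =
      (List.finRange n).filter (· ∉ T) := by
    apply List.filter_congr
    intro i _
    by_cases hi : i ∈ T
    · simp [signExp, hi, (Real.exp_pos _).le]
    · simp [signExp, hi, Real.exp_pos]
  rw [h]
  apply List.map_congr_left
  intro i hi
  have hi : i ∉ T := by simpa using hi
  simp [signExp, hi]

theorem nodup_negIdx (T : Finset (Fin n)) : (negIdx T).Nodup :=
  List.nodup_reverse.2 ((List.nodup_finRange n).filter _)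

theorem nodup_posIdx (T : Finset (Fin n)) : (posIdx T).Nodup := (List.nodup_finRange n).filter _

theorem mem_negIdx {T : Finset (Fin n)} {i : Fin n} : i ∈ negIdx T ↔ i ∈ T := by simp [negIdx]

theorem mem_posIdx {T : Finset (Fin n)} {i : Fin n} : i ∈ posIdx T ↔ i ∉ T := by simp [posIdx]

theorem length_negIdx (T : Finset (Fin n)) : (negIdx T).length = T.card := by
  rw [← List.toFinset_card_of_nodup (nodup_negIdx T)]
  congr 1
  ext i; simp [mem_negIdx]

theorem length_posIdx (T : Finset (Fin n)) : (posIdx T).length = n - T.card := by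
  rw [← List.toFinset_card_of_nodup (nodup_posIdx T)]
  have : (posIdx T).toFinset = Tᶜ := by ext i; simp [mem_posIdx]
  rw [this, Finset.card_compl, Fintype.card_fin]

/-- The positions, split by sign. -/
noncomputable def idxEquiv (T : Finset (Fin n)) :
    Fin (negIdx T).length ⊕ Fin (posIdx T).length ≃ Fin n :=
  Equiv.ofBijective (Sum.elim (negIdx T).get (posIdx T).get) (by
    constructor
    · refine Function.Injective.sumElim (List.nodup_iff_injective_get.1 (nodup_negIdx T))
        (List.nodup_iff_injective_get.1 (nodup_posIdx T)) ?_
      intro a b h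
      exact mem_posIdx.1 ((posIdx T).get_mem b) (h ▸ mem_negIdx.1 ((negIdx T).get_mem a))
    · intro i
      by_cases hi : i ∈ T
      · obtain ⟨a, ha⟩ := List.mem_iff_get.1 (mem_negIdx.2 hi)
        exact ⟨Sum.inl a, ha⟩
      · obtain ⟨a, ha⟩ := List.mem_iff_get.1 (mem_posIdx.2 hi)
        exact ⟨Sum.inr a, ha⟩)

/-- The coordinates, split by sign. -/
noncomputable def splitEquiv (T : Finset (Fin n)) :
    (Fin n → ℝ) ≃ᵐ (Fin (negIdx T).length → ℝ) × (Fin (posIdx T).length → ℝ) :=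
  (MeasurableEquiv.piCongrLeft (fun _ : Fin n => ℝ) (idxEquiv T)).symm.trans
    (MeasurableEquiv.sumPiEquivProdPi fun _ => ℝ)

theorem splitEquiv_apply (T : Finset (Fin n)) (x : Fin n → ℝ) :
    splitEquiv T x = (fun i => x ((negIdx T).get i), fun i => x ((posIdx T).get i)) := rfl

theorem measurePreserving_splitEquiv (T : Finset (Fin n)) :
    MeasurePreserving (splitEquiv T) (Measure.pi fun _ => (volume : Measure ℝ))
      ((Measure.pi fun _ => (volume : Measure ℝ)).prod
        (Measure.pi fun _ => (volume : Measure ℝ))) :=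
  ((measurePreserving_piCongrLeft (fun _ : Fin n => (volume : Measure ℝ)) (idxEquiv T)).symm).trans
    (measurePreserving_sumPiEquivProdPi (fun _ => (volume : Measure ℝ)))

theorem map_negIdx (T : Finset (Fin n)) (x : Fin n → ℝ) :
    (negIdx T).map x = List.ofFn (splitEquiv T x).1 := by
  rw [splitEquiv_apply]
  apply List.ext_getElem <;> simp

theorem map_posIdx (T : Finset (Fin n)) (x : Fin n → ℝ) :
    (posIdx T).map x = List.ofFn (splitEquiv T x).2 := by
  rw [splitEquiv_apply]
  apply List.ext_getElem <;> simp

/-- The integral of a function on lists of rapidities over the lists of length `k`. -/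
noncomputable def listIntegral (h : List ℝ → ℂ) (k : ℕ) : ℂ :=
  ∫ y, h (List.ofFn y) ∂(Measure.pi fun _ : Fin k => (volume : Measure ℝ))

/-- Fubini after splitting the coordinates. The value depends on `T` only through its cardinality,
so that sums over `T` become binomial sums. -/
theorem integral_split_mul (T : Finset (Fin n)) (h h' : List ℝ → ℂ) :
    ∫ x, h ((negIdx T).map x) * h' ((posIdx T).map x)
        ∂(Measure.pi fun _ : Fin n => (volume : Measure ℝ)) =
      listIntegral h T.card * listIntegral h' (n - T.card) := by
  rw [← length_posIdx, ← length_negIdx]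
  simp only [map_negIdx, map_posIdx]
  rw [(measurePreserving_splitEquiv T).integral_comp (splitEquiv T).measurableEmbedding
    (fun z => h (List.ofFn z.1) * h' (List.ofFn z.2)), integral_prod_mul
    (fun y => h (List.ofFn y)) (fun y => h' (List.ofFn y))]
  rfl

theorem memLp_split_mul (T : Finset (Fin n)) {h h' : List ℝ → ℂ}
    (hh : ∀ k, MemLp (fun y => h (List.ofFn y)) 2
      (Measure.pi fun _ : Fin k => (volume : Measure ℝ)))
    (hh' : ∀ k, MemLp (fun y => h' (List.ofFn y)) 2
      (Measure.pi fun _ : Fin k => (volume : Measure ℝ))) :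
    MemLp (fun x => h ((negIdx T).map x) * h' ((posIdx T).map x)) 2
      (Measure.pi fun _ : Fin n => (volume : Measure ℝ)) := by
  have hm : AEStronglyMeasurable (fun x => h ((negIdx T).map x) * h' ((posIdx T).map x))
      (Measure.pi fun _ : Fin n => (volume : Measure ℝ)) := by
    simp only [map_negIdx, map_posIdx]
    exact (((hh _).1.comp_fst).mul ((hh' _).1.comp_snd)).comp_measurePreserving
      (measurePreserving_splitEquiv T)
  rw [memLp_two_iff_integrable_sq_norm hm]
  simp only [norm_mul, mul_pow, map_negIdx, map_posIdx]
  exact (measurePreserving_splitEquiv T).integrable_comp_of_integrable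
    (((memLp_two_iff_integrable_sq_norm (hh _).1).1 (hh _)).mul_prod
      ((memLp_two_iff_integrable_sq_norm (hh' _).1).1 (hh' _)))

theorem ae_split {P : List ℝ → List ℝ → Prop} (T : Finset (Fin n))
    (hP : ∀ k m, ∀ᵐ z ∂((Measure.pi fun _ : Fin k => (volume : Measure ℝ)).prod
      (Measure.pi fun _ : Fin m => (volume : Measure ℝ))), P (List.ofFn z.1) (List.ofFn z.2)) :
    ∀ᵐ x ∂(Measure.pi fun _ : Fin n => (volume : Measure ℝ)),
      P ((negIdx T).map x) ((posIdx T).map x) := by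
  simp only [map_negIdx, map_posIdx]
  exact (measurePreserving_splitEquiv T).quasiMeasurePreserving.ae (hP _ _)

end Pattern

/-- For every sign pattern the rapidities of the negative entries are a subfamily of Lebesgue
distributed coordinates, so null sets of rapidities pull back to null sets of momenta. -/
theorem ListAE.negPart {P : List ℝ → Prop} (hP : ListAE volume P) :
    ListAE masslessMeasure fun l => P (negPart l) := by
  intro n
  refine ae_massless_iff.2 fun T => ?_
  simp only [negPart_signExp]
  exact ae_split (P := fun L _ => P L) T
    fun k m => Measure.quasiMeasurePreserving_fst.ae (hP k)

theorem ListAE.posPart {P : List ℝ → Prop} (hP : ListAE volume P) :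
    ListAE masslessMeasure fun l => P (posPart l) := by
  intro n
  refine ae_massless_iff.2 fun T => ?_
  simp only [posPart_signExp]
  exact ae_split (P := fun _ R => P R) T
    fun k m => Measure.quasiMeasurePreserving_snd.ae (hP m)

theorem listAE_ne_zero : ListAE masslessMeasure fun l => ∀ p ∈ l, p ≠ 0 :=
  fun _ => ae_massless_iff.2 fun T => Eventually.of_forall fun x => signExp_ne_zero T x

end Zamolodchikov

namespace Zamolodchikov

/-! ### The bilinear map from pairs of chiral vectors to massless vectors -/

/-- Only the signs enter the phase; the rapidities 0 serve as a reference point, so that the phase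
leaves the integral as a constant. -/
theorem phase_signExp (ε : ℂ) {n : ℕ} (T : Finset (Fin n)) (x : Fin n → ℝ) :
    phase ε (List.ofFn (signExp T x)) = phase ε (List.ofFn (signExp T 0)) := by
  have hpos : ∀ i, 0 < signExp T x i ↔ 0 < signExp T 0 i := by
    intro i; unfold signExp; split_ifs <;> simp [Real.exp_pos, (Real.exp_pos _).not_gt]
  have hneg : ∀ i, signExp T x i < 0 ↔ signExp T 0 i < 0 := by
    intro i; unfold signExp; split_ifs <;> simp [Real.exp_pos, (Real.exp_pos _).not_gt]
  have hlen : ∀ m : List (Fin n), (negPart (m.map (signExp T x))).length =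
      (negPart (m.map (signExp T 0))).length := by
    intro m
    simp only [negPart, List.length_reverse, List.length_map, List.filter_map]
    congr 1
    apply List.filter_congr
    intro i _
    simp [hneg]
  rw [List.ofFn_eq_map, List.ofFn_eq_map]
  induction List.finRange n with
  | nil => rfl
  | cons i m ih =>
    simp only [List.map_cons, phase, hpos, hlen, ih]

section WaveLp

variable {μ : Measure ℝ} [SigmaFinite μ] {s : ExchangeFactor}

theorem Fock.memLp_wave (Ψ : Fock μ s) (n : ℕ) :
    MemLp (fun x => Ψ.wave (List.ofFn x)) 2 (Measure.pi fun _ : Fin n => μ) := by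
  simp only [wave_ofFn]
  exact Lp.memLp _

theorem integrable_conj_mul {α : Type*} [MeasurableSpace α] {ν : Measure α} {f g : α → ℂ}
    (hf : MemLp f 2 ν) (hg : MemLp g 2 ν) : Integrable (fun x => conj (f x) * g x) ν :=
  hf.star.integrable_mul hg

theorem Fock.listIntegral_wave {s : ExchangeFactor} (Ψ Φ : Fock volume s) (k : ℕ) :
    listIntegral (fun l => conj (Ψ.wave l) * Φ.wave l) k =
      inner ℂ (Ψ.component k) (Φ.component k) :=
  (Fock.inner_component Ψ Φ k).symm

theorem Fock.summable_inner (Ψ Φ : Fock μ s) :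
    Summable fun n => inner ℂ (Ψ.component n) (Φ.component n) :=
  lp.summable_inner (𝕜 := ℂ) (G := fun n : ℕ => nParticle μ s n) Ψ Φ

theorem Fock.wave_add (Ψ Φ : Fock μ s) :
    ListAE μ fun l => (Ψ + Φ).wave l = Ψ.wave l + Φ.wave l := by
  intro n
  simp only [wave_ofFn]
  exact Lp.coeFn_add (Ψ.component n : L2Power μ n) (Φ.component n : L2Power μ n)

theorem Fock.wave_smul (c : ℂ) (Ψ : Fock μ s) :
    ListAE μ fun l => (c • Ψ).wave l = c * Ψ.wave l := by
  intro n
  simp only [wave_ofFn]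
  exact Lp.coeFn_smul c (Ψ.component n : L2Power μ n)

end WaveLp

section Pair

variable (S : ScatteringFunctionWithLimit)

theorem pairWave_signExp (A B : List ℝ → ℂ) {n : ℕ} (T : Finset (Fin n)) (x : Fin n → ℝ) :
    pairWave S A B (List.ofFn (signExp T x)) =
      (((Real.sqrt (n.choose T.card) : ℝ) : ℂ)⁻¹ * phase S.atInfinity (List.ofFn (signExp T 0))) *
        (A ((negIdx T).map x) * B ((posIdx T).map x)) := by
  unfold pairWave
  rw [negPart_signExp, posPart_signExp, phase_signExp, List.length_map, length_negIdx,
    List.length_ofFn]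
  ring

theorem memLp_pairWave {A B : List ℝ → ℂ}
    (hA : ∀ k, MemLp (fun y => A (List.ofFn y)) 2
      (Measure.pi fun _ : Fin k => (volume : Measure ℝ)))
    (hB : ∀ k, MemLp (fun y => B (List.ofFn y)) 2
      (Measure.pi fun _ : Fin k => (volume : Measure ℝ))) (n : ℕ) :
    MemLp (fun p => pairWave S A B (List.ofFn p)) 2
      (Measure.pi fun _ : Fin n => masslessMeasure) := by
  rw [memLp_two_massless_iff]
  intro T
  simp only [pairWave_signExp]
  exact (memLp_split_mul T hA hB).const_mul _

theorem sqrt_choose_inv_mul {n k : ℕ} (hk : k ≤ n) :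
    ((n.choose k : ℕ) : ℂ) * (((Real.sqrt (n.choose k) : ℝ) : ℂ)⁻¹ *
      ((Real.sqrt (n.choose k) : ℝ) : ℂ)⁻¹) = 1 := by
  have h : (0 : ℝ) < n.choose k := by exact_mod_cast Nat.choose_pos hk
  rw [← mul_inv, ← Complex.ofReal_mul, Real.mul_self_sqrt h.le]
  push_cast
  exact mul_inv_cancel₀ (by exact_mod_cast h.ne')

/-- For each of the C(n,k) sign patterns with k negative entries the phases cancel and the integral
factorizes. The two normalizations C(n,k)^(-1/2) compensate the number of patterns, which leaves a
term of a Cauchy product. -/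
theorem integral_pairWave {A B A' B' : List ℝ → ℂ}
    (hA : ∀ k, MemLp (fun y => A (List.ofFn y)) 2
      (Measure.pi fun _ : Fin k => (volume : Measure ℝ)))
    (hB : ∀ k, MemLp (fun y => B (List.ofFn y)) 2
      (Measure.pi fun _ : Fin k => (volume : Measure ℝ)))
    (hA' : ∀ k, MemLp (fun y => A' (List.ofFn y)) 2
      (Measure.pi fun _ : Fin k => (volume : Measure ℝ)))
    (hB' : ∀ k, MemLp (fun y => B' (List.ofFn y)) 2
      (Measure.pi fun _ : Fin k => (volume : Measure ℝ))) (n : ℕ) :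
    ∫ p, conj (pairWave S A B (List.ofFn p)) * pairWave S A' B' (List.ofFn p)
        ∂(Measure.pi fun _ : Fin n => masslessMeasure) =
      ∑ k ∈ Finset.range (n + 1), listIntegral (fun l => conj (A l) * A' l) k *
        listIntegral (fun l => conj (B l) * B' l) (n - k) := by
  rw [integral_massless (integrable_conj_mul (memLp_pairWave S hA hB n)
    (memLp_pairWave S hA' hB' n))]
  have h : ∀ T : Finset (Fin n), ∫ x, conj (pairWave S A B (List.ofFn (signExp T x))) *
      pairWave S A' B' (List.ofFn (signExp T x))
        ∂(Measure.pi fun _ : Fin n => (volume : Measure ℝ)) =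
      (((Real.sqrt (n.choose T.card) : ℝ) : ℂ)⁻¹ * ((Real.sqrt (n.choose T.card) : ℝ) : ℂ)⁻¹) *
        (listIntegral (fun l => conj (A l) * A' l) T.card *
        listIntegral (fun l => conj (B l) * B' l) (n - T.card)) := by
    intro T
    rw [← integral_split_mul, ← integral_const_mul]
    congr 1
    funext x
    rw [pairWave_signExp, pairWave_signExp]
    simp only [map_mul, conj_phase S.conj_atInfinity, map_inv₀, Complex.conj_ofReal]
    linear_combination (((Real.sqrt (n.choose T.card) : ℝ) : ℂ)⁻¹ *
      ((Real.sqrt (n.choose T.card) : ℝ) : ℂ)⁻¹ * (conj (A ((negIdx T).map x)) *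
        A' ((negIdx T).map x) * (conj (B ((posIdx T).map x)) * B' ((posIdx T).map x)))) *
      phase_sq S.atInfinity_sq (List.ofFn (signExp T 0))
  simp only [h]
  rw [← Finset.powerset_univ, Finset.sum_powerset_apply_card (fun k =>
    (((Real.sqrt (n.choose k) : ℝ) : ℂ)⁻¹ * ((Real.sqrt (n.choose k) : ℝ) : ℂ)⁻¹) *
        (listIntegral (fun l => conj (A l) * A' l) k *
        listIntegral (fun l => conj (B l) * B' l) (n - k))), Finset.card_univ, Fintype.card_fin]
  refine Finset.sum_congr rfl fun k hk => ?_
  rw [nsmul_eq_mul, ← mul_assoc, sqrt_choose_inv_mul (by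
    simpa [Nat.lt_succ_iff] using hk), one_mul]

variable {S}

/-- The `n`-particle component of the massless vector of a pair of chiral vectors. -/
noncomputable def pairComponent (A B : ChiralFock S) (n : ℕ) :
    nParticle masslessMeasure (masslessFactor S) n :=
  ⟨(memLp_pairWave S A.memLp_wave B.memLp_wave n).toLp,
    toLp_mem_nParticle (G := pairWave S A.wave B.wave) _ (by
      filter_upwards [listAE_ne_zero n, A.exchangeAt_wave.negPart n, B.exchangeAt_wave.posPart n]
        with p h1 h2 h3
      exact exchangeAt_pairWave S h1 h2 h3)⟩

theorem inner_pairComponent (A B A' B' : ChiralFock S) (n : ℕ) :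
    inner ℂ (pairComponent A B n) (pairComponent A' B' n) =
      ∑ k ∈ Finset.range (n + 1), inner ℂ (A.component k) (A'.component k) *
        inner ℂ (B.component (n - k)) (B'.component (n - k)) := by
  simp only [← Fock.listIntegral_wave]
  rw [← integral_pairWave S A.memLp_wave B.memLp_wave A'.memLp_wave B'.memLp_wave n,
    Submodule.coe_inner, L2.inner_def]
  refine integral_congr_ae ?_
  filter_upwards [(memLp_pairWave S A.memLp_wave B.memLp_wave n).coeFn_toLp,
    (memLp_pairWave S A'.memLp_wave B'.memLp_wave n).coeFn_toLp] with p h1 h2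
  rw [RCLike.inner_apply, mul_comm]
  exact congrArg₂ (fun a b => conj a * b) h1 h2

/-- The squared norms are the terms of the Cauchy product of two absolutely convergent series. -/
theorem summable_norm_pairComponent (A B : ChiralFock S) :
    Summable fun n => ‖pairComponent A B n‖ ^ 2 := by
  have h := summable_norm_sum_mul_range_of_summable_norm (A.summable_inner A).norm
    (B.summable_inner B).norm
  refine h.congr fun n => ?_
  rw [← inner_pairComponent]
  exact (congrArg norm (inner_self_eq_norm_sq_to_K (𝕜 := ℂ) (pairComponent A B n))).trans (by simp)

/-- The massless vector of a pair of chiral vectors, a left and a right moving one. -/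
noncomputable def pairVec (A B : ChiralFock S) : MasslessFock S :=
  (⟨pairComponent A B, by
    apply memℓp_gen
    simpa using summable_norm_pairComponent A B⟩ :
      lp (fun n : ℕ => nParticle masslessMeasure (masslessFactor S) n) 2)

theorem component_pairVec (A B : ChiralFock S) (n : ℕ) :
    (pairVec A B).component n = pairComponent A B n := rfl

theorem wave_pairVec (A B : ChiralFock S) :
    ListAE masslessMeasure fun l => (pairVec A B).wave l = pairWave S A.wave B.wave l := by
  intro n
  simp only [Fock.wave_ofFn]
  exact (memLp_pairWave S A.memLp_wave B.memLp_wave n).coeFn_toLp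

theorem inner_pairVec (A B A' B' : ChiralFock S) :
    inner ℂ (pairVec A B) (pairVec A' B') = inner ℂ A A' * inner ℂ B B' := by
  rw [Fock.inner_eq, Fock.inner_eq, Fock.inner_eq,
    tsum_mul_tsum_eq_tsum_sum_range_of_summable_norm (A.summable_inner A').norm
      (B.summable_inner B').norm]
  exact tsum_congr fun n => inner_pairComponent A B A' B' n

theorem pairVec_add_left (A A' B : ChiralFock S) :
    pairVec (A + A') B = pairVec A B + pairVec A' B := by
  apply Fock.ext_wave
  refine ((((wave_pairVec (A + A') B).and (wave_pairVec A B)).and (wave_pairVec A' B)).and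
    ((Fock.wave_add (pairVec A B) (pairVec A' B)).and (Fock.wave_add A A').negPart)).mono ?_
  rintro l ⟨⟨⟨h1, h2⟩, h3⟩, h4, h5⟩
  rw [h1, h4, h2, h3, pairWave, h5, pairWave, pairWave]
  ring

theorem pairVec_add_right (A B B' : ChiralFock S) :
    pairVec A (B + B') = pairVec A B + pairVec A B' := by
  apply Fock.ext_wave
  refine ((((wave_pairVec A (B + B')).and (wave_pairVec A B)).and (wave_pairVec A B')).and
    ((Fock.wave_add (pairVec A B) (pairVec A B')).and (Fock.wave_add B B').posPart)).mono ?_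
  rintro l ⟨⟨⟨h1, h2⟩, h3⟩, h4, h5⟩
  rw [h1, h4, h2, h3, pairWave, h5, pairWave, pairWave]
  ring

theorem pairVec_smul_left (c : ℂ) (A B : ChiralFock S) :
    pairVec (c • A) B = c • pairVec A B := by
  apply Fock.ext_wave
  refine (((wave_pairVec (c • A) B).and (wave_pairVec A B)).and
    ((Fock.wave_smul c (pairVec A B)).and (Fock.wave_smul c A).negPart)).mono ?_
  rintro l ⟨⟨h1, h2⟩, h4, h5⟩
  rw [h1, h4, h2, pairWave, h5, pairWave]
  ring

theorem pairVec_smul_right (c : ℂ) (A B : ChiralFock S) :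
    pairVec A (c • B) = c • pairVec A B := by
  apply Fock.ext_wave
  refine (((wave_pairVec A (c • B)).and (wave_pairVec A B)).and
    ((Fock.wave_smul c (pairVec A B)).and (Fock.wave_smul c B).posPart)).mono ?_
  rintro l ⟨⟨h1, h2⟩, h4, h5⟩
  rw [h1, h4, h2, pairWave, h5, pairWave]
  ring

open scoped TensorProduct

/-- `pairVec` as an isometry of the algebraic tensor product. -/
noncomputable def pairIsometry (S : ScatteringFunctionWithLimit) :
    (ChiralFock S ⊗[ℂ] ChiralFock S) →ₗᵢ[ℂ] MasslessFock S :=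
  (TensorProduct.lift (LinearMap.mk₂ ℂ pairVec pairVec_add_left pairVec_smul_left
    pairVec_add_right pairVec_smul_right)).isometryOfInner (by
    intro x y
    induction x using TensorProduct.induction_on with
    | zero => simp
    | add a b ha hb => rw [map_add, inner_add_left, ha, hb, inner_add_left]
    | tmul a b =>
      induction y using TensorProduct.induction_on with
      | zero => simp
      | add c d hc hd => rw [map_add, inner_add_right, hc, hd, inner_add_right]
      | tmul c d =>
        rw [TensorProduct.lift.tmul, TensorProduct.lift.tmul, TensorProduct.inner_tmul]
        exact inner_pairVec a b c d)

end Pair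

end Zamolodchikov

namespace Zamolodchikov

/-! ### Square integrable functions on products -/

section Product

variable {X Y : Type*} [MeasurableSpace X] [MeasurableSpace Y] {μ : Measure X} {ν : Measure Y}

theorem memLp_two_mul_prod {a : X → ℂ} {b : Y → ℂ} (ha : MemLp a 2 μ) (hb : MemLp b 2 ν) :
    MemLp (fun z : X × Y => a z.1 * b z.2) 2 (μ.prod ν) := by
  have hm : AEStronglyMeasurable (fun z : X × Y => a z.1 * b z.2) (μ.prod ν) :=
    ha.1.comp_fst.mul hb.1.comp_snd
  rw [memLp_two_iff_integrable_sq_norm hm]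
  simp only [norm_mul, mul_pow]
  exact ((memLp_two_iff_integrable_sq_norm ha.1).1 ha).mul_prod
    ((memLp_two_iff_integrable_sq_norm hb.1).1 hb)

theorem integrable_conj_mul_conj_mul {a : X → ℂ} {b : Y → ℂ} {f : X × Y → ℂ}
    (ha : MemLp a 2 μ) (hb : MemLp b 2 ν) (hf : MemLp f 2 (μ.prod ν)) :
    Integrable (fun z : X × Y => conj (a z.1) * (conj (b z.2) * f z)) (μ.prod ν) := by
  refine (integrable_conj_mul (memLp_two_mul_prod ha hb) hf).congr (Eventually.of_forall fun z => ?_)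
  simp only [map_mul]
  ring

variable [SigmaFinite μ] [SigmaFinite ν]

theorem ae_memLp_fiber {f : X × Y → ℂ} (hf : MemLp f 2 (μ.prod ν)) :
    ∀ᵐ y ∂ν, MemLp (fun x => f (x, y)) 2 μ := by
  have h1 := ((memLp_two_iff_integrable_sq_norm hf.1).1 hf).swap.prod_right_ae
  have h2 := hf.1.prod_swap.prodMk_left
  filter_upwards [h1, h2] with y h3 h4
  exact (memLp_two_iff_integrable_sq_norm h4).2 h3

/-- A square integrable function on a product that is orthogonal to all products of square
integrable functions vanishes. -/
theorem ae_eq_zero_of_orthogonal_products {f : X × Y → ℂ} (hf : MemLp f 2 (μ.prod ν))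
    (h : ∀ (a : Lp ℂ 2 μ) (b : Lp ℂ 2 ν),
      ∫ z, conj (a z.1) * (conj (b z.2) * f z) ∂(μ.prod ν) = 0) : f =ᵐ[μ.prod ν] 0 := by
  have hrect : ∀ (s : Set X) (t : Set Y), MeasurableSet s → MeasurableSet t → μ s < ⊤ →
      ν t < ⊤ → ∫ z in s ×ˢ t, f z ∂(μ.prod ν) = 0 := by
    intro s t hs ht hμ hν
    have := h (indicatorConstLp 2 hs hμ.ne 1) (indicatorConstLp 2 ht hν.ne 1)
    rw [← this, ← integral_indicator (hs.prod ht)]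
    refine integral_congr_ae ?_
    filter_upwards [Measure.quasiMeasurePreserving_fst.ae
      (indicatorConstLp_coeFn (p := 2) (hs := hs) (hμs := hμ.ne) (c := (1 : ℂ))),
      Measure.quasiMeasurePreserving_snd.ae
      (indicatorConstLp_coeFn (p := 2) (hs := ht) (hμs := hν.ne) (c := (1 : ℂ)))] with z h1 h2
    rw [h1, h2]
    by_cases hz1 : z.1 ∈ s <;> by_cases hz2 : z.2 ∈ t <;> simp [Set.indicator, hz1, hz2]
  have hN : ∀ N, ∀ᵐ z ∂(μ.prod ν),
      z ∈ spanningSets μ N ×ˢ spanningSets ν N → f z = 0 := by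
    intro N
    have hRm : MeasurableSet (spanningSets μ N ×ˢ spanningSets ν N) :=
      (measurableSet_spanningSets μ N).prod (measurableSet_spanningSets ν N)
    have hfin : (μ.prod ν) (spanningSets μ N ×ˢ spanningSets ν N) < ⊤ := by
      rw [Measure.prod_prod]
      exact ENNReal.mul_lt_top (measure_spanningSets_lt_top μ N) (measure_spanningSets_lt_top ν N)
    rw [← ae_restrict_iff' hRm]
    have : IsFiniteMeasure ((μ.prod ν).restrict (spanningSets μ N ×ˢ spanningSets ν N)) :=
      ⟨by simpa using hfin⟩
    have hint : Integrable f ((μ.prod ν).restrict (spanningSets μ N ×ˢ spanningSets ν N)) :=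
      (hf.restrict _).integrable (by norm_num)
    -- On a box of finite measure `f` is integrable, and the sets over which it integrates to zero
    -- form a Dynkin system containing the rectangles; the whole box, needed for complements, is
    -- itself a rectangle.
    refine hint.ae_eq_zero_of_forall_setIntegral_eq_zero fun s hs _ => ?_
    induction s, hs using MeasurableSpace.induction_on_inter generateFrom_prod.symm
      isPiSystem_prod with
    | empty => simp
    | basic t ht =>
      obtain ⟨u, hu, v, hv, rfl⟩ := ht
      rw [Measure.restrict_restrict (hu.prod hv), Set.prod_inter_prod]
      exact hrect _ _ (hu.inter (measurableSet_spanningSets μ N))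
        (hv.inter (measurableSet_spanningSets ν N))
        ((measure_mono Set.inter_subset_right).trans_lt (measure_spanningSets_lt_top μ N))
        ((measure_mono Set.inter_subset_right).trans_lt (measure_spanningSets_lt_top ν N))
    | compl t htm ih =>
      have h1 := integral_add_compl htm hint
      rw [ih (measure_lt_top _ _), zero_add] at h1
      rw [h1]
      exact hrect _ _ (measurableSet_spanningSets μ N) (measurableSet_spanningSets ν N)
        (measure_spanningSets_lt_top μ N) (measure_spanningSets_lt_top ν N)
    | iUnion g hd hm ih =>
      rw [integral_iUnion hm hd hint.integrableOn]
      simp [ih _ (measure_lt_top _ _)]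
  filter_upwards [ae_all_iff.2 hN] with z hz
  have h1 : z.1 ∈ ⋃ N, spanningSets μ N := by rw [iUnion_spanningSets]; trivial
  have h2 : z.2 ∈ ⋃ N, spanningSets ν N := by rw [iUnion_spanningSets]; trivial
  obtain ⟨N, hN1⟩ := Set.mem_iUnion.1 h1
  obtain ⟨M, hM1⟩ := Set.mem_iUnion.1 h2
  exact hz (max N M) ⟨monotone_spanningSets μ (le_max_left _ _) hN1,
    monotone_spanningSets ν (le_max_right _ _) hM1⟩

/-- If almost all fibers of `f` lie in a closed subspace, the projection onto it may be omitted in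
integrals against `f`. -/
theorem integral_conj_projection_mul {f : X × Y → ℂ} (hf : MemLp f 2 (μ.prod ν))
    (K : Submodule ℂ (Lp ℂ 2 μ)) [K.HasOrthogonalProjection]
    (hK : ∀ᵐ y ∂ν, ∃ h : MemLp (fun x => f (x, y)) 2 μ, h.toLp ∈ K)
    (a : Lp ℂ 2 μ) (b : Lp ℂ 2 ν) :
    ∫ z, conj ((K.orthogonalProjectionOnto a : Lp ℂ 2 μ) z.1) * (conj (b z.2) * f z) ∂(μ.prod ν) =
      ∫ z, conj (a z.1) * (conj (b z.2) * f z) ∂(μ.prod ν) := by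
  rw [integral_prod_symm _ (integrable_conj_mul_conj_mul (Lp.memLp _) (Lp.memLp b) hf),
    integral_prod_symm _ (integrable_conj_mul_conj_mul (Lp.memLp a) (Lp.memLp b) hf)]
  refine integral_congr_ae ?_
  filter_upwards [hK] with y ⟨hy, hyK⟩
  -- At fixed `y` the integral is an inner product with the fiber of `f`. The fiber lies in `K`, so
  -- the projection does not affect it.
  have key : ∀ c : Lp ℂ 2 μ, ∫ x, conj (c x) * (conj (b y) * f (x, y)) ∂μ =
      conj (b y) * inner ℂ c hy.toLp := by
    intro c
    rw [L2.inner_def, ← integral_const_mul]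
    refine integral_congr_ae ?_
    filter_upwards [hy.coeFn_toLp] with x hx
    rw [hx, RCLike.inner_apply]
    ring
  rw [key, key]
  congr 1
  exact K.inner_orthogonalProjectionOnto_eq_of_mem_right ⟨hy.toLp, hyK⟩ a

end Product

end Zamolodchikov

namespace Zamolodchikov

/-! ### The massless vectors of pairs are total -/

section Total

variable {S : ScatteringFunctionWithLimit}

/-- Passing to negative momenta reverses the order of `L`, and the massless factor at negative
momenta reverses the sign of the rapidity difference. The two reversals cancel. -/
theorem exchangeAt_joinParts_left {Φ : List ℝ → ℂ} {L R : List ℝ}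
    (h : ExchangeAt (masslessFactor S) Φ (joinParts L R)) :
    ExchangeAt (chiralFactor S) (fun L => Φ (joinParts L R)) L := by
  rintro l₁ a b l₂ rfl
  have e : ∀ c d : ℝ, joinParts (l₁ ++ c :: d :: l₂) R =
      l₂.reverse.map (fun β => -Real.exp β) ++ (-Real.exp d) :: (-Real.exp c) ::
        (l₁.reverse.map (fun β => -Real.exp β) ++ R.map Real.exp) := by
    intro c d; simp [joinParts]
  have h1 := h _ _ _ _ (e a b)
  change Φ _ = _ * Φ _
  rw [h1, e b a, masslessFactor_of_neg S (by simp [Real.exp_pos]) (by simp [Real.exp_pos]),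
    neg_neg, neg_neg, Real.log_exp, Real.log_exp]
  rfl

theorem exchangeAt_joinParts_right {Φ : List ℝ → ℂ} {L R : List ℝ}
    (h : ExchangeAt (masslessFactor S) Φ (joinParts L R)) :
    ExchangeAt (chiralFactor S) (fun R => Φ (joinParts L R)) R := by
  rintro l₁ a b l₂ rfl
  have e : ∀ c d : ℝ, joinParts L (l₁ ++ c :: d :: l₂) =
      (L.reverse.map (fun β => -Real.exp β) ++ l₁.map Real.exp) ++ Real.exp c :: Real.exp d ::
        l₂.map Real.exp := by
    intro c d; simp [joinParts]
  have h1 := h _ _ _ _ (e a b)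
  change Φ _ = _ * Φ _
  rw [h1, e b a, masslessFactor_of_pos S (Real.exp_pos _) (Real.exp_pos _), Real.log_exp,
    Real.log_exp]
  rfl

/-- A massless vector is determined by its values at momenta sorted by sign. -/
theorem wave_signExp (Φ : MasslessFock S) {n : ℕ} (T : Finset (Fin n)) :
    ∀ᵐ x ∂(Measure.pi fun _ : Fin n => (volume : Measure ℝ)),
      Φ.wave (List.ofFn (signExp T x)) = phase S.atInfinity (List.ofFn (signExp T 0)) *
        Φ.wave (joinParts ((negIdx T).map x) ((posIdx T).map x)) ∧
      ExchangeAt (masslessFactor S) Φ.wave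
        (joinParts ((negIdx T).map x) ((posIdx T).map x)) := by
  -- Sorting passes through many rearrangements of the momenta, so the exchange relation is needed
  -- at all of them simultaneously.
  filter_upwards [ae_massless_iff.1 (Φ.exchangeAt_wave.perm n) T] with x hx
  have h0 := signExp_ne_zero T x
  have h1 := eq_phase_mul_sorted S (Φ := Φ.wave) (List.ofFn (signExp T x)) [] h0 hx
  have h2 := hx _ (joinParts_perm h0)
  rw [List.nil_append, List.nil_append, phase_signExp] at h1
  rw [negPart_signExp, posPart_signExp] at h1 h2
  exact ⟨h1, h2⟩

/-- Up to a constant sign, the sorted values agree with the restriction of the wave function to the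
sign pattern `T`. -/
theorem memLp_joinParts (Φ : MasslessFock S) {n : ℕ} (T : Finset (Fin n)) :
    MemLp (fun z : (Fin (negIdx T).length → ℝ) × (Fin (posIdx T).length → ℝ) =>
      Φ.wave (joinParts (List.ofFn z.1) (List.ofFn z.2))) 2
      ((Measure.pi fun _ => (volume : Measure ℝ)).prod
        (Measure.pi fun _ => (volume : Measure ℝ))) := by
  rw [← (measurePreserving_splitEquiv T).map_eq, (splitEquiv T).memLp_map_measure_iff]
  refine ((memLp_two_massless_iff.1 (Φ.memLp_wave n) T).const_mul
    (phase S.atInfinity (List.ofFn (signExp T 0)))).ae_eq ?_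
  filter_upwards [wave_signExp Φ T] with x hx
  simp only [Function.comp_apply]
  rw [hx.1, ← map_negIdx, ← map_posIdx, ← mul_assoc, phase_sq S.atInfinity_sq, one_mul]

theorem ae_exchangeAt_joinParts (Φ : MasslessFock S) {n : ℕ} (T : Finset (Fin n)) :
    ∀ᵐ z : (Fin (negIdx T).length → ℝ) × (Fin (posIdx T).length → ℝ)
      ∂((Measure.pi fun _ => (volume : Measure ℝ)).prod
        (Measure.pi fun _ => (volume : Measure ℝ))),
      ExchangeAt (masslessFactor S) Φ.wave (joinParts (List.ofFn z.1) (List.ofFn z.2)) := by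
  rw [← (measurePreserving_splitEquiv T).map_eq, (splitEquiv T).measurableEmbedding.ae_map_iff]
  filter_upwards [wave_signExp Φ T] with x hx
  rw [← map_negIdx, ← map_posIdx]
  exact hx.2

/-- The integral of a massless wave function, at momenta sorted by sign, against a product of two
functions of rapidities. -/
noncomputable def joinIntegral (Φ A B : List ℝ → ℂ) (k m : ℕ) : ℂ :=
  ∫ z, conj (A (List.ofFn z.1)) * (conj (B (List.ofFn z.2)) *
      Φ (joinParts (List.ofFn z.1) (List.ofFn z.2)))
    ∂((Measure.pi fun _ : Fin k => (volume : Measure ℝ)).prod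
      (Measure.pi fun _ : Fin m => (volume : Measure ℝ)))

/-- The count of sign patterns is that of `integral_pairWave`, but only one of the two vectors
carries the normalization, so the binomial coefficient does not cancel completely. -/
theorem inner_pairComponent_component (A B : ChiralFock S) (Φ : MasslessFock S) (n : ℕ) :
    inner ℂ ((pairVec A B).component n) (Φ.component n) =
      ∑ k ∈ Finset.range (n + 1), ((n.choose k : ℕ) : ℂ) *
        (((Real.sqrt (n.choose k) : ℝ) : ℂ)⁻¹ * joinIntegral Φ.wave A.wave B.wave k (n - k)) := by
  rw [Fock.inner_component, integral_massless (integrable_conj_mul ((pairVec A B).memLp_wave n)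
    (Φ.memLp_wave n))]
  have h : ∀ T : Finset (Fin n), ∫ x, conj ((pairVec A B).wave (List.ofFn (signExp T x))) *
      Φ.wave (List.ofFn (signExp T x)) ∂(Measure.pi fun _ : Fin n => (volume : Measure ℝ)) =
      ((Real.sqrt (n.choose T.card) : ℝ) : ℂ)⁻¹ *
        joinIntegral Φ.wave A.wave B.wave T.card (n - T.card) := by
    intro T
    rw [← length_posIdx, ← length_negIdx, joinIntegral,
      ← (measurePreserving_splitEquiv T).integral_comp (splitEquiv T).measurableEmbedding,
      ← integral_const_mul]
    refine integral_congr_ae ?_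
    filter_upwards [wave_signExp Φ T, ae_massless_iff.1 (wave_pairVec A B n) T] with x h1 h2
    rw [h2, pairWave_signExp, h1.1, ← map_negIdx, ← map_posIdx, length_negIdx]
    simp only [map_mul, conj_phase S.conj_atInfinity, map_inv₀, Complex.conj_ofReal]
    linear_combination (((Real.sqrt (n.choose T.card) : ℝ) : ℂ)⁻¹ *
      conj (A.wave ((negIdx T).map x)) * conj (B.wave ((posIdx T).map x)) *
      Φ.wave (joinParts ((negIdx T).map x) ((posIdx T).map x))) *
      phase_sq S.atInfinity_sq (List.ofFn (signExp T 0))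
  simp only [h]
  rw [← Finset.powerset_univ, Finset.sum_powerset_apply_card (fun k =>
    ((Real.sqrt (n.choose k) : ℝ) : ℂ)⁻¹ * joinIntegral Φ.wave A.wave B.wave k (n - k)),
    Finset.card_univ, Fintype.card_fin]
  simp only [nsmul_eq_mul]

theorem joinIntegral_eq_zero_left {Φ B : List ℝ → ℂ} {A : ChiralFock S} {k m : ℕ}
    (h : A.component k = 0) : joinIntegral Φ A.wave B k m = 0 := by
  refine integral_eq_zero_of_ae ?_
  have h1 : ∀ᵐ x ∂(Measure.pi fun _ : Fin k => (volume : Measure ℝ)),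
      A.wave (List.ofFn x) = 0 := by
    simp only [Fock.wave_ofFn, h]
    exact Lp.coeFn_zero _ _ _
  filter_upwards [Measure.quasiMeasurePreserving_fst.ae h1] with z hz
  simp [hz]

theorem joinIntegral_eq_zero_right {Φ A : List ℝ → ℂ} {B : ChiralFock S} {k m : ℕ}
    (h : B.component m = 0) : joinIntegral Φ A B.wave k m = 0 := by
  refine integral_eq_zero_of_ae ?_
  have h1 : ∀ᵐ x ∂(Measure.pi fun _ : Fin m => (volume : Measure ℝ)),
      B.wave (List.ofFn x) = 0 := by
    simp only [Fock.wave_ofFn, h]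
    exact Lp.coeFn_zero _ _ _
  filter_upwards [Measure.quasiMeasurePreserving_snd.ae h1] with z hz
  simp [hz]

theorem Fock.component_single_same {μ : Measure ℝ} [SigmaFinite μ] {s : ExchangeFactor} (n : ℕ)
    (Ψ : nParticle μ s n) : (Fock.single μ s n Ψ).component n = Ψ :=
  lp.single_apply_self (E := fun n => nParticle μ s n) 2 n Ψ

theorem Fock.component_single_ne {μ : Measure ℝ} [SigmaFinite μ] {s : ExchangeFactor} {n m : ℕ}
    (Ψ : nParticle μ s n) (h : m ≠ n) : (Fock.single μ s n Ψ).component m = 0 :=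
  lp.single_apply_ne (E := fun n => nParticle μ s n) 2 n Ψ h

/-- Pair vectors built from `Fock.single` with k and m particles single out one term of the double
sum over n and the number of left movers. -/
theorem joinIntegral_eq_zero {Φ : MasslessFock S}
    (h : ∀ A ∈ ChiralFinite S, ∀ B ∈ ChiralFinite S, inner ℂ (pairVec A B) Φ = 0) (k m : ℕ)
    (a : nParticle volume (chiralFactor S) k) (b : nParticle volume (chiralFactor S) m) :
    ∫ z, conj ((a : L2Power volume k) z.1) * (conj ((b : L2Power volume m) z.2) *
        Φ.wave (joinParts (List.ofFn z.1) (List.ofFn z.2)))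
      ∂((Measure.pi fun _ : Fin k => (volume : Measure ℝ)).prod
        (Measure.pi fun _ : Fin m => (volume : Measure ℝ))) = 0 := by
  set A := Fock.single volume (chiralFactor S) k a with hA
  set B := Fock.single volume (chiralFactor S) m b with hB
  have hAf : A ∈ ChiralFinite S := ⟨k + 1, fun n hn => Fock.component_single_ne a (by omega)⟩
  have hBf : B ∈ ChiralFinite S := ⟨m + 1, fun n hn => Fock.component_single_ne b (by omega)⟩
  have h1 := h A hAf B hBf
  have hz : ∀ k' m', (k' ≠ k ∨ m' ≠ m) → joinIntegral Φ.wave A.wave B.wave k' m' = 0 := by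
    rintro k' m' (h2 | h2)
    · exact joinIntegral_eq_zero_left (Fock.component_single_ne a h2)
    · exact joinIntegral_eq_zero_right (Fock.component_single_ne b h2)
  rw [Fock.inner_eq, tsum_eq_single (k + m)] at h1
  · rw [inner_pairComponent_component, Finset.sum_eq_single k] at h1
    · have hc : (0 : ℝ) < (k + m).choose k := by
        exact_mod_cast Nat.choose_pos (Nat.le_add_right k m)
      have hc2 : ((Real.sqrt ((k + m).choose k) : ℝ) : ℂ)⁻¹ ≠ 0 :=
        inv_ne_zero (Complex.ofReal_ne_zero.2 (Real.sqrt_pos.2 hc).ne')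
      have hc3 : (((k + m).choose k : ℕ) : ℂ) ≠ 0 := by exact_mod_cast hc.ne'
      have h3 := (mul_eq_zero.1 ((mul_eq_zero.1 h1).resolve_left hc3)).resolve_left hc2
      rw [Nat.add_sub_cancel_left] at h3
      unfold joinIntegral at h3
      simp only [Fock.wave_ofFn] at h3
      rw [hA, hB, Fock.component_single_same, Fock.component_single_same] at h3
      exact h3
    · intro k' _ hk'
      rw [hz _ _ (Or.inl hk')]; simp
    · intro hk'
      exact absurd (Finset.mem_range.2 (by omega)) hk'
  · intro n hn
    rw [inner_pairComponent_component]
    refine Finset.sum_eq_zero fun k' hk' => ?_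
    rw [hz, mul_zero, mul_zero]
    have := Finset.mem_range.1 hk'
    omega

/-- The massless vectors of pairs of chiral vectors of finite particle number are total. -/
theorem eq_zero_of_inner_pairVec {Φ : MasslessFock S}
    (h : ∀ A ∈ ChiralFinite S, ∀ B ∈ ChiralFinite S, inner ℂ (pairVec A B) Φ = 0) : Φ = 0 := by
  have key : ∀ (n : ℕ) (T : Finset (Fin n)),
      (fun z : (Fin (negIdx T).length → ℝ) × (Fin (posIdx T).length → ℝ) =>
        Φ.wave (joinParts (List.ofFn z.1) (List.ofFn z.2))) =ᵐ[
      (Measure.pi fun _ => (volume : Measure ℝ)).prod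
        (Measure.pi fun _ => (volume : Measure ℝ))] 0 := by
    intro n T
    have hmem := memLp_joinParts Φ T
    have hex := ae_exchangeAt_joinParts Φ T
    refine ae_eq_zero_of_orthogonal_products hmem fun a b => ?_
    -- Orthogonality is known only for symmetric `a` and `b`. The fibers of the sorted function are
    -- symmetric in each group of rapidities, so both factors may be replaced by their projections:
    -- the left one here, the right one after interchanging the variables.
    rw [← integral_conj_projection_mul hmem (nParticle volume (chiralFactor S) _) ?_ a b]
    · have hswap := integral_prod_swap
        (μ := Measure.pi fun _ : Fin (negIdx T).length => (volume : Measure ℝ))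
        (ν := Measure.pi fun _ : Fin (posIdx T).length => (volume : Measure ℝ))
        (fun z => conj (((nParticle volume (chiralFactor S) _).orthogonalProjectionOnto a :
          L2Power volume _) z.1) * (conj (b z.2) *
            Φ.wave (joinParts (List.ofFn z.1) (List.ofFn z.2))))
      rw [← hswap]
      have hmem' := hmem.comp_measurePreserving
        (Measure.measurePreserving_swap
          (μ := Measure.pi fun _ : Fin (posIdx T).length => (volume : Measure ℝ))
          (ν := Measure.pi fun _ : Fin (negIdx T).length => (volume : Measure ℝ)))
      have hproj := integral_conj_projection_mul hmem' (nParticle volume (chiralFactor S) _) ?_ b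
        ((nParticle volume (chiralFactor S) _).orthogonalProjectionOnto a : L2Power volume _)
      · refine Eq.trans ?_ (hproj.symm.trans ?_)
        · refine integral_congr_ae (Eventually.of_forall fun z => ?_)
          simp only [Function.comp_apply, Prod.fst_swap, Prod.snd_swap]
          ring
        · have h0 := joinIntegral_eq_zero h _ _
            ((nParticle volume (chiralFactor S) _).orthogonalProjectionOnto a)
            ((nParticle volume (chiralFactor S) _).orthogonalProjectionOnto b)
          rw [← integral_prod_swap] at h0
          rw [← h0]
          refine integral_congr_ae (Eventually.of_forall fun z => ?_)
          simp only [Function.comp_apply, Prod.fst_swap, Prod.snd_swap]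
          ring
      · have hex' := (Measure.measurePreserving_swap
          (μ := Measure.pi fun _ : Fin (posIdx T).length => (volume : Measure ℝ))
          (ν := Measure.pi fun _ : Fin (negIdx T).length =>
            (volume : Measure ℝ))).quasiMeasurePreserving.ae hex
        filter_upwards [ae_memLp_fiber hmem', Measure.ae_ae_of_ae_prod
          (Measure.measurePreserving_swap.quasiMeasurePreserving.ae hex')] with x h1 h2
        refine ⟨h1, toLp_mem_nParticle
          (G := fun R => Φ.wave (joinParts (List.ofFn x) R)) h1 ?_⟩
        filter_upwards [h2] with y hy
        exact exchangeAt_joinParts_right hy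
    · filter_upwards [ae_memLp_fiber hmem, Measure.ae_ae_of_ae_prod
        (Measure.measurePreserving_swap.quasiMeasurePreserving.ae hex)] with y h1 h2
      refine ⟨h1, toLp_mem_nParticle (G := fun L => Φ.wave (joinParts L (List.ofFn y))) h1 ?_⟩
      filter_upwards [h2] with x hx
      exact exchangeAt_joinParts_left hx
  apply Fock.ext
  intro n
  apply Subtype.ext
  apply Lp.ext
  refine EventuallyEq.trans ?_ (Lp.coeFn_zero _ _ _).symm
  refine ae_massless_iff.2 fun T => ?_
  filter_upwards [wave_signExp Φ T,
    (measurePreserving_splitEquiv T).quasiMeasurePreserving.ae (key n T)] with x h1 h2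
  rw [← map_negIdx, ← map_posIdx] at h2
  rw [← Fock.wave_ofFn, h1.1, h2]
  simp

/-! ### Extension of the isometry to a unitary. -/

open scoped TensorProduct

/-- The continuous extension of `pairIsometry` to the Hilbert tensor product. -/
noncomputable def pairIsometryExt (S : ScatteringFunctionWithLimit) :
    HilbertTensor (ChiralFock S) (ChiralFock S) →ₗᵢ[ℂ] MasslessFock S where
  toLinearMap := ((pairIsometry S).toContinuousLinearMap.extend
    (UniformSpace.Completion.toComplL (𝕜 := ℂ)
      (E := ChiralFock S ⊗[ℂ] ChiralFock S))).toLinearMap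
  norm_map' Ψ := by
    induction Ψ using UniformSpace.Completion.induction_on with
    | hp => exact isClosed_eq (ContinuousLinearMap.continuous _).norm continuous_norm
    | ih t =>
      refine (congrArg norm (ContinuousLinearMap.extend_eq (pairIsometry S).toContinuousLinearMap
        UniformSpace.Completion.denseRange_coe
        (UniformSpace.Completion.isUniformInducing_coe _) t)).trans ?_
      rw [UniformSpace.Completion.norm_coe]
      exact (pairIsometry S).norm_map t

theorem pairIsometryExt_coe (t : ChiralFock S ⊗[ℂ] ChiralFock S) :
    pairIsometryExt S (t : HilbertTensor (ChiralFock S) (ChiralFock S)) = pairIsometry S t :=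
  ContinuousLinearMap.extend_eq (pairIsometry S).toContinuousLinearMap
    UniformSpace.Completion.denseRange_coe (UniformSpace.Completion.isUniformInducing_coe _) t

/-- The range of an isometry on a complete space is closed, and its orthogonal complement vanishes
because the pair vectors are total. -/
theorem surjective_pairIsometryExt (S : ScatteringFunctionWithLimit) :
    Function.Surjective (pairIsometryExt S) := by
  have hc : IsClosed ((pairIsometryExt S).toLinearMap.range : Set (MasslessFock S)) := by
    have := (pairIsometryExt S).isometry.isClosedEmbedding.isClosed_range
    rwa [LinearMap.coe_range]
  have : CompleteSpace (pairIsometryExt S).toLinearMap.range := hc.completeSpace_coe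
  have htop : (pairIsometryExt S).toLinearMap.range = ⊤ := by
    rw [← Submodule.orthogonal_eq_bot_iff, Submodule.eq_bot_iff]
    intro Φ hΦ
    refine eq_zero_of_inner_pairVec fun A _ B _ => ?_
    rw [Submodule.mem_orthogonal] at hΦ
    refine hΦ _ ⟨((A ⊗ₜ[ℂ] B : ChiralFock S ⊗[ℂ] ChiralFock S) :
      HilbertTensor (ChiralFock S) (ChiralFock S)), ?_⟩
    exact pairIsometryExt_coe _
  exact LinearMap.range_eq_top.1 htop

/-- The unitary of the Hilbert tensor product of the chiral Fock spaces onto the massless one. -/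
noncomputable def pairUnitary (S : ScatteringFunctionWithLimit) :
    HilbertTensor (ChiralFock S) (ChiralFock S) ≃ₗᵢ[ℂ] MasslessFock S :=
  LinearIsometryEquiv.ofSurjective (pairIsometryExt S) (surjective_pairIsometryExt S)

theorem pairUnitary_coe_tmul (A B : ChiralFock S) :
    pairUnitary S ((A ⊗ₜ[ℂ] B : ChiralFock S ⊗[ℂ] ChiralFock S) :
      HilbertTensor (ChiralFock S) (ChiralFock S)) = pairVec A B :=
  pairIsometryExt_coe _

end Total

end Zamolodchikov

namespace Zamolodchikov

/-! ### Poincaré transformations and the reflection -/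

section WaveOps

variable {μ : Measure ℝ} [SigmaFinite μ] {s : ExchangeFactor}

theorem Fock.wave_symmetry (w : ℝ → ℝ) (hw : Measurable w) (b : ℝ → ℝ)
    (hb : MeasurePreserving b μ μ) (hs : ∀ p q, s.toFun (b p) (b q) = s.toFun p q)
    (Ψ : Fock μ s) :
    ListAE μ fun l => (symmetry μ s w hw b hb hs Ψ).wave l =
      Complex.exp (Complex.I * (((l.map w).sum : ℝ) : ℂ)) * Ψ.wave (l.map b) := by
  intro n
  have hc : symmetryL2 μ w hw b hb n (Ψ.component n) =ᵐ[_] _ := coeFn_weightedComp _ _ _ _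
  filter_upwards [hc] with x hx
  rw [wave_ofFn, List.map_ofFn, List.map_ofFn, List.sum_ofFn, wave_ofFn]
  exact hx

theorem reverse_ofFn_eq {α : Type*} {n : ℕ} (x : Fin n → α) :
    (List.ofFn x).reverse = List.ofFn fun j => x (Fin.revPerm j) := by
  apply List.ext_getElem
  · simp
  · intro i h1 h2
    simp only [List.getElem_reverse, List.getElem_ofFn, List.length_ofFn, Fin.revPerm_apply]
    congr 1
    apply Fin.ext
    simp [Fin.rev]
    omega

theorem Fock.wave_reflection (Ψ : Fock μ s) :
    ListAE μ fun l => (reflection μ s Ψ).wave l = conj (Ψ.wave l.reverse) := by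
  intro n
  have hc : reflectionL2 μ n (Ψ.component n) =ᵐ[_] _ := coeFn_conjComp _ _
  filter_upwards [hc] with x hx
  rw [wave_ofFn, reverse_ofFn_eq, wave_ofFn]
  exact hx

theorem Fock.wave_numberPow (ε : ℂ) (hε : ‖ε‖ = 1) (Ψ : Fock μ s) :
    ListAE μ fun l => (numberPow μ s ε hε Ψ).wave l = ε ^ l.length * Ψ.wave l := by
  intro n
  simp only [wave_ofFn, List.length_ofFn]
  exact Lp.coeFn_smul (ε ^ n) (Ψ.component n : L2Power μ n)

end WaveOps

section TensorExt

open scoped TensorProduct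

variable {E F G : Type*} [NormedAddCommGroup E] [InnerProductSpace ℂ E]
    [NormedAddCommGroup F] [InnerProductSpace ℂ F] [NormedAddCommGroup G]

/-- Only continuity and additivity are assumed, so linear and antilinear maps are covered alike;
scalars can be absorbed into elementary tensors. -/
theorem hilbertTensor_ext {f g : HilbertTensor E F → G} (hf : Continuous f) (hg : Continuous g)
    (hfa : ∀ x y, f (x + y) = f x + f y) (hga : ∀ x y, g (x + y) = g x + g y)
    (h : ∀ x y, f ((x ⊗ₜ[ℂ] y : E ⊗[ℂ] F) : HilbertTensor E F) =
      g ((x ⊗ₜ[ℂ] y : E ⊗[ℂ] F) : HilbertTensor E F)) (Ψ : HilbertTensor E F) : f Ψ = g Ψ := by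
  induction Ψ using UniformSpace.Completion.induction_on with
  | hp => exact isClosed_eq hf hg
  | ih t =>
    induction t using TensorProduct.induction_on with
    | zero =>
      have := h 0 0
      rwa [TensorProduct.zero_tmul] at this
    | tmul x y => exact h x y
    | add a b ha hb => rw [UniformSpace.Completion.coe_add, hfa, hga, ha, hb]

end TensorExt

variable {S : ScatteringFunctionWithLimit}

theorem masslessU_pairVec (x : ℝ × ℝ) (θ : ℝ) (A B : ChiralFock S) :
    masslessU S x θ (pairVec A B) =
      pairVec (chiralU S (x.1 + x.2) θ A) (chiralU S (x.1 - x.2) (-θ) B) := by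
  apply Fock.ext_wave
  have h1 : ListAE masslessMeasure fun l => (masslessU S x θ (pairVec A B)).wave l =
      Complex.exp (Complex.I * (((l.map fun p => |p| * x.1 - p * x.2).sum : ℝ) : ℂ)) *
        (pairVec A B).wave (l.map (boost θ)) := Fock.wave_symmetry _ _ _ _ _ _
  have h2 : ListAE masslessMeasure fun l => (pairVec A B).wave (l.map (boost θ)) =
      pairWave S A.wave B.wave (l.map (boost θ)) := by
    intro n
    have := (measurePreserving_pi (fun _ : Fin n => masslessMeasure) (fun _ => masslessMeasure)
      fun _ => measurePreserving_boost θ).quasiMeasurePreserving.ae (wave_pairVec A B n)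
    filter_upwards [this] with p hp
    rw [List.map_ofFn]
    exact hp
  have h3 : ListAE volume fun l => (chiralU S (x.1 + x.2) θ A).wave l =
      Complex.exp (Complex.I * (((l.map fun β => (x.1 + x.2) * Real.exp β).sum : ℝ) : ℂ)) *
        A.wave (l.map (· + θ)) := Fock.wave_symmetry _ _ _ _ _ _
  have h4 : ListAE volume fun l => (chiralU S (x.1 - x.2) (-θ) B).wave l =
      Complex.exp (Complex.I * (((l.map fun β => (x.1 - x.2) * Real.exp β).sum : ℝ) : ℂ)) *
        B.wave (l.map (· + -θ)) := Fock.wave_symmetry _ _ _ _ _ _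
  refine ((h1.and h2).and ((wave_pairVec (chiralU S (x.1 + x.2) θ A)
    (chiralU S (x.1 - x.2) (-θ) B)).and (h3.negPart.and h4.posPart))).mono ?_
  rintro l ⟨⟨e1, e2⟩, e3, e4, e5⟩
  rw [e1, e2, e3, pairWave, pairWave, e4, e5, negPart_map_boost, posPart_map_boost,
    phase_map_boost, sum_map_momentum, List.length_map, List.length_map, Complex.ofReal_add,
    mul_add, Complex.exp_add]
  ring

theorem masslessU_pairUnitary (x : ℝ × ℝ) (θ : ℝ)
    (Ψ : HilbertTensor (ChiralFock S) (ChiralFock S)) :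
    masslessU S x θ (pairUnitary S Ψ) =
      pairUnitary S (tensorOp (chiralU S (x.1 + x.2) θ).toContinuousLinearMap
        (chiralU S (x.1 - x.2) (-θ)).toContinuousLinearMap Ψ) := by
  revert Ψ
  refine hilbertTensor_ext ((masslessU S x θ).continuous.comp (pairUnitary S).continuous)
    ((pairUnitary S).continuous.comp (ContinuousLinearMap.continuous _))
    (fun a b => by rw [map_add, map_add]) (fun a b => by rw [map_add, map_add]) fun A B => ?_
  rw [tensorOp, ContinuousLinearMap.completion_apply_coe, TensorProduct.mapL_tmul,
    pairUnitary_coe_tmul, pairUnitary_coe_tmul]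
  exact masslessU_pairVec x θ A B

open scoped TensorProduct

/-- Both sides depend only on the parities of `k` and `m`. The right side is the combination that
`parityTwist` produces. -/
theorem sign_pow_mul {ε : ℂ} (hε : ε ^ 2 = 1) (k m : ℕ) :
    ε ^ (k * m) = 1 / 2 * (1 + ε ^ k + ε ^ m - ε ^ k * ε ^ m) := by
  have hpow : ∀ j : ℕ, ε ^ j = 1 ∨ ε ^ j = ε := by
    intro j
    rcases Nat.even_or_odd j with ⟨i, rfl⟩ | ⟨i, rfl⟩
    · exact Or.inl (by rw [← two_mul, pow_mul, hε, one_pow])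
    · exact Or.inr (by rw [pow_add, pow_mul, hε, one_pow, one_mul, pow_one])
  rw [pow_mul]
  rcases hpow k with h1 | h1 <;> rcases hpow m with h2 | h2 <;> rw [h1] <;>
    simp only [h2, one_pow]
  · ring
  · ring
  · ring
  · linear_combination (1 / 2 : ℂ) * hε

theorem pairUnitary_doubleNumberPow_tmul (A B : ChiralFock S) :
    pairUnitary S (doubleNumberPow volume (chiralFactor S) S.atInfinity S.norm_atInfinity
        ((A ⊗ₜ[ℂ] B : ChiralFock S ⊗[ℂ] ChiralFock S) :
          HilbertTensor (ChiralFock S) (ChiralFock S))) =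
      (1 / 2 : ℂ) • (pairVec A B +
        pairVec (numberPow volume (chiralFactor S) S.atInfinity S.norm_atInfinity A) B +
        pairVec A (numberPow volume (chiralFactor S) S.atInfinity S.norm_atInfinity B) -
        pairVec (numberPow volume (chiralFactor S) S.atInfinity S.norm_atInfinity A)
          (numberPow volume (chiralFactor S) S.atInfinity S.norm_atInfinity B)) := by
  simp only [doubleNumberPow, parityTwist, tensorOp, smul_apply, sub_apply, add_apply,
    ContinuousLinearMap.id_apply, ContinuousLinearMap.completion_apply_coe,
    TensorProduct.mapL_tmul, map_smul, map_add, map_sub, pairUnitary_coe_tmul]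
  rfl

/-- Each of the four pair vectors multiplies the wave function by powers of ε given by the lengths
of the two parts, and `sign_pow_mul` adds them up. No fixed particle number of `A` or `B` is needed.
-/
theorem wave_pairUnitary_doubleNumberPow (A B : ChiralFock S) :
    ListAE masslessMeasure fun l =>
      (pairUnitary S (doubleNumberPow volume (chiralFactor S) S.atInfinity S.norm_atInfinity
        ((A ⊗ₜ[ℂ] B : ChiralFock S ⊗[ℂ] ChiralFock S) :
          HilbertTensor (ChiralFock S) (ChiralFock S)))).wave l =
      S.atInfinity ^ ((negPart l).length * (posPart l).length) *
        pairWave S A.wave B.wave l := by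
  set ε := S.atInfinity with hε
  set A' := numberPow volume (chiralFactor S) ε S.norm_atInfinity A with hA'
  set B' := numberPow volume (chiralFactor S) ε S.norm_atInfinity B with hB'
  have hdec : pairUnitary S (doubleNumberPow volume (chiralFactor S) S.atInfinity
        S.norm_atInfinity ((A ⊗ₜ[ℂ] B : ChiralFock S ⊗[ℂ] ChiralFock S) :
          HilbertTensor (ChiralFock S) (ChiralFock S))) =
      (1 / 2 : ℂ) • (((pairVec A B + pairVec A' B) + pairVec A B') + (-1 : ℂ) • pairVec A' B') := by
    rw [pairUnitary_doubleNumberPow_tmul, neg_one_smul, ← sub_eq_add_neg]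
  rw [hdec]
  refine ((((Fock.wave_smul (1 / 2 : ℂ) (((pairVec A B + pairVec A' B) + pairVec A B') +
    (-1 : ℂ) • pairVec A' B')).and (Fock.wave_add ((pairVec A B + pairVec A' B) + pairVec A B')
    ((-1 : ℂ) • pairVec A' B'))).and ((Fock.wave_add (pairVec A B + pairVec A' B)
    (pairVec A B')).and (Fock.wave_add (pairVec A B) (pairVec A' B)))).and (((Fock.wave_smul (-1 : ℂ) (pairVec A' B')).and
    ((wave_pairVec A B).and (wave_pairVec A' B))).and (((wave_pairVec A B').and
    (wave_pairVec A' B')).and ((Fock.wave_numberPow ε S.norm_atInfinity A).negPart.and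
      (Fock.wave_numberPow ε S.norm_atInfinity B).posPart)))).mono ?_
  rintro l ⟨⟨⟨e1, e2⟩, e3, e4⟩, ⟨e5, e6, e7⟩, ⟨e8, e9⟩, e10, e11⟩
  rw [e1, e2, e3, e4, e5, e6, e7, e8, e9]
  unfold pairWave
  rw [hA', hB', e10, e11]
  generalize (negPart l).length = k
  generalize hm : (posPart l).length = m
  have hε2 := S.atInfinity_sq
  rw [← hε] at hε2 ⊢
  rw [sign_pow_mul hε2]
  ring

/-- Reversing the momenta reverses both parts, as the chiral reflections do. The change of the
phase, given by `phase_reverse`, is exactly the twist. -/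
theorem masslessUj_pairVec (A B : ChiralFock S) :
    masslessUj S (pairVec A B) =
      pairUnitary S (doubleNumberPow volume (chiralFactor S) S.atInfinity S.norm_atInfinity
        ((chiralUj S A ⊗ₜ[ℂ] chiralUj S B : ChiralFock S ⊗[ℂ] ChiralFock S) :
          HilbertTensor (ChiralFock S) (ChiralFock S))) := by
  apply Fock.ext_wave
  have h1 : ListAE masslessMeasure fun l => (masslessUj S (pairVec A B)).wave l =
      conj ((pairVec A B).wave l.reverse) := Fock.wave_reflection _
  have h2 : ListAE masslessMeasure fun l => (pairVec A B).wave l.reverse =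
      pairWave S A.wave B.wave l.reverse :=
    (wave_pairVec A B).perm.mono fun l hl => hl _ (List.reverse_perm l)
  have h3 : ListAE volume fun l => (chiralUj S A).wave l = conj (A.wave l.reverse) :=
    Fock.wave_reflection _
  have h4 : ListAE volume fun l => (chiralUj S B).wave l = conj (B.wave l.reverse) :=
    Fock.wave_reflection _
  refine ((h1.and h2).and ((wave_pairUnitary_doubleNumberPow (chiralUj S A) (chiralUj S B)).and
    (h3.negPart.and h4.posPart))).mono ?_
  rintro l ⟨⟨e1, e2⟩, e3, e4, e5⟩
  rw [e1, e2, e3, pairWave, pairWave, e4, e5, negPart_reverse, posPart_reverse,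
    phase_reverse S.atInfinity_sq, List.length_reverse, List.length_reverse]
  simp only [map_mul, map_inv₀, Complex.conj_ofReal, conj_phase S.conj_atInfinity, map_pow,
    S.conj_atInfinity]
  ring

theorem masslessUj_pairUnitary (Ψ : HilbertTensor (ChiralFock S) (ChiralFock S)) :
    masslessUj S (pairUnitary S Ψ) =
      pairUnitary S (doubleNumberPow volume (chiralFactor S) S.atInfinity S.norm_atInfinity
        (antitensorOp (chiralUj S) (chiralUj S) Ψ)) := by
  revert Ψ
  refine hilbertTensor_ext ((masslessUj S).continuous.comp (pairUnitary S).continuous)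
    ((pairUnitary S).continuous.comp ((ContinuousLinearMap.continuous _).comp
      (ContinuousLinearMap.continuous _)))
    (fun a b => by rw [map_add, map_add]) (fun a b => by rw [map_add, map_add, map_add])
    fun A B => ?_
  rw [pairUnitary_coe_tmul, masslessUj_pairVec, antitensorOp,
    ContinuousLinearMap.completion_apply_coe]
  rfl

end Zamolodchikov

namespace Zamolodchikov

/-! ### Creation operators -/

section Creation

variable {μ : Measure ℝ} [SigmaFinite μ] {s : ExchangeFactor}

theorem coeFn_tensorLeft_wave (φ : Lp ℂ 2 μ) (Ψ : Fock μ s) (n : ℕ) :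
    tensorLeft φ n (Ψ.component n : L2Power μ n) =ᵐ[Measure.pi fun _ : Fin (n + 1) => μ]
      fun p => φ (p 0) * Ψ.wave (List.ofFn fun i : Fin n => p i.succ) := by
  refine (coeFn_tensorLeft φ n _).trans (Eventually.of_forall fun p => ?_)
  simp only [Fock.wave_ofFn]

theorem integrable_conj_wave_mul_tensorLeft (φ : Lp ℂ 2 μ) (Φ Ψ : Fock μ s) (n : ℕ) :
    Integrable (fun p : Fin (n + 1) → ℝ => conj (Φ.wave (List.ofFn p)) *
      (φ (p 0) * Ψ.wave (List.ofFn fun i : Fin n => p i.succ)))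
      (Measure.pi fun _ : Fin (n + 1) => μ) := by
  refine (integrable_conj_mul (Φ.memLp_wave (n + 1))
    (Lp.memLp (tensorLeft φ n (Ψ.component n : L2Power μ n)))).congr ?_
  filter_upwards [coeFn_tensorLeft_wave φ Ψ n] with p hp
  rw [hp]

/-- Against a vector that is already symmetric, the symmetrizing projection may be omitted. No
explicit formula for the projection is therefore required. -/
theorem inner_createN (φ : Lp ℂ 2 μ) (Φ Ψ : Fock μ s) (n : ℕ) :
    inner ℂ (Φ.component (n + 1)) (createN s φ n (Ψ.component n)) =
      (Real.sqrt (n + 1) : ℂ) * ∫ p : Fin (n + 1) → ℝ, conj (Φ.wave (List.ofFn p)) *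
        (φ (p 0) * Ψ.wave (List.ofFn fun i : Fin n => p i.succ))
        ∂(Measure.pi fun _ : Fin (n + 1) => μ) := by
  have h1 : createN s φ n (Ψ.component n) = (Real.sqrt (n + 1) : ℂ) •
      (nParticle μ s (n + 1)).orthogonalProjectionOnto
        (tensorLeft φ n (Ψ.component n : L2Power μ n)) := rfl
  rw [h1]
  refine (inner_smul_right (𝕜 := ℂ) (E := nParticle μ s (n + 1)) _ _ _).trans ?_
  rw [Submodule.inner_orthogonalProjectionOnto_eq_of_mem_left, L2.inner_def]
  congr 1
  refine integral_congr_ae ?_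
  filter_upwards [coeFn_tensorLeft_wave φ Ψ n] with p hp
  rw [hp, RCLike.inner_apply, mul_comm]
  simp only [Fock.wave_ofFn]

theorem component_creation_succ (φ : Lp ℂ 2 μ) (Ψ : finiteParticle μ s) (n : ℕ) :
    (creation s φ Ψ : Fock μ s).component (n + 1) =
      createN s φ n ((Ψ : Fock μ s).component n) := rfl

theorem component_reflection (Ψ : Fock μ s) (n : ℕ) :
    (reflection μ s Ψ).component n = restrictNParticle (reflectionL2 μ n)
      (reflectionL2_mem μ s n) (Ψ.component n) := rfl

theorem reflection_reflection (Ψ : Fock μ s) : reflection μ s (reflection μ s Ψ) = Ψ := by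
  apply Fock.ext_wave
  have h1 : ListAE μ fun l => (reflection μ s Ψ).wave l.reverse = conj (Ψ.wave l) :=
    (Fock.wave_reflection Ψ).perm.mono fun l hl => by
      rw [hl _ (List.reverse_perm l), List.reverse_reverse]
  refine ((Fock.wave_reflection (reflection μ s Ψ)).and h1).mono ?_
  rintro l ⟨e1, e2⟩
  rw [e1, e2, Complex.conj_conj]

theorem inner_component_reflection (Φ Ψ : Fock μ s) (n : ℕ) :
    inner ℂ (Φ.component n) ((reflection μ s Ψ).component n) =
      conj (inner ℂ ((reflection μ s Φ).component n) (Ψ.component n)) := by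
  conv_lhs => rw [← reflection_reflection Φ]
  rw [component_reflection, component_reflection Ψ]
  exact inner_antilinear _ _ _

end Creation

/-! ### Counting sign patterns with a prescribed first sign. -/

section Counting

/-- A subset containing position 0 is determined by its trace on the other n positions and has one
element more than that trace. -/
theorem sum_ite_zero_mem (n : ℕ) (f : ℕ → ℂ) :
    ∑ T : Finset (Fin (n + 1)), (if 0 ∈ T then f T.card else 0) =
      ∑ k ∈ Finset.range (n + 1), ((n.choose k : ℕ) : ℂ) * f (k + 1) := by
  have h0 : (0 : Fin (n + 1)) ∉ Finset.univ.map (Fin.succEmb n) := by simp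
  have hu : (Finset.univ : Finset (Fin (n + 1))) =
      insert 0 (Finset.univ.map (Fin.succEmb n)) := by
    rw [Fin.univ_succ, Finset.cons_eq_insert]; rfl
  rw [← Finset.powerset_univ, hu, Finset.sum_powerset_insert h0]
  have h1 : ∑ t ∈ (Finset.univ.map (Fin.succEmb n)).powerset, (if 0 ∈ t then f t.card else 0) = 0 :=
    Finset.sum_eq_zero fun t ht => if_neg fun h => h0 (Finset.mem_powerset.1 ht h)
  have h2 : ∑ t ∈ (Finset.univ.map (Fin.succEmb n)).powerset,
      (if 0 ∈ insert 0 t then f (insert 0 t).card else 0) =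
      ∑ t ∈ (Finset.univ.map (Fin.succEmb n)).powerset, f (t.card + 1) := by
    refine Finset.sum_congr rfl fun t ht => ?_
    rw [if_pos (Finset.mem_insert_self _ _),
      Finset.card_insert_of_notMem fun h => h0 (Finset.mem_powerset.1 ht h)]
  rw [h1, h2, zero_add, Finset.sum_powerset_apply_card fun k => f (k + 1)]
  simp

theorem sum_ite_zero_notMem (n : ℕ) (f : ℕ → ℂ) :
    ∑ T : Finset (Fin (n + 1)), (if 0 ∈ T then 0 else f T.card) =
      ∑ k ∈ Finset.range (n + 1), ((n.choose k : ℕ) : ℂ) * f k := by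
  have h0 : (0 : Fin (n + 1)) ∉ Finset.univ.map (Fin.succEmb n) := by simp
  have hu : (Finset.univ : Finset (Fin (n + 1))) =
      insert 0 (Finset.univ.map (Fin.succEmb n)) := by
    rw [Fin.univ_succ, Finset.cons_eq_insert]; rfl
  rw [← Finset.powerset_univ, hu, Finset.sum_powerset_insert h0]
  have h1 : ∑ t ∈ (Finset.univ.map (Fin.succEmb n)).powerset, (if 0 ∈ t then 0 else f t.card) =
      ∑ t ∈ (Finset.univ.map (Fin.succEmb n)).powerset, f t.card :=
    Finset.sum_congr rfl fun t ht => if_neg fun h => h0 (Finset.mem_powerset.1 ht h)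
  have h2 : ∑ t ∈ (Finset.univ.map (Fin.succEmb n)).powerset,
      (if 0 ∈ insert 0 t then 0 else f (insert 0 t).card) = 0 :=
    Finset.sum_eq_zero fun t _ => if_pos (Finset.mem_insert_self _ _)
  rw [h1, h2, add_zero, Finset.sum_powerset_apply_card]
  simp

/-- Here √N comes from the massless creation operator, x counts sign patterns, and x and y are the
binomial normalizations of the two pair vectors. What remains is the factor √K of the chiral
creation operator. -/
theorem sqrt_mul_inv_sqrt {N x y K : ℕ} (hx : 0 < x) (hy : 0 < y) (h : N * x = y * K) :
    ((Real.sqrt N : ℝ) : ℂ) * ((x : ℂ) * (((Real.sqrt y : ℝ) : ℂ)⁻¹ *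
      ((Real.sqrt x : ℝ) : ℂ)⁻¹)) = ((Real.sqrt K : ℝ) : ℂ) := by
  have hx' : (0 : ℝ) < x := by exact_mod_cast hx
  have hy' : (0 : ℝ) < y := by exact_mod_cast hy
  have e : Real.sqrt N * (x * ((Real.sqrt y)⁻¹ * (Real.sqrt x)⁻¹)) = Real.sqrt K := by
    have h1 : Real.sqrt N * Real.sqrt x = Real.sqrt y * Real.sqrt K := by
      rw [← Real.sqrt_mul (Nat.cast_nonneg _), ← Real.sqrt_mul (Nat.cast_nonneg _)]
      exact_mod_cast congrArg (fun a : ℕ => Real.sqrt a) h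
    have h2 : (x : ℝ) = Real.sqrt x * Real.sqrt x := (Real.mul_self_sqrt hx'.le).symm
    have h3 := (Real.sqrt_pos.2 hx').ne'
    have h4 := (Real.sqrt_pos.2 hy').ne'
    calc Real.sqrt N * (x * ((Real.sqrt y)⁻¹ * (Real.sqrt x)⁻¹))
        = Real.sqrt N * ((Real.sqrt x * Real.sqrt x) * ((Real.sqrt y)⁻¹ * (Real.sqrt x)⁻¹)) := by
          rw [← h2]
      _ = (Real.sqrt N * Real.sqrt x) * (Real.sqrt y)⁻¹ := by field_simp
      _ = Real.sqrt K := by rw [h1]; field_simp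
  rw [← e]
  push_cast
  ring

end Counting

/-! ### Matrix elements of creation operators between pair vectors. -/

variable {S : ScatteringFunctionWithLimit}

/-- The integrand of the matrix elements of the chiral creation operator. -/
noncomputable def headIntegrand (ψ : ℝ → ℂ) (B D : List ℝ → ℂ) (l : List ℝ) : ℂ :=
  conj (B l) * (ψ (l.headD 0) * D l.tail)

/-- The integrand of the matrix elements of the reflected chiral creation operator. -/
noncomputable def lastIntegrand (ψ : ℝ → ℂ) (A C : List ℝ → ℂ) (l : List ℝ) : ℂ :=
  conj (A l) * (ψ (l.getLastD 0) * C l.dropLast)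

theorem inner_yDagger (ψ : Lp ℂ 2 (volume : Measure ℝ)) (B : ChiralFock S) (D : ChiralFinite S)
    (m : ℕ) : inner ℂ (B.component (m + 1)) ((yDagger S ψ D : ChiralFock S).component (m + 1)) =
      ((Real.sqrt ((m + 1 : ℕ) : ℝ) : ℝ) : ℂ) *
        listIntegral (headIntegrand ψ B.wave (D : ChiralFock S).wave) (m + 1) := by
  unfold yDagger
  rw [component_creation_succ, inner_createN, listIntegral]
  push_cast
  congr 2
  funext p
  simp [headIntegrand, List.ofFn_succ]

/-- Conjugation with the reflection reverses the order of the rapidities, so the particle is created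
at the last position instead of the first. The conjugate in `star ψ` cancels that of the antilinear
reflection. -/
theorem inner_yDaggerPrime (ψ : Lp ℂ 2 (volume : Measure ℝ)) (A : ChiralFock S)
    (C : ChiralFinite S) (k : ℕ) :
    inner ℂ (A.component (k + 1)) ((yDaggerPrime S ψ C : ChiralFock S).component (k + 1)) =
      ((Real.sqrt ((k + 1 : ℕ) : ℝ) : ℝ) : ℂ) *
        listIntegral (lastIntegrand ψ A.wave (C : ChiralFock S).wave) (k + 1) := by
  have h1 : (yDaggerPrime S ψ C : ChiralFock S) = reflection volume (chiralFactor S)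
    (yDagger S (star ψ) (reflectionFinite volume (chiralFactor S) C) : ChiralFock S) := rfl
  rw [h1, inner_component_reflection, inner_yDagger, map_mul, Complex.conj_ofReal]
  congr 1
  rw [listIntegral, listIntegral, ← integral_conj]
  have hp : ∫ y, lastIntegrand ψ A.wave (C : ChiralFock S).wave (List.ofFn y)
        ∂(Measure.pi fun _ : Fin (k + 1) => (volume : Measure ℝ)) =
      ∫ y, lastIntegrand ψ A.wave (C : ChiralFock S).wave (List.ofFn y).reverse
        ∂(Measure.pi fun _ : Fin (k + 1) => (volume : Measure ℝ)) := by
    have hmp := measurePreserving_perm volume (Fin.revPerm (n := k + 1))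
    have hme : MeasurableEmbedding fun (p : Fin (k + 1) → ℝ) i => p (Fin.revPerm i) :=
      (MeasurableEquiv.piCongrLeft (fun _ : Fin (k + 1) => ℝ)
        Fin.revPerm).symm.measurableEmbedding
    simp only [reverse_ofFn_eq]
    exact (hmp.integral_comp hme fun y =>
      lastIntegrand ψ A.wave (C : ChiralFock S).wave (List.ofFn y)).symm
  rw [hp]
  have hst : ∀ᵐ y ∂(Measure.pi fun _ : Fin (k + 1) => (volume : Measure ℝ)),
      (star ψ : Lp ℂ 2 (volume : Measure ℝ)) (y 0) = conj (ψ (y 0)) :=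
    (Measure.quasiMeasurePreserving_eval (fun _ : Fin (k + 1) => (volume : Measure ℝ)) 0).ae
      (Lp.coeFn_star ψ)
  have htail : ∀ᵐ y ∂(Measure.pi fun _ : Fin (k + 1) => (volume : Measure ℝ)),
      (reflectionFinite volume (chiralFactor S) C : ChiralFock S).wave
        (List.ofFn fun i : Fin k => y i.succ) =
      conj ((C : ChiralFock S).wave (List.ofFn fun i : Fin k => y i.succ).reverse) :=
    (Measure.quasiMeasurePreserving_snd.comp (measurePreserving_piFinSuccAbove
      (fun _ : Fin (k + 1) => (volume : Measure ℝ)) 0).quasiMeasurePreserving).ae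
      (Fock.wave_reflection (C : ChiralFock S) k)
  refine integral_congr_ae ?_
  filter_upwards [hst, htail, Fock.wave_reflection A (k + 1)] with y e1 e2 e3
  have hl : List.ofFn y = y 0 :: List.ofFn fun i : Fin k => y i.succ := List.ofFn_succ
  unfold headIntegrand lastIntegrand
  rw [e3]
  rw [hl, List.reverse_cons, List.headD_cons, List.tail_cons, e1, e2, List.getLastD_concat,
    List.dropLast_concat]
  simp

/-- Matrix elements of the creation operators of negative momenta. -/
theorem integral_pairVec_leftEmbed (ψ : Lp ℂ 2 (volume : Measure ℝ)) (A B C D : ChiralFock S)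
    (n : ℕ) :
    ∫ p : Fin (n + 1) → ℝ, conj ((pairVec A B).wave (List.ofFn p)) *
        (leftEmbed ψ (p 0) * (pairVec C D).wave (List.ofFn fun i : Fin n => p i.succ))
        ∂(Measure.pi fun _ : Fin (n + 1) => masslessMeasure) =
      ∑ k ∈ Finset.range (n + 1), ((n.choose k : ℕ) : ℂ) *
        (((Real.sqrt ((n + 1).choose (k + 1)) : ℝ) : ℂ)⁻¹ *
          ((Real.sqrt (n.choose k) : ℝ) : ℂ)⁻¹ *
        (listIntegral (lastIntegrand ψ A.wave C.wave) (k + 1) *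
          listIntegral (fun l => conj (B.wave l) * D.wave l) (n - k))) := by
  rw [integral_massless (integrable_conj_wave_mul_tensorLeft _ _ _ n)]
  have h1 : ∀ᵐ p ∂(Measure.pi fun _ : Fin (n + 1) => masslessMeasure),
      (leftEmbed ψ) (p 0) = if p 0 < 0 then ψ (Real.log (-p 0)) else 0 :=
    (Measure.quasiMeasurePreserving_eval (fun _ : Fin (n + 1) => masslessMeasure) 0).ae
      (memLp_leftEmbed ψ).coeFn_toLp
  have h2 : ∀ᵐ p ∂(Measure.pi fun _ : Fin (n + 1) => masslessMeasure),
      (pairVec C D).wave (List.ofFn fun i : Fin n => p i.succ) =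
        pairWave S C.wave D.wave (List.ofFn fun i : Fin n => p i.succ) :=
    (Measure.quasiMeasurePreserving_snd.comp (measurePreserving_piFinSuccAbove
      (fun _ : Fin (n + 1) => masslessMeasure) 0).quasiMeasurePreserving).ae
      (wave_pairVec C D n)
  have h3 := wave_pairVec A B (n + 1)
  -- The truncated difference `k - 1` is harmless: `F` is used only at sets containing position 0,
  -- whose cardinality is positive.
  obtain ⟨F, hF⟩ : ∃ F : ℕ → ℂ, ∀ k, F k = ((Real.sqrt ((n + 1).choose k) : ℝ) : ℂ)⁻¹ *
          ((Real.sqrt (n.choose (k - 1)) : ℝ) : ℂ)⁻¹ *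
        (listIntegral (lastIntegrand ψ A.wave C.wave) k *
          listIntegral (fun l => conj (B.wave l) * D.wave l) (n + 1 - k)) := ⟨_, fun _ => rfl⟩
  have key : ∀ T : Finset (Fin (n + 1)),
      ∫ x, conj ((pairVec A B).wave (List.ofFn (signExp T x))) * (leftEmbed ψ (signExp T x 0) *
        (pairVec C D).wave (List.ofFn fun i : Fin n => signExp T x i.succ))
        ∂(Measure.pi fun _ : Fin (n + 1) => (volume : Measure ℝ)) =
      if 0 ∈ T then F T.card else 0 := by
    intro T
    rw [hF]
    split_ifs with h0
    -- A negative first momentum becomes the last entry of the reversed left moving list and leaves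
    -- the phase unchanged. The phases of the list and of its tail therefore cancel.
    · rw [← integral_split_mul, ← integral_const_mul]
      refine integral_congr_ae ?_
      filter_upwards [ae_massless_iff.1 h1 T, ae_massless_iff.1 h2 T, ae_massless_iff.1 h3 T]
        with x e1 e2 e3
      have hp : signExp T x 0 < 0 := by simp [signExp, h0, Real.exp_pos]
      have hN := negPart_signExp T x
      have hP := posPart_signExp T x
      rw [e1, e2, e3, if_pos hp]
      have hl : List.ofFn (signExp T x) = signExp T x 0 ::
        List.ofFn fun i : Fin n => signExp T x i.succ := List.ofFn_succ
      have hlen : (negPart (List.ofFn fun i : Fin n => signExp T x i.succ)).length =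
          T.card - 1 := by
        have := congrArg List.length hN
        rw [hl, negPart_cons_neg hp, List.length_append, List.length_map, length_negIdx] at this
        simp at this
        omega
      unfold pairWave
      rw [hN, hP, List.length_map, length_negIdx, hlen, List.length_ofFn, List.length_ofFn]
      rw [hl] at hN hP ⊢
      rw [negPart_cons_neg hp] at hN
      rw [posPart_cons_nonpos hp.le] at hP
      rw [phase_cons_nonpos _ hp.le, ← hN, ← hP]
      unfold lastIntegrand
      rw [List.getLastD_concat, List.dropLast_concat]
      simp only [map_mul, map_inv₀, Complex.conj_ofReal, conj_phase S.conj_atInfinity]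
      have hph := phase_sq S.atInfinity_sq (List.ofFn fun i : Fin n => signExp T x i.succ)
      generalize (List.ofFn fun i : Fin n => signExp T x i.succ) = l at hph ⊢
      linear_combination (((Real.sqrt ((n + 1).choose T.card) : ℝ) : ℂ)⁻¹ *
        ((Real.sqrt (n.choose (T.card - 1)) : ℝ) : ℂ)⁻¹ *
        conj (A.wave (negPart l ++ [Real.log (-signExp T x 0)])) * conj (B.wave (posPart l)) *
        ψ (Real.log (-signExp T x 0)) * C.wave (negPart l) * D.wave (posPart l)) * hph
    · refine integral_eq_zero_of_ae ?_
      filter_upwards [ae_massless_iff.1 h1 T] with x e1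
      have hp : ¬ signExp T x 0 < 0 := by simp [signExp, h0, (Real.exp_pos _).le]
      rw [e1, if_neg hp]
      simp
  refine (Finset.sum_congr rfl fun T _ => key T).trans ((sum_ite_zero_mem n F).trans ?_)
  refine Finset.sum_congr rfl fun k _ => ?_
  rw [hF, Nat.add_sub_cancel, Nat.add_sub_add_right]

/-- Matrix elements of the creation operators of positive momenta. -/
theorem integral_pairVec_rightEmbed (ψ : Lp ℂ 2 (volume : Measure ℝ)) (A B C D : ChiralFock S)
    (n : ℕ) :
    ∫ p : Fin (n + 1) → ℝ, conj ((pairVec A B).wave (List.ofFn p)) *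
        (rightEmbed ψ (p 0) * (pairVec C D).wave (List.ofFn fun i : Fin n => p i.succ))
        ∂(Measure.pi fun _ : Fin (n + 1) => masslessMeasure) =
      ∑ k ∈ Finset.range (n + 1), ((n.choose k : ℕ) : ℂ) *
        (((Real.sqrt ((n + 1).choose k) : ℝ) : ℂ)⁻¹ *
          ((Real.sqrt (n.choose k) : ℝ) : ℂ)⁻¹ * (S.atInfinity ^ k *
        (listIntegral (fun l => conj (A.wave l) * C.wave l) k *
          listIntegral (headIntegrand ψ B.wave D.wave) (n + 1 - k)))) := by
  rw [integral_massless (integrable_conj_wave_mul_tensorLeft _ _ _ n)]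
  have h1 : ∀ᵐ p ∂(Measure.pi fun _ : Fin (n + 1) => masslessMeasure),
      (rightEmbed ψ) (p 0) = if 0 < p 0 then ψ (Real.log (p 0)) else 0 :=
    (Measure.quasiMeasurePreserving_eval (fun _ : Fin (n + 1) => masslessMeasure) 0).ae
      (memLp_rightEmbed ψ).coeFn_toLp
  have h2 : ∀ᵐ p ∂(Measure.pi fun _ : Fin (n + 1) => masslessMeasure),
      (pairVec C D).wave (List.ofFn fun i : Fin n => p i.succ) =
        pairWave S C.wave D.wave (List.ofFn fun i : Fin n => p i.succ) :=
    (Measure.quasiMeasurePreserving_snd.comp (measurePreserving_piFinSuccAbove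
      (fun _ : Fin (n + 1) => masslessMeasure) 0).quasiMeasurePreserving).ae
      (wave_pairVec C D n)
  have h3 := wave_pairVec A B (n + 1)
  obtain ⟨F, hF⟩ : ∃ F : ℕ → ℂ, ∀ k, F k = ((Real.sqrt ((n + 1).choose k) : ℝ) : ℂ)⁻¹ *
          ((Real.sqrt (n.choose k) : ℝ) : ℂ)⁻¹ * (S.atInfinity ^ k *
        (listIntegral (fun l => conj (A.wave l) * C.wave l) k *
          listIntegral (headIntegrand ψ B.wave D.wave) (n + 1 - k))) := ⟨_, fun _ => rfl⟩
  have key : ∀ T : Finset (Fin (n + 1)),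
      ∫ x, conj ((pairVec A B).wave (List.ofFn (signExp T x))) * (rightEmbed ψ (signExp T x 0) *
        (pairVec C D).wave (List.ofFn fun i : Fin n => signExp T x i.succ))
        ∂(Measure.pi fun _ : Fin (n + 1) => (volume : Measure ℝ)) =
      if 0 ∈ T then 0 else F T.card := by
    intro T
    rw [hF]
    split_ifs with h0
    · refine integral_eq_zero_of_ae ?_
      filter_upwards [ae_massless_iff.1 h1 T] with x e1
      have hp : ¬ 0 < signExp T x 0 := by simp [signExp, h0, (Real.exp_pos _).le]
      rw [e1, if_neg hp]
      simp
    -- A positive first momentum becomes the first right moving rapidity and precedes all negative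
    -- entries, which adds ε to the power `T.card` to the phase.
    · rw [← integral_split_mul, ← integral_const_mul, ← integral_const_mul]
      refine integral_congr_ae ?_
      filter_upwards [ae_massless_iff.1 h1 T, ae_massless_iff.1 h2 T, ae_massless_iff.1 h3 T]
        with x e1 e2 e3
      have hp : 0 < signExp T x 0 := by simp [signExp, h0, Real.exp_pos]
      have hN := negPart_signExp T x
      have hP := posPart_signExp T x
      rw [e1, e2, e3, if_pos hp]
      have hl : List.ofFn (signExp T x) = signExp T x 0 ::
        List.ofFn fun i : Fin n => signExp T x i.succ := List.ofFn_succ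
      have hlen : (negPart (List.ofFn fun i : Fin n => signExp T x i.succ)).length =
          T.card := by
        have := congrArg List.length hN
        rwa [hl, negPart_cons_nonneg hp.le, List.length_map, length_negIdx] at this
      unfold pairWave
      rw [hN, hP, List.length_map, length_negIdx, hlen, List.length_ofFn, List.length_ofFn]
      rw [hl] at hN hP ⊢
      rw [negPart_cons_nonneg hp.le] at hN
      rw [posPart_cons_pos hp] at hP
      rw [phase_cons_pos _ hp, hlen, ← hN, ← hP]
      unfold headIntegrand
      rw [List.headD_cons, List.tail_cons]
      simp only [map_mul, map_inv₀, Complex.conj_ofReal, conj_phase S.conj_atInfinity, map_pow,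
        S.conj_atInfinity]
      have hph := phase_sq S.atInfinity_sq (List.ofFn fun i : Fin n => signExp T x i.succ)
      generalize (List.ofFn fun i : Fin n => signExp T x i.succ) = l at hph ⊢
      linear_combination (((Real.sqrt ((n + 1).choose T.card) : ℝ) : ℂ)⁻¹ *
        ((Real.sqrt (n.choose T.card) : ℝ) : ℂ)⁻¹ * S.atInfinity ^ T.card *
        conj (A.wave (negPart l)) * conj (B.wave (Real.log (signExp T x 0) :: posPart l)) *
        ψ (Real.log (signExp T x 0)) * C.wave (negPart l) * D.wave (posPart l)) * hph
  refine (Finset.sum_congr rfl fun T _ => key T).trans ((sum_ite_zero_notMem n F).trans ?_)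
  exact Finset.sum_congr rfl fun k _ => by rw [hF]

/-- For particle numbers from the sum of the two bounds on, every splitting into left and right
movers meets a vanishing component. -/
theorem pairVec_mem_finite (C D : ChiralFinite S) :
    pairVec (C : ChiralFock S) (D : ChiralFock S) ∈ MasslessFinite S := by
  obtain ⟨M, hM⟩ := C.2
  obtain ⟨N, hN⟩ := D.2
  refine ⟨M + N, fun n hn => ?_⟩
  rw [← inner_self_eq_zero (𝕜 := ℂ), component_pairVec, inner_pairComponent]
  refine Finset.sum_eq_zero fun k _ => ?_
  rcases le_or_gt M k with h | h
  · rw [hM k h, inner_zero_left, zero_mul]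
  · rw [hN (n - k) (by omega), inner_zero_left, mul_zero]

theorem eq_of_inner_pairVec {Φ Ψ : MasslessFock S}
    (h : ∀ A ∈ ChiralFinite S, ∀ B ∈ ChiralFinite S,
      inner ℂ (pairVec A B) Φ = inner ℂ (pairVec A B) Ψ) : Φ = Ψ :=
  sub_eq_zero.1 (eq_zero_of_inner_pairVec fun A hA B hB => by
    rw [inner_sub_right, h A hA B hB, sub_self])

theorem zDagger_leftEmbed_pairVec (ψ : Lp ℂ 2 (volume : Measure ℝ)) (C D : ChiralFinite S) :
    (zDagger S (leftEmbed ψ) ⟨pairVec C D, pairVec_mem_finite C D⟩ : MasslessFock S) =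
      pairVec (yDaggerPrime S ψ C : ChiralFock S) (D : ChiralFock S) := by
  refine eq_of_inner_pairVec fun A _ B _ => ?_
  rw [Fock.inner_eq, Fock.inner_eq]
  refine tsum_congr fun n => ?_
  rw [component_pairVec, component_pairVec, inner_pairComponent]
  cases n with
  | zero =>
    have h1 : (yDaggerPrime S ψ C : ChiralFock S).component 0 = 0 := map_zero _
    have h2 : (zDagger S (leftEmbed ψ) ⟨pairVec C D, pairVec_mem_finite C D⟩ :
      MasslessFock S).component 0 = 0 := rfl
    simp [h1, h2]
  | succ n =>
    unfold zDagger
    -- On the chiral side the sum has one more term. It is the one without left movers, and it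
    -- vanishes because the created left mover cannot be absent.
    rw [component_creation_succ, ← component_pairVec, inner_createN, integral_pairVec_leftEmbed,
      Finset.sum_range_succ' _ (n + 1)]
    have h1 : (yDaggerPrime S ψ C : ChiralFock S).component 0 = 0 := map_zero _
    rw [h1, inner_zero_right, zero_mul, add_zero, Finset.mul_sum]
    refine Finset.sum_congr rfl fun k hk => ?_
    have hk : k ≤ n := by simpa [Nat.lt_succ_iff] using hk
    -- The square roots match by (n + 1) C(n,k) = C(n+1,k+1) (k + 1).
    rw [inner_yDaggerPrime, Nat.add_sub_add_right, ← Fock.listIntegral_wave B,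
      ← sqrt_mul_inv_sqrt (N := n + 1) (x := n.choose k) (y := (n + 1).choose (k + 1))
        (K := k + 1) (Nat.choose_pos hk) (Nat.choose_pos (by omega))
        (Nat.add_one_mul_choose_eq n k)]
    push_cast
    ring

theorem zDagger_rightEmbed_pairVec (ψ : Lp ℂ 2 (volume : Measure ℝ)) (C D : ChiralFinite S) :
    (zDagger S (rightEmbed ψ) ⟨pairVec C D, pairVec_mem_finite C D⟩ : MasslessFock S) =
      pairVec (chiralNumberPow S C : ChiralFock S) (yDagger S ψ D : ChiralFock S) := by
  refine eq_of_inner_pairVec fun A _ B _ => ?_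
  rw [Fock.inner_eq, Fock.inner_eq]
  refine tsum_congr fun n => ?_
  rw [component_pairVec, component_pairVec, inner_pairComponent]
  have h1 : (yDagger S ψ D : ChiralFock S).component 0 = 0 := rfl
  cases n with
  | zero =>
    have h2 : (zDagger S (rightEmbed ψ) ⟨pairVec C D, pairVec_mem_finite C D⟩ :
      MasslessFock S).component 0 = 0 := rfl
    simp [h1, h2]
  | succ n =>
    unfold zDagger
    -- The additional chiral term is now the last one, with n + 1 left movers and no place for the
    -- created right mover.
    rw [component_creation_succ, ← component_pairVec, inner_createN, integral_pairVec_rightEmbed,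
      Finset.sum_range_succ _ (n + 1), Nat.sub_self, h1, inner_zero_right, mul_zero, add_zero,
      Finset.mul_sum]
    refine Finset.sum_congr rfl fun k hk => ?_
    have hk : k ≤ n := by simpa [Nat.lt_succ_iff] using hk
    have h2 : inner ℂ (A.component k) ((chiralNumberPow S C : ChiralFock S).component k) =
      S.atInfinity ^ k * inner ℂ (A.component k) ((C : ChiralFock S).component k) :=
      inner_smul_right (𝕜 := ℂ) (E := nParticle volume (chiralFactor S) k) _ _ _
    -- The square roots match by (n + 1) C(n,k) = C(n+1,k) (n - k + 1).
    rw [h2, Nat.succ_sub hk, Nat.succ_eq_add_one, inner_yDagger,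
      ← Fock.listIntegral_wave A,
      ← sqrt_mul_inv_sqrt (N := n + 1) (x := n.choose k) (y := (n + 1).choose k)
        (K := n - k + 1) (Nat.choose_pos hk) (Nat.choose_pos (by omega))
        (by rw [mul_comm, Nat.choose_mul_succ_eq, Nat.succ_sub hk])]
    push_cast
    ring

end Zamolodchikov

namespace Zamolodchikov

/-! ### Creation, annihilation, reflection and parity on finite particle vectors -/

section FiniteParticle

variable {μ : Measure ℝ} [SigmaFinite μ] {s : ExchangeFactor}

/-- `X'` is a formal adjoint of `X` on the finite particle vectors. -/
def FormalAdjoint (X X' : finiteParticle μ s →ₗ[ℂ] finiteParticle μ s) : Prop :=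
  ∀ Φ Ψ : finiteParticle μ s,
    inner ℂ (X Φ : Fock μ s) (Ψ : Fock μ s) = inner ℂ (Φ : Fock μ s) (X' Ψ : Fock μ s)

theorem formalAdjoint_id : FormalAdjoint (μ := μ) (s := s) LinearMap.id LinearMap.id :=
  fun _ _ => rfl

theorem formalAdjoint_creation (ψ : Lp ℂ 2 μ) :
    FormalAdjoint (creation s (star ψ)) (annihilation s ψ) :=
  inner_creation_eq_inner_annihilation s ψ

theorem coe_reflectionFinite (Φ : finiteParticle μ s) :
    (reflectionFinite μ s Φ : Fock μ s) = reflection μ s Φ := rfl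

theorem reflectionFinite_reflectionFinite (Φ : finiteParticle μ s) :
    reflectionFinite μ s (reflectionFinite μ s Φ) = Φ :=
  Subtype.ext (reflection_reflection _)

theorem reflected_apply (X : finiteParticle μ s →ₗ[ℂ] finiteParticle μ s)
    (Φ : finiteParticle μ s) :
    reflected X Φ = reflectionFinite μ s (X (reflectionFinite μ s Φ)) := rfl

theorem reflected_reflected (X : finiteParticle μ s →ₗ[ℂ] finiteParticle μ s) :
    reflected (reflected X) = X := by
  ext1 Φ
  rw [reflected_apply, reflected_apply, reflectionFinite_reflectionFinite,
    reflectionFinite_reflectionFinite]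

theorem reflected_add (X Y : finiteParticle μ s →ₗ[ℂ] finiteParticle μ s) :
    reflected (X + Y) = reflected X + reflected Y := by
  ext1 Φ
  simp only [reflected_apply, LinearMap.add_apply, map_add]

theorem reflected_neg (X : finiteParticle μ s →ₗ[ℂ] finiteParticle μ s) :
    reflected (-X) = -reflected X := by
  ext1 Φ
  simp only [reflected_apply, LinearMap.neg_apply, map_neg]

theorem inner_reflection_left (Φ Ψ : Fock μ s) :
    inner ℂ (reflection μ s Φ) Ψ = conj (inner ℂ Φ (reflection μ s Ψ)) := by
  conv_lhs => rw [← reflection_reflection Ψ]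
  exact inner_antilinear _ _ _

theorem FormalAdjoint.reflected {X X' : finiteParticle μ s →ₗ[ℂ] finiteParticle μ s}
    (h : FormalAdjoint X X') : FormalAdjoint (reflected X) (reflected X') := by
  intro Φ Ψ
  rw [reflected_apply, reflected_apply, coe_reflectionFinite, coe_reflectionFinite,
    inner_reflection_left, ← coe_reflectionFinite Ψ, h, coe_reflectionFinite Φ,
    inner_reflection_left, Complex.conj_conj]

theorem creation_add (φ ψ : Lp ℂ 2 μ) :
    creation s (φ + ψ) = creation s φ + creation s ψ := by
  have hT : ∀ (n : ℕ) (Φ : L2Power μ n),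
      tensorLeft (φ + ψ) n Φ = tensorLeft φ n Φ + tensorLeft ψ n Φ := by
    intro n Φ
    apply Lp.ext
    filter_upwards [coeFn_tensorLeft (φ + ψ) n Φ, coeFn_tensorLeft φ n Φ, coeFn_tensorLeft ψ n Φ,
      Lp.coeFn_add (tensorLeft φ n Φ) (tensorLeft ψ n Φ),
      (Measure.quasiMeasurePreserving_eval (fun _ : Fin (n + 1) => μ) 0).ae
        (Lp.coeFn_add φ ψ)] with p h1 h2 h3 h4 h5
    rw [h1, h4, Pi.add_apply, h2, h3, h5, Pi.add_apply, add_mul]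
  ext1 Φ
  apply Subtype.ext
  apply Fock.ext
  intro n
  cases n with
  | zero => exact (add_zero (0 : nParticle μ s 0)).symm
  | succ n =>
    change createN s (φ + ψ) n _ = createN s φ n _ + createN s ψ n _
    simp only [createN, smul_apply, ContinuousLinearMap.comp_apply, hT,
      map_add, smul_add]

theorem creation_smul (c : ℂ) (ψ : Lp ℂ 2 μ) : creation s (c • ψ) = c • creation s ψ := by
  have hT : ∀ (n : ℕ) (Φ : L2Power μ n), tensorLeft (c • ψ) n Φ = c • tensorLeft ψ n Φ := by
    intro n Φ
    apply Lp.ext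
    filter_upwards [coeFn_tensorLeft (c • ψ) n Φ, coeFn_tensorLeft ψ n Φ,
      Lp.coeFn_smul c (tensorLeft ψ n Φ),
      (Measure.quasiMeasurePreserving_eval (fun _ : Fin (n + 1) => μ) 0).ae
        (Lp.coeFn_smul c ψ)] with p h1 h2 h3 h4
    rw [h1, h3, Pi.smul_apply, h2, h4, Pi.smul_apply, smul_eq_mul, smul_eq_mul, mul_assoc]
  ext1 Φ
  apply Subtype.ext
  apply Fock.ext
  intro n
  cases n with
  | zero => exact (smul_zero (A := nParticle μ s 0) c).symm
  | succ n =>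
    change createN s (c • ψ) n _ = c • createN s ψ n _
    simp only [createN, smul_apply, ContinuousLinearMap.comp_apply, hT,
      map_smul]
    exact smul_comm _ _ _

/-- The difference of the two images is itself a finite particle vector and may be used as test
vector. This transfers linearity from creation to annihilation operators. -/
theorem FormalAdjoint.unique {X X' X'' : finiteParticle μ s →ₗ[ℂ] finiteParticle μ s}
    (h : FormalAdjoint X X') (h' : FormalAdjoint X X'') : X' = X'' := by
  ext1 Ψ
  apply Subtype.ext
  refine sub_eq_zero.1 (inner_self_eq_zero (𝕜 := ℂ).1 ?_)
  have := (h (X' Ψ - X'' Ψ) Ψ).symm.trans (h' (X' Ψ - X'' Ψ) Ψ)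
  rw [Submodule.coe_sub] at this
  rw [inner_sub_right, this, sub_self]

theorem star_add_lp {α : Type*} [MeasurableSpace α] {ν : Measure α} (φ ψ : Lp ℂ 2 ν) :
    star (φ + ψ) = star φ + star ψ := by
  apply Lp.ext
  filter_upwards [Lp.coeFn_star (φ + ψ), Lp.coeFn_star φ, Lp.coeFn_star ψ, Lp.coeFn_add φ ψ,
    Lp.coeFn_add (star φ) (star ψ)] with x h1 h2 h3 h4 h5
  rw [h1, h5, Pi.star_apply, h4, Pi.add_apply, Pi.add_apply, h2, h3]
  simp

theorem star_smul_lp {α : Type*} [MeasurableSpace α] {ν : Measure α} (c : ℂ) (ψ : Lp ℂ 2 ν) :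
    star (c • ψ) = conj c • star ψ := by
  apply Lp.ext
  filter_upwards [Lp.coeFn_star (c • ψ), Lp.coeFn_star ψ, Lp.coeFn_smul c ψ,
    Lp.coeFn_smul (conj c) (star ψ)] with x h1 h2 h3 h4
  rw [h1, h4, Pi.star_apply, h3, Pi.smul_apply, Pi.smul_apply, h2]
  simp

theorem annihilation_add (φ ψ : Lp ℂ 2 μ) :
    annihilation s (φ + ψ) = annihilation s φ + annihilation s ψ := by
  refine (formalAdjoint_creation (φ + ψ)).unique fun Φ Ψ => ?_
  rw [star_add_lp, creation_add, LinearMap.add_apply, LinearMap.add_apply, Submodule.coe_add,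
    Submodule.coe_add, inner_add_left, inner_add_right, formalAdjoint_creation φ,
    formalAdjoint_creation ψ]

theorem annihilation_smul (c : ℂ) (ψ : Lp ℂ 2 μ) :
    annihilation s (c • ψ) = c • annihilation s ψ := by
  refine (formalAdjoint_creation (c • ψ)).unique fun Φ Ψ => ?_
  rw [star_smul_lp, creation_smul, LinearMap.smul_apply, LinearMap.smul_apply, Submodule.coe_smul,
    Submodule.coe_smul, inner_smul_left, inner_smul_right, formalAdjoint_creation ψ,
    Complex.conj_conj]

theorem creation_neg (ψ : Lp ℂ 2 μ) : creation s (-ψ) = -creation s ψ := by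
  rw [← neg_one_smul ℂ ψ, creation_smul]
  ext1 Φ
  rw [LinearMap.smul_apply, LinearMap.neg_apply]
  exact neg_one_smul ℂ (creation s ψ Φ)

theorem annihilation_neg (ψ : Lp ℂ 2 μ) : annihilation s (-ψ) = -annihilation s ψ := by
  rw [← neg_one_smul ℂ ψ, annihilation_smul]
  ext1 Φ
  rw [LinearMap.smul_apply, LinearMap.neg_apply]
  exact neg_one_smul ℂ (annihilation s ψ Φ)

variable {ε : ℂ} (hε : ‖ε‖ = 1)

theorem component_numberPowFinite (Φ : finiteParticle μ s) (n : ℕ) :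
    (numberPowFinite μ s ε hε Φ : Fock μ s).component n =
      ε ^ n • (Φ : Fock μ s).component n := rfl

theorem numberPowFinite_numberPowFinite (hε2 : ε ^ 2 = 1) (Φ : finiteParticle μ s) :
    numberPowFinite μ s ε hε (numberPowFinite μ s ε hε Φ) = Φ := by
  apply Subtype.ext
  apply Fock.ext
  intro n
  rw [component_numberPowFinite, component_numberPowFinite, smul_smul, ← mul_pow, ← pow_two, hε2,
    one_pow, one_smul]

theorem numberPowFinite_one (h1 : ε = 1) : numberPowFinite μ s ε hε = LinearMap.id := by
  ext1 Φ
  apply Subtype.ext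
  apply Fock.ext
  intro n
  rw [component_numberPowFinite, h1, one_pow, one_smul]
  rfl

theorem formalAdjoint_numberPowFinite (hc : conj ε = ε) :
    FormalAdjoint (numberPowFinite μ s ε hε) (numberPowFinite μ s ε hε) := by
  intro Φ Ψ
  rw [Fock.inner_eq, Fock.inner_eq]
  refine tsum_congr fun n => ?_
  rw [component_numberPowFinite, component_numberPowFinite]
  refine (inner_smul_left (𝕜 := ℂ) (E := nParticle μ s n) _ _ _).trans
    (Eq.trans ?_ (inner_smul_right (𝕜 := ℂ) (E := nParticle μ s n) _ _ _).symm)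
  rw [map_pow, hc]

theorem numberPowFinite_reflectionFinite (hc : conj ε = ε) (Φ : finiteParticle μ s) :
    numberPowFinite μ s ε hε (reflectionFinite μ s Φ) =
      reflectionFinite μ s (numberPowFinite μ s ε hε Φ) := by
  apply Subtype.ext
  apply Fock.ext
  intro n
  have h := (restrictNParticle (s := s) (reflectionL2 μ n)
    (reflectionL2_mem μ s n)).map_smulₛₗ (ε ^ n) ((Φ : Fock μ s).component n)
  rw [map_pow, hc] at h
  exact h.symm

/-- `X` changes the particle number by odd amounts, in the sense that `ε^N X = ε X ε^N`. -/
def IsOddFor (X : finiteParticle μ s →ₗ[ℂ] finiteParticle μ s) : Prop :=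
  ∀ Φ, numberPowFinite μ s ε hε (X Φ) = ε • X (numberPowFinite μ s ε hε Φ)

theorem isOddFor_creation (ψ : Lp ℂ 2 μ) : IsOddFor hε (creation s ψ) := by
  intro Φ
  apply Subtype.ext
  apply Fock.ext
  intro n
  cases n with
  | zero =>
    change ε ^ 0 • (0 : nParticle μ s 0) = ε • (0 : nParticle μ s 0)
    rw [smul_zero, smul_zero]
  | succ n =>
    change ε ^ (n + 1) • createN s ψ n ((Φ : Fock μ s).component n) =
      ε • createN s ψ n (ε ^ n • (Φ : Fock μ s).component n)
    rw [map_smul, smul_smul, pow_succ']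

theorem isOddFor_annihilation (hε2 : ε ^ 2 = 1) (ψ : Lp ℂ 2 μ) :
    IsOddFor hε (annihilation s ψ) := by
  intro Φ
  apply Subtype.ext
  apply Fock.ext
  intro n
  change ε ^ n • annihilateN s ψ n ((Φ : Fock μ s).component (n + 1)) =
    ε • annihilateN s ψ n (ε ^ (n + 1) • (Φ : Fock μ s).component (n + 1))
  rw [map_smul, smul_smul]
  congr 1
  linear_combination -ε ^ n * hε2

variable {hε}

theorem IsOddFor.add {X Y : finiteParticle μ s →ₗ[ℂ] finiteParticle μ s} (hX : IsOddFor hε X)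
    (hY : IsOddFor hε Y) : IsOddFor hε (X + Y) := fun Φ => by
  rw [LinearMap.add_apply, LinearMap.add_apply, map_add, hX, hY, smul_add]

theorem IsOddFor.reflected {X : finiteParticle μ s →ₗ[ℂ] finiteParticle μ s} (hc : conj ε = ε)
    (hX : IsOddFor hε X) : IsOddFor hε (reflected X) := fun Φ => by
  rw [reflected_apply, reflected_apply, numberPowFinite_reflectionFinite hε hc, hX,
    map_smulₛₗ, hc, numberPowFinite_reflectionFinite hε hc]

end FiniteParticle

/-! ### Operators on the algebraic tensor product of the finite particle spaces -/

open scoped TensorProduct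

section Twist

variable {μ : Measure ℝ} [SigmaFinite μ] {s : ExchangeFactor} {ε : ℂ} (hε : ‖ε‖ = 1)

/-- `ε^{N ⊗ N}` on the algebraic tensor product of the finite particle vectors. -/
noncomputable def finiteTwist :
    (finiteParticle μ s ⊗[ℂ] finiteParticle μ s) →ₗ[ℂ]
      (finiteParticle μ s ⊗[ℂ] finiteParticle μ s) :=
  (1 / 2 : ℂ) • (LinearMap.id + TensorProduct.map (numberPowFinite μ s ε hε) LinearMap.id +
    TensorProduct.map LinearMap.id (numberPowFinite μ s ε hε) -
    TensorProduct.map (numberPowFinite μ s ε hε) (numberPowFinite μ s ε hε))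

theorem finiteTwist_tmul (C D : finiteParticle μ s) :
    finiteTwist hε (C ⊗ₜ[ℂ] D) = (1 / 2 : ℂ) • (C ⊗ₜ[ℂ] D +
      numberPowFinite μ s ε hε C ⊗ₜ[ℂ] D + C ⊗ₜ[ℂ] numberPowFinite μ s ε hε D -
      numberPowFinite μ s ε hε C ⊗ₜ[ℂ] numberPowFinite μ s ε hε D) := by
  simp [finiteTwist]

theorem finiteTwist_finiteTwist (hε2 : ε ^ 2 = 1)
    (t : finiteParticle μ s ⊗[ℂ] finiteParticle μ s) :
    finiteTwist hε (finiteTwist hε t) = t := by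
  induction t using TensorProduct.induction_on with
  | zero => rw [map_zero, map_zero]
  | add a b ha hb => rw [map_add, map_add, ha, hb]
  | tmul C D =>
    simp only [finiteTwist_tmul, map_smul, map_add, map_sub,
      numberPowFinite_numberPowFinite hε hε2]
    module

theorem finiteTwist_one (h1 : ε = 1) (t : finiteParticle μ s ⊗[ℂ] finiteParticle μ s) :
    finiteTwist hε t = t := by
  rw [finiteTwist, numberPowFinite_one hε h1, TensorProduct.map_id]
  simp only [LinearMap.smul_apply, LinearMap.sub_apply, LinearMap.add_apply, LinearMap.id_apply]
  module

/-- If `X` changes the left particle number n by an odd amount, then ε^(nm) changes by ε^m. This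
factor is ε^N on the right side of the tensor product. -/
theorem map_left_finiteTwist (hε2 : ε ^ 2 = 1)
    {X : finiteParticle μ s →ₗ[ℂ] finiteParticle μ s} (hX : IsOddFor hε X)
    (t : finiteParticle μ s ⊗[ℂ] finiteParticle μ s) :
    TensorProduct.map X LinearMap.id (finiteTwist hε t) =
      finiteTwist hε (TensorProduct.map X (numberPowFinite μ s ε hε) t) := by
  -- For ε = 1 the twist is trivial; for ε = -1 oddness says that `X` anticommutes with ε^N.
  rcases sq_eq_sq_iff_eq_or_eq_neg.1 (hε2.trans (one_pow 2).symm) with h1 | h1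
  · rw [finiteTwist_one hε h1, finiteTwist_one hε h1, numberPowFinite_one hε h1]
  · induction t using TensorProduct.induction_on with
    | zero => simp only [map_zero]
    | add a b ha hb => simp only [map_add, ha, hb]
    | tmul C D =>
      have e : numberPowFinite μ s ε hε (X C) = -X (numberPowFinite μ s ε hε C) := by
        rw [hX C]
        nth_rewrite 1 [h1]
        exact neg_one_smul ℂ _
      simp only [finiteTwist_tmul, map_smul, map_add, map_sub, TensorProduct.map_tmul,
        LinearMap.id_apply, numberPowFinite_numberPowFinite hε hε2, e, TensorProduct.neg_tmul]
      module

theorem map_right_finiteTwist (hε2 : ε ^ 2 = 1)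
    {Y : finiteParticle μ s →ₗ[ℂ] finiteParticle μ s} (hY : IsOddFor hε Y)
    (t : finiteParticle μ s ⊗[ℂ] finiteParticle μ s) :
    TensorProduct.map (numberPowFinite μ s ε hε) Y (finiteTwist hε t) =
      finiteTwist hε (TensorProduct.map LinearMap.id Y t) := by
  rcases sq_eq_sq_iff_eq_or_eq_neg.1 (hε2.trans (one_pow 2).symm) with h1 | h1
  · rw [finiteTwist_one hε h1, finiteTwist_one hε h1, numberPowFinite_one hε h1]
  · induction t using TensorProduct.induction_on with
    | zero => simp only [map_zero]
    | add a b ha hb => simp only [map_add, ha, hb]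
    | tmul C D =>
      have e : numberPowFinite μ s ε hε (Y D) = -Y (numberPowFinite μ s ε hε D) := by
        rw [hY D]
        nth_rewrite 1 [h1]
        exact neg_one_smul ℂ _
      simp only [finiteTwist_tmul, map_smul, map_add, map_sub, TensorProduct.map_tmul,
        LinearMap.id_apply, numberPowFinite_numberPowFinite hε hε2, e, TensorProduct.tmul_neg]
      module

variable (μ s) in
/-- `U(j) ⊗ U(j)` on the algebraic tensor product of the finite particle vectors. -/
noncomputable def finiteReflection :
    (finiteParticle μ s ⊗[ℂ] finiteParticle μ s) →ₛₗ[starRingEnd ℂ]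
      (finiteParticle μ s ⊗[ℂ] finiteParticle μ s) :=
  TensorProduct.map (reflectionFinite μ s) (reflectionFinite μ s)

theorem finiteReflection_tmul (C D : finiteParticle μ s) :
    finiteReflection μ s (C ⊗ₜ[ℂ] D) =
      reflectionFinite μ s C ⊗ₜ[ℂ] reflectionFinite μ s D := rfl

theorem finiteReflection_finiteTwist (hc : conj ε = ε)
    (t : finiteParticle μ s ⊗[ℂ] finiteParticle μ s) :
    finiteReflection μ s (finiteTwist hε t) = finiteTwist hε (finiteReflection μ s t) := by
  induction t using TensorProduct.induction_on with
  | zero => simp only [map_zero]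
  | add a b ha hb => simp only [map_add, ha, hb]
  | tmul C D =>
    have h2 : conj (1 / 2 : ℂ) = 1 / 2 := by
      rw [map_div₀, map_one, map_ofNat]
    simp only [finiteTwist_tmul, map_smulₛₗ, map_add, map_sub, finiteReflection_tmul,
      numberPowFinite_reflectionFinite hε hc, h2]

theorem finiteReflection_map (X Y : finiteParticle μ s →ₗ[ℂ] finiteParticle μ s)
    (t : finiteParticle μ s ⊗[ℂ] finiteParticle μ s) :
    finiteReflection μ s (TensorProduct.map X Y (finiteReflection μ s t)) =
      TensorProduct.map (reflected X) (reflected Y) t := by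
  induction t using TensorProduct.induction_on with
  | zero => simp only [map_zero]
  | add a b ha hb => simp only [map_add, ha, hb]
  | tmul C D => rfl

theorem reflected_id :
    reflected (LinearMap.id : finiteParticle μ s →ₗ[ℂ] finiteParticle μ s) = LinearMap.id := by
  ext1 Φ
  exact reflectionFinite_reflectionFinite Φ

theorem reflected_numberPowFinite (hc : conj ε = ε) :
    reflected (numberPowFinite μ s ε hε) = numberPowFinite μ s ε hε := by
  ext1 Φ
  rw [reflected_apply, numberPowFinite_reflectionFinite hε hc, reflectionFinite_reflectionFinite]

/-- Conjugation of `X ⊗ 1` with `ε^{N ⊗ N} (U(j) ⊗ U(j))`. -/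
theorem twisted_reflection_map_left (hε2 : ε ^ 2 = 1) (hc : conj ε = ε)
    {X : finiteParticle μ s →ₗ[ℂ] finiteParticle μ s} (hX : IsOddFor hε X)
    (t : finiteParticle μ s ⊗[ℂ] finiteParticle μ s) :
    finiteTwist hε (finiteReflection μ s (TensorProduct.map X LinearMap.id
      (finiteTwist hε (finiteReflection μ s t)))) =
      TensorProduct.map (reflected X) (numberPowFinite μ s ε hε) t := by
  rw [map_left_finiteTwist hε hε2 hX, finiteReflection_finiteTwist hε hc,
    finiteTwist_finiteTwist hε hε2, finiteReflection_map, reflected_numberPowFinite hε hc]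

/-- Conjugation of `ε^N ⊗ Y` with `ε^{N ⊗ N} (U(j) ⊗ U(j))`. -/
theorem twisted_reflection_map_right (hε2 : ε ^ 2 = 1) (hc : conj ε = ε)
    {Y : finiteParticle μ s →ₗ[ℂ] finiteParticle μ s} (hY : IsOddFor hε Y)
    (t : finiteParticle μ s ⊗[ℂ] finiteParticle μ s) :
    finiteTwist hε (finiteReflection μ s (TensorProduct.map (numberPowFinite μ s ε hε) Y
      (finiteTwist hε (finiteReflection μ s t)))) =
      TensorProduct.map LinearMap.id (reflected Y) t := by
  rw [map_right_finiteTwist hε hε2 hY, finiteReflection_finiteTwist hε hc,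
    finiteTwist_finiteTwist hε hε2, finiteReflection_map, reflected_id]

end Twist

/-! ### Conjugation with the unitary on finite particle vectors -/

section Conjugation

variable {S : ScatteringFunctionWithLimit}

theorem pairUnitary_tensorIncl_tmul (C D : ChiralFinite S) :
    pairUnitary S (tensorIncl (ChiralFinite S) (ChiralFinite S) (C ⊗ₜ[ℂ] D)) =
      pairVec (C : ChiralFock S) (D : ChiralFock S) :=
  pairUnitary_coe_tmul _ _

theorem pairUnitary_tensorIncl_mem (t : ChiralFinite S ⊗[ℂ] ChiralFinite S) :
    pairUnitary S (tensorIncl (ChiralFinite S) (ChiralFinite S) t) ∈ MasslessFinite S := by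
  induction t using TensorProduct.induction_on with
  | zero => rw [map_zero, map_zero]; exact Submodule.zero_mem _
  | add a b ha hb => rw [map_add, map_add]; exact Submodule.add_mem _ ha hb
  | tmul C D => rw [pairUnitary_tensorIncl_tmul]; exact pairVec_mem_finite C D

variable (S) in
/-- The unitary as a map between finite particle vectors. -/
noncomputable def finiteUnitary :
    (ChiralFinite S ⊗[ℂ] ChiralFinite S) →ₗ[ℂ] MasslessFinite S :=
  ((pairUnitary S).toLinearEquiv.toLinearMap ∘ₗ
    tensorIncl (ChiralFinite S) (ChiralFinite S)).codRestrict _ pairUnitary_tensorIncl_mem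

theorem finiteUnitary_tmul (C D : ChiralFinite S) :
    finiteUnitary S (C ⊗ₜ[ℂ] D) = ⟨pairVec C D, pairVec_mem_finite C D⟩ :=
  Subtype.ext (pairUnitary_tensorIncl_tmul C D)

/-- `A` is conjugated into `B` by the unitary, on finite particle vectors. -/
def Intertwined (A : MasslessFinite S →ₗ[ℂ] MasslessFinite S)
    (B : (ChiralFinite S ⊗[ℂ] ChiralFinite S) →ₗ[ℂ] (ChiralFinite S ⊗[ℂ] ChiralFinite S)) :
    Prop :=
  ∀ t, A (finiteUnitary S t) = finiteUnitary S (B t)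

variable {A A₁ A₂ : MasslessFinite S →ₗ[ℂ] MasslessFinite S}
  {B B₁ B₂ : (ChiralFinite S ⊗[ℂ] ChiralFinite S) →ₗ[ℂ] (ChiralFinite S ⊗[ℂ] ChiralFinite S)}

theorem Intertwined.conjugateOnFinite (h : Intertwined A B) :
    ConjugateOnFinite S (pairUnitary S) A B := by
  intro t
  refine ⟨pairUnitary_tensorIncl_mem t, ?_⟩
  rw [LinearIsometryEquiv.symm_apply_eq]
  exact congrArg Subtype.val (h t)

theorem intertwined_of_tmul
    (h : ∀ C D, A (finiteUnitary S (C ⊗ₜ[ℂ] D)) = finiteUnitary S (B (C ⊗ₜ[ℂ] D))) :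
    Intertwined A B := by
  intro t
  induction t using TensorProduct.induction_on with
  | zero => simp only [map_zero]
  | add a b ha hb => simp only [map_add, ha, hb]
  | tmul C D => exact h C D

theorem Intertwined.add (h₁ : Intertwined A₁ B₁) (h₂ : Intertwined A₂ B₂) :
    Intertwined (A₁ + A₂) (B₁ + B₂) := fun t => by
  rw [LinearMap.add_apply, LinearMap.add_apply, map_add, h₁, h₂]

theorem Intertwined.smul (c : ℂ) (h : Intertwined A B) : Intertwined (c • A) (c • B) :=
  fun t => by rw [LinearMap.smul_apply, LinearMap.smul_apply, map_smul, h]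

/-- The unitary preserves inner products and pair vectors of finite particle number are total, so
the relation passes to adjoints. Matrix elements of annihilation operators need not be computed. -/
theorem Intertwined.adjoint {X X' Y Y' : ChiralFinite S →ₗ[ℂ] ChiralFinite S}
    {A' : MasslessFinite S →ₗ[ℂ] MasslessFinite S}
    (h : Intertwined A (TensorProduct.map X Y)) (hA : FormalAdjoint A A')
    (hX : FormalAdjoint X X') (hY : FormalAdjoint Y Y') :
    Intertwined A' (TensorProduct.map X' Y') := by
  refine intertwined_of_tmul fun C D => Subtype.ext (eq_of_inner_pairVec fun a ha b hb => ?_)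
  have h1 := h ((⟨a, ha⟩ : ChiralFinite S) ⊗ₜ[ℂ] (⟨b, hb⟩ : ChiralFinite S))
  have h2 := hA (finiteUnitary S ((⟨a, ha⟩ : ChiralFinite S) ⊗ₜ[ℂ] (⟨b, hb⟩ : ChiralFinite S)))
    (finiteUnitary S (C ⊗ₜ[ℂ] D))
  rw [h1] at h2
  simp only [finiteUnitary_tmul, TensorProduct.map_tmul] at h2 ⊢
  rw [← h2, inner_pairVec, inner_pairVec, hX, hY]

theorem intertwined_zDagger_leftEmbed (ψ : Lp ℂ 2 (volume : Measure ℝ)) :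
    Intertwined (zDagger S (leftEmbed ψ)) (TensorProduct.map (yDaggerPrime S ψ) LinearMap.id) :=
  intertwined_of_tmul fun C D => Subtype.ext (by
    rw [finiteUnitary_tmul, zDagger_leftEmbed_pairVec, TensorProduct.map_tmul, finiteUnitary_tmul,
      LinearMap.id_apply])

theorem intertwined_zDagger_rightEmbed (ψ : Lp ℂ 2 (volume : Measure ℝ)) :
    Intertwined (zDagger S (rightEmbed ψ))
      (TensorProduct.map (chiralNumberPow S) (yDagger S ψ)) :=
  intertwined_of_tmul fun C D => Subtype.ext (by
    rw [finiteUnitary_tmul, zDagger_rightEmbed_pairVec, TensorProduct.map_tmul,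
      finiteUnitary_tmul])

theorem star_leftEmbed (ψ : Lp ℂ 2 (volume : Measure ℝ)) :
    star (leftEmbed ψ) = leftEmbed (star ψ) := by
  apply Lp.ext
  -- Null sets of rapidities can be pulled back only on the half-line p < 0, where log(-p) carries
  -- dp/|p| to dβ.
  have h : ∀ᵐ p ∂masslessMeasure, p < 0 →
      (star ψ : Lp ℂ 2 (volume : Measure ℝ)) (Real.log (-p)) = star (ψ (Real.log (-p))) :=
    (ae_restrict_iff' measurableSet_Iio).1
      (measurePreserving_log_neg.quasiMeasurePreserving.ae (Lp.coeFn_star ψ))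
  filter_upwards [Lp.coeFn_star (leftEmbed ψ), (memLp_leftEmbed ψ).coeFn_toLp,
    (memLp_leftEmbed (star ψ)).coeFn_toLp, h] with p h1 h2 h3 h4
  refine h1.trans (Eq.trans ?_ h3.symm)
  refine (congrArg star h2).trans ?_
  split_ifs with hp
  · exact (h4 hp).symm
  · exact star_zero ℂ

theorem star_rightEmbed (ψ : Lp ℂ 2 (volume : Measure ℝ)) :
    star (rightEmbed ψ) = rightEmbed (star ψ) := by
  apply Lp.ext
  have h : ∀ᵐ p ∂masslessMeasure, 0 < p →
      (star ψ : Lp ℂ 2 (volume : Measure ℝ)) (Real.log p) = star (ψ (Real.log p)) :=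
    (ae_restrict_iff' measurableSet_Ioi).1
      (measurePreserving_log.quasiMeasurePreserving.ae (Lp.coeFn_star ψ))
  filter_upwards [Lp.coeFn_star (rightEmbed ψ), (memLp_rightEmbed ψ).coeFn_toLp,
    (memLp_rightEmbed (star ψ)).coeFn_toLp, h] with p h1 h2 h3 h4
  refine h1.trans (Eq.trans ?_ h3.symm)
  refine (congrArg star h2).trans ?_
  split_ifs with hp
  · exact (h4 hp).symm
  · exact star_zero ℂ

/-- Adjoint of the left creation relation for the conjugate of ψ. The reflected creation operator
contains a second conjugation, and another one sits in the definition of annihilation; hence the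
`star ψ`. -/
theorem intertwined_zOp_leftEmbed (ψ : Lp ℂ 2 (volume : Measure ℝ)) :
    Intertwined (zOp S (leftEmbed ψ))
      (TensorProduct.map (reflected (yOp S (star ψ))) LinearMap.id) := by
  refine (intertwined_zDagger_leftEmbed (star ψ)).adjoint ?_
    (formalAdjoint_creation (star ψ)).reflected formalAdjoint_id
  rw [← star_leftEmbed]
  exact formalAdjoint_creation _

theorem intertwined_zOp_rightEmbed (ψ : Lp ℂ 2 (volume : Measure ℝ)) :
    Intertwined (zOp S (rightEmbed ψ)) (TensorProduct.map (chiralNumberPow S) (yOp S ψ)) := by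
  refine (intertwined_zDagger_rightEmbed (star ψ)).adjoint ?_
    (formalAdjoint_numberPowFinite _ S.conj_atInfinity) (formalAdjoint_creation ψ)
  rw [← star_rightEmbed]
  exact formalAdjoint_creation _

theorem reflectionFinite_finiteUnitary (t : ChiralFinite S ⊗[ℂ] ChiralFinite S) :
    reflectionFinite masslessMeasure (masslessFactor S) (finiteUnitary S t) =
      finiteUnitary S (finiteTwist S.norm_atInfinity
        (finiteReflection volume (chiralFactor S) t)) := by
  induction t using TensorProduct.induction_on with
  | zero => simp only [map_zero]
  | add a b ha hb => simp only [map_add, ha, hb]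
  | tmul C D =>
    rw [finiteReflection_tmul, finiteTwist_tmul]
    apply Subtype.ext
    rw [finiteUnitary_tmul, coe_reflectionFinite]
    refine (masslessUj_pairVec _ _).trans ?_
    rw [pairUnitary_doubleNumberPow_tmul]
    simp only [map_smul, map_add, map_sub, finiteUnitary_tmul]
    rfl

/-- The twisted reflection implements the reflection of the massless model. -/
theorem Intertwined.reflected (h : Intertwined A B)
    {B' : (ChiralFinite S ⊗[ℂ] ChiralFinite S) →ₗ[ℂ] (ChiralFinite S ⊗[ℂ] ChiralFinite S)}
    (hB : ∀ t, finiteTwist S.norm_atInfinity (finiteReflection volume (chiralFactor S) (B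
      (finiteTwist S.norm_atInfinity (finiteReflection volume (chiralFactor S) t)))) = B' t) :
    Intertwined (reflected A) B' := by
  intro t
  rw [reflected_apply, reflectionFinite_finiteUnitary, h, reflectionFinite_finiteUnitary, hB]

end Conjugation

end Zamolodchikov

namespace Zamolodchikov

/-! ### Test functions -/

section SliceIntegral

open scoped LineDeriv

/-- The seminorms of orders k and k + 2 together give decay in ξ with a majorant integrable in η. It
serves for dominated differentiation and for the Schwartz bounds. -/
theorem exists_decay_slice (G : 𝓢(ℝ × ℝ, ℂ)) (k : ℕ) :
    ∃ C : ℝ, ∀ ξ η : ℝ, |ξ| ^ k * ‖G (ξ, η)‖ ≤ C * (1 + η ^ 2)⁻¹ := by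
  obtain ⟨C₀, h₀⟩ := G.decay k 0
  obtain ⟨C₂, h₂⟩ := G.decay (k + 2) 0
  simp only [norm_iteratedFDeriv_zero] at h₀ h₂
  refine ⟨C₀ + C₂, fun ξ η => ?_⟩
  rw [← div_eq_mul_inv, le_div_iff₀ (by positivity)]
  have h1 : |ξ| ≤ ‖((ξ, η) : ℝ × ℝ)‖ := norm_fst_le ((ξ, η) : ℝ × ℝ)
  have h2 : |η| ≤ ‖((ξ, η) : ℝ × ℝ)‖ := norm_snd_le ((ξ, η) : ℝ × ℝ)
  have h3 : |ξ| ^ k ≤ ‖((ξ, η) : ℝ × ℝ)‖ ^ k := by gcongr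
  have h4 : |ξ| ^ k * η ^ 2 ≤ ‖((ξ, η) : ℝ × ℝ)‖ ^ (k + 2) := by
    rw [pow_add, ← sq_abs η]
    gcongr
  calc |ξ| ^ k * ‖G (ξ, η)‖ * (1 + η ^ 2)
      = |ξ| ^ k * ‖G (ξ, η)‖ + |ξ| ^ k * η ^ 2 * ‖G (ξ, η)‖ := by ring
    _ ≤ ‖((ξ, η) : ℝ × ℝ)‖ ^ k * ‖G (ξ, η)‖ + ‖((ξ, η) : ℝ × ℝ)‖ ^ (k + 2) * ‖G (ξ, η)‖ := by
        gcongr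
    _ ≤ C₀ + C₂ := add_le_add (h₀.2 _) (h₂.2 _)

theorem integrable_slice (G : 𝓢(ℝ × ℝ, ℂ)) (ξ : ℝ) : Integrable fun η => G (ξ, η) := by
  obtain ⟨C, hC⟩ := exists_decay_slice G 0
  refine (integrable_inv_one_add_sq.const_mul C).mono'
    (G.continuous.comp (by fun_prop)).aestronglyMeasurable (Eventually.of_forall fun η => ?_)
  simpa using hC ξ η

theorem hasDerivAt_slice (G : 𝓢(ℝ × ℝ, ℂ)) (ξ η : ℝ) :
    HasDerivAt (fun t => G (t, η)) ((∂_{((1, 0) : ℝ × ℝ)} G) (ξ, η)) ξ := by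
  rw [SchwartzMap.lineDerivOp_apply_eq_fderiv]
  have h1 : HasDerivAt (fun t : ℝ => ((t, η) : ℝ × ℝ)) (1, 0) ξ :=
    (hasDerivAt_id ξ).prodMk (hasDerivAt_const ξ η)
  exact (G.differentiableAt.hasFDerivAt (x := (ξ, η))).comp_hasDerivAt ξ h1

theorem hasDerivAt_integral_slice (G : 𝓢(ℝ × ℝ, ℂ)) (ξ : ℝ) :
    HasDerivAt (fun t => ∫ η, G (t, η)) (∫ η, (∂_{((1, 0) : ℝ × ℝ)} G) (ξ, η)) ξ := by
  obtain ⟨C, hC⟩ := exists_decay_slice (∂_{((1, 0) : ℝ × ℝ)} G) 0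
  refine (hasDerivAt_integral_of_dominated_loc_of_deriv_le (F := fun t η => G (t, η))
    (F' := fun t η => (∂_{((1, 0) : ℝ × ℝ)} G) (t, η)) (bound := fun η => C * (1 + η ^ 2)⁻¹)
    (s := Set.univ) univ_mem
    (Eventually.of_forall fun t => (integrable_slice G t).aestronglyMeasurable)
    (integrable_slice G ξ) (integrable_slice _ ξ).aestronglyMeasurable
    (Eventually.of_forall fun η t _ => ?_) (integrable_inv_one_add_sq.const_mul C)
    (Eventually.of_forall fun η t _ => hasDerivAt_slice G t η)).2
  simpa using hC t η

/-- All derivatives are again integrals of this kind, which reduces smoothness and decay to the case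
of order zero. -/
theorem iteratedDeriv_integral_slice (n : ℕ) (G : 𝓢(ℝ × ℝ, ℂ)) :
    ∃ G' : 𝓢(ℝ × ℝ, ℂ), iteratedDeriv n (fun ξ => ∫ η, G (ξ, η)) = fun ξ => ∫ η, G' (ξ, η) := by
  induction n with
  | zero => exact ⟨G, iteratedDeriv_zero⟩
  | succ n ih =>
    obtain ⟨G', h⟩ := ih
    refine ⟨∂_{((1, 0) : ℝ × ℝ)} G', ?_⟩
    rw [iteratedDeriv_succ, h]
    exact funext fun ξ => (hasDerivAt_integral_slice G' ξ).deriv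

/-- The integral of a Schwartz function over its second variable. -/
noncomputable def sliceIntegral (G : 𝓢(ℝ × ℝ, ℂ)) : 𝓢(ℝ, ℂ) where
  toFun ξ := ∫ η, G (ξ, η)
  smooth' := contDiff_of_differentiable_iteratedDeriv fun n _ => by
    obtain ⟨G', h⟩ := iteratedDeriv_integral_slice n G
    rw [h]
    exact fun ξ => (hasDerivAt_integral_slice G' ξ).differentiableAt
  decay' k n := by
    obtain ⟨G', h⟩ := iteratedDeriv_integral_slice n G
    obtain ⟨C, hC⟩ := exists_decay_slice G' k
    refine ⟨∫ η : ℝ, C * (1 + η ^ 2)⁻¹, fun ξ => ?_⟩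
    rw [norm_iteratedFDeriv_eq_norm_iteratedDeriv, h, Real.norm_eq_abs]
    calc |ξ| ^ k * ‖∫ η, G' (ξ, η)‖ ≤ |ξ| ^ k * ∫ η, ‖G' (ξ, η)‖ := by
          gcongr
          exact norm_integral_le_integral_norm _
      _ = ∫ η, |ξ| ^ k * ‖G' (ξ, η)‖ := (integral_const_mul _ _).symm
      _ ≤ ∫ η, C * (1 + η ^ 2)⁻¹ :=
          integral_mono ((integrable_slice G' ξ).norm.const_mul _)
            (integrable_inv_one_add_sq.const_mul C) (hC ξ)

end SliceIntegral

/-! ### Mass shell restrictions in light cone coordinates. -/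

section LightCone

/-- The light cone coordinates `(ξ, ξ') ↦ ((ξ + ξ')/2, (ξ - ξ')/2)`. -/
noncomputable def lightCone : (ℝ × ℝ) ≃L[ℝ] (ℝ × ℝ) :=
  LinearEquiv.toContinuousLinearEquiv
    { toFun := fun x => ((x.1 + x.2) / 2, (x.1 - x.2) / 2)
      invFun := fun x => (x.1 + x.2, x.1 - x.2)
      map_add' := fun x y => by ext <;> simp <;> ring
      map_smul' := fun c x => by ext <;> simp <;> ring
      left_inv := fun x => by ext <;> simp <;> ring
      right_inv := fun x => by ext <;> simp }

theorem lightCone_apply (x : ℝ × ℝ) :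
    lightCone x = ((x.1 + x.2) / 2, (x.1 - x.2) / 2) := rfl

theorem det_lightCone : (lightCone : (ℝ × ℝ) →L[ℝ] (ℝ × ℝ)).det = -(1 / 2) := by
  rw [ContinuousLinearMap.det, ← LinearMap.det_toMatrix (Module.Basis.finTwoProd ℝ),
    Matrix.det_fin_two]
  simp [LinearMap.toMatrix_apply, lightCone_apply]
  norm_num

/-- The Jacobian 1/2 is the factor in the definitions of `leftTest` and `rightTest`. -/
theorem integral_eq_lightCone (F : ℝ × ℝ → ℂ) :
    ∫ x, F x = 1 / 2 * ∫ x, F (lightCone x) := by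
  have h := integral_image_eq_integral_abs_det_fderiv_smul (volume : Measure (ℝ × ℝ))
    (s := Set.univ) (f := lightCone) (f' := fun _ => (lightCone : (ℝ × ℝ) →L[ℝ] (ℝ × ℝ)))
    MeasurableSet.univ (fun x _ => lightCone.hasFDerivAt.hasFDerivWithinAt)
    lightCone.injective.injOn F
  rw [Set.image_univ, lightCone.surjective.range_eq, Measure.restrict_univ] at h
  rw [h, det_lightCone, ← integral_const_mul]
  congr 1
  funext x
  rw [abs_neg, abs_of_pos (by norm_num : (0 : ℝ) < 1 / 2), Complex.real_smul]
  norm_num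

/-- `g_l` as a Schwartz function. -/
noncomputable def leftSchwartz (g : 𝓢(ℝ × ℝ, ℂ)) : 𝓢(ℝ, ℂ) :=
  (1 / 2 : ℂ) • sliceIntegral (SchwartzMap.compCLMOfContinuousLinearEquiv ℝ lightCone g)

theorem integrable_mul_exp (g : 𝓢(ℝ × ℝ, ℂ)) {w : ℝ × ℝ → ℝ} (hw : Continuous w) (σ : ℝ) :
    Integrable fun x => g x * Complex.exp (σ * Complex.I * (w x : ℝ)) := by
  refine g.integrable.norm.mono' ?_ (Eventually.of_forall fun x => ?_)
  · have := g.continuous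
    exact Continuous.aestronglyMeasurable (by fun_prop)
  · rw [norm_mul, show (σ * Complex.I * (w x : ℝ) : ℂ) = ((σ * w x : ℝ) : ℂ) * Complex.I by
      push_cast; ring, Complex.norm_exp_ofReal_mul_I, mul_one]

/-- At a negative momentum the exponent depends only on x₀ + x₁. The integral over the other light
cone coordinate acts on `g` alone and yields `leftTest g`. -/
theorem massShell_neg_exp (σ : ℝ) (g : 𝓢(ℝ × ℝ, ℂ)) {gl : 𝓢(ℝ, ℂ)}
    (hgl : ∀ ξ, gl ξ = leftTest g ξ) (β : ℝ) :
    massShell σ g (-Real.exp β) = 1 / (2 * Real.pi) *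
      ∫ ξ : ℝ, gl ξ * Complex.exp (σ * Complex.I * Real.exp β * ξ) := by
  have hw : ∀ x : ℝ × ℝ, |-Real.exp β| * x.1 - -Real.exp β * x.2 = Real.exp β * (x.1 + x.2) := by
    intro x
    rw [abs_neg, Real.abs_exp]
    ring
  have hG := integrable_mul_exp (SchwartzMap.compCLMOfContinuousLinearEquiv ℝ lightCone g)
    (w := fun x => Real.exp β * x.1) (by fun_prop) σ
  rw [massShell]
  simp only [hw]
  rw [integral_eq_lightCone, ← integral_const_mul]
  have h1 : ∀ x : ℝ × ℝ, (1 / 2 : ℂ) * (g (lightCone x) * Complex.exp (σ * Complex.I *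
      ((Real.exp β * ((lightCone x).1 + (lightCone x).2) : ℝ) : ℂ))) = 1 / 2 *
      (SchwartzMap.compCLMOfContinuousLinearEquiv ℝ lightCone g x *
        Complex.exp (σ * Complex.I * ((Real.exp β * x.1 : ℝ) : ℂ))) := by
    intro x
    rw [lightCone_apply, show (x.1 + x.2) / 2 + (x.1 - x.2) / 2 = x.1 by ring]
    rfl
  simp only [h1]
  rw [integral_const_mul, Measure.volume_eq_prod, integral_prod _ hG, ← integral_const_mul]
  congr 2
  funext ξ
  simp only
  rw [integral_mul_const, hgl, leftTest]
  push_cast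
  rw [← mul_assoc, ← mul_assoc]
  rfl

/-- The spatial reflection `(x₀, x₁) ↦ (x₀, -x₁)`. -/
noncomputable def spaceReflection : (ℝ × ℝ) ≃L[ℝ] (ℝ × ℝ) :=
  (ContinuousLinearEquiv.refl ℝ ℝ).prodCongr (ContinuousLinearEquiv.neg ℝ)

/-- The composition of a test function with the spatial reflection. -/
noncomputable def spaceReflected (g : 𝓢(ℝ × ℝ, ℂ)) : 𝓢(ℝ × ℝ, ℂ) :=
  SchwartzMap.compCLMOfContinuousLinearEquiv ℝ spaceReflection g

theorem spaceReflected_apply (g : 𝓢(ℝ × ℝ, ℂ)) (x : ℝ × ℝ) :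
    spaceReflected g x = g (x.1, -x.2) := rfl

theorem leftTest_spaceReflected (g : 𝓢(ℝ × ℝ, ℂ)) (ξ : ℝ) :
    leftTest (spaceReflected g) ξ = rightTest g ξ := by
  unfold leftTest rightTest
  congr 2
  funext η
  rw [spaceReflected_apply]
  congr 2
  ring

theorem massShell_spaceReflected (σ : ℝ) (g : 𝓢(ℝ × ℝ, ℂ)) (p : ℝ) :
    massShell σ (spaceReflected g) (-p) = massShell σ g p := by
  unfold massShell
  congr 1
  have hmp : MeasurePreserving (fun x : ℝ × ℝ => (x.1, -x.2)) volume volume :=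
    (MeasurePreserving.id volume).prod (Measure.measurePreserving_neg volume)
  have hme : MeasurableEmbedding (fun x : ℝ × ℝ => (x.1, -x.2)) :=
    spaceReflection.toHomeomorph.measurableEmbedding
  rw [← hmp.integral_comp hme]
  congr 1
  funext x
  rw [spaceReflected_apply, abs_neg]
  simp

/-- Spatial reflection exchanges p with -p and `leftTest` with `rightTest`, so the right moving case
follows from the left moving one. -/
theorem massShell_exp (σ : ℝ) (g : 𝓢(ℝ × ℝ, ℂ)) {gr : 𝓢(ℝ, ℂ)}
    (hgr : ∀ ξ, gr ξ = rightTest g ξ) (β : ℝ) :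
    massShell σ g (Real.exp β) = 1 / (2 * Real.pi) *
      ∫ ξ : ℝ, gr ξ * Complex.exp (σ * Complex.I * Real.exp β * ξ) := by
  rw [← massShell_spaceReflected]
  exact massShell_neg_exp σ _ (fun ξ => (hgr ξ).trans (leftTest_spaceReflected g ξ).symm) β

/-- The momentum `|p|` or `-p` conjugate to the coordinate `x_k`. -/
noncomputable def coordMomentum (k : Fin 2) (p : ℝ) : ℝ := if k = 0 then |p| else -p

/-- Integration by parts. The factor of modulus |p| removes the singularity of dp/|p| at zero
momentum, which is why derivatives of test functions are admissible. -/
theorem massShell_fderiv (σ : ℝ) {f g : 𝓢(ℝ × ℝ, ℂ)} {k : Fin 2}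
    (hf : ∀ x, f x = fderiv ℝ g x (coordVec k)) (p : ℝ) :
    massShell σ f p = -(σ * Complex.I * coordMomentum k p) * massShell σ g p := by
  set e : ℝ × ℝ → ℂ := fun x => Complex.exp (σ * Complex.I * (|p| * x.1 - p * x.2 : ℝ)) with he
  have hw : Continuous fun x : ℝ × ℝ => |p| * x.1 - p * x.2 := by fun_prop
  have hde : ∀ x, HasFDerivAt e (e x • (σ * Complex.I) • Complex.ofRealCLM.comp
      (|p| • ContinuousLinearMap.fst ℝ ℝ ℝ - p • ContinuousLinearMap.snd ℝ ℝ ℝ)) x := by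
    intro x
    refine HasFDerivAt.cexp (HasFDerivAt.const_mul ?_ _)
    exact (Complex.ofRealCLM.comp (|p| • ContinuousLinearMap.fst ℝ ℝ ℝ -
      p • ContinuousLinearMap.snd ℝ ℝ ℝ)).hasFDerivAt
  have hev : ∀ x, fderiv ℝ e x (coordVec k) = σ * Complex.I * coordMomentum k p * e x := by
    intro x
    rw [(hde x).fderiv]
    unfold coordVec coordMomentum
    split_ifs <;> simp <;> ring
  have i1 : Integrable fun x => g x * e x := integrable_mul_exp g hw σ
  have i2 : Integrable fun x => f x * e x := integrable_mul_exp f hw σ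
  have h := integral_mul_fderiv_eq_neg_fderiv_mul_of_integrable (μ := volume) (f := e) (g := g)
    (v := coordVec k) ?_ ?_ ?_ (fun x _ => (hde x).differentiableAt)
    (fun x _ => g.differentiableAt)
  · unfold massShell
    have h3 : ∫ x, f x * e x = -(σ * Complex.I * coordMomentum k p) * ∫ x, g x * e x := by
      have h4 : ∫ x, f x * e x = ∫ x, e x * fderiv ℝ g x (coordVec k) := by
        congr 1
        funext x
        rw [hf, mul_comm]
      rw [h4, h, ← integral_neg, ← integral_const_mul]
      congr 1
      funext x
      rw [hev]
      ring
    rw [h3]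
    ring
  · simp only [hev]
    refine (i1.const_mul (σ * Complex.I * coordMomentum k p)).congr
      (Eventually.of_forall fun x => ?_)
    simp only
    ring
  · simp only [← hf]
    exact i2.congr (Eventually.of_forall fun x => mul_comm _ _)
  · exact i1.congr (Eventually.of_forall fun x => mul_comm _ _)

end LightCone

end Zamolodchikov

namespace Zamolodchikov

/-! ### The fields -/

theorem hatFun_neg (σ : ℝ) (h : 𝓢(ℝ, ℂ)) (β : ℝ) : hatFun σ (-h) β = -hatFun σ h β := by
  unfold hatFun
  simp only [neg_apply, neg_mul, integral_neg, mul_neg]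

/-- The substitution ξ ↦ -ξ turns the integral into its conjugate; the minus sign comes from the
factor i in front. -/
theorem hatFun_reflectTest (σ : ℝ) (h : 𝓢(ℝ, ℂ)) (β : ℝ) :
    hatFun σ (reflectTest h) β = -conj (hatFun σ h β) := by
  unfold hatFun
  have h1 : ∫ ξ : ℝ, reflectTest h ξ * Complex.exp (σ * Complex.I * Real.exp β * ξ) =
      conj (∫ ξ : ℝ, h ξ * Complex.exp (σ * Complex.I * Real.exp β * ξ)) := by
    rw [← integral_conj, ← integral_neg_eq_self]
    congr 1
    funext ξ
    rw [reflectTest_apply, neg_neg, map_mul, ← Complex.exp_conj]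
    simp only [map_mul, Complex.conj_ofReal, Complex.conj_I, Complex.ofReal_neg, mul_neg, neg_mul]
  rw [h1]
  simp only [map_mul, map_div₀, Complex.conj_ofReal, Complex.conj_I]
  ring

theorem hatPlus_neg (h : 𝓢(ℝ, ℂ)) : hatPlus (-h) = -hatPlus h := by
  apply Lp.ext
  filter_upwards [(memLp_hatFun (σ := 1) (by simp) (-h)).coeFn_toLp,
    (memLp_hatFun (σ := 1) (by simp) h).coeFn_toLp, Lp.coeFn_neg (hatPlus h)] with β h1 h2 h3
  refine h1.trans (Eq.trans ?_ h3.symm)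
  rw [hatFun_neg, Pi.neg_apply]
  exact congrArg Neg.neg h2.symm

theorem hatMinus_neg (h : 𝓢(ℝ, ℂ)) : hatMinus (-h) = -hatMinus h := by
  apply Lp.ext
  filter_upwards [(memLp_hatFun (σ := -1) (by simp) (-h)).coeFn_toLp,
    (memLp_hatFun (σ := -1) (by simp) h).coeFn_toLp, Lp.coeFn_neg (hatMinus h)] with β h1 h2 h3
  refine h1.trans (Eq.trans ?_ h3.symm)
  rw [hatFun_neg, Pi.neg_apply]
  exact congrArg Neg.neg h2.symm

theorem hatPlus_reflectTest (h : 𝓢(ℝ, ℂ)) : hatPlus (reflectTest h) = -star (hatPlus h) := by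
  apply Lp.ext
  filter_upwards [(memLp_hatFun (σ := 1) (by simp) (reflectTest h)).coeFn_toLp,
    (memLp_hatFun (σ := 1) (by simp) h).coeFn_toLp, Lp.coeFn_neg (star (hatPlus h)),
    Lp.coeFn_star (hatPlus h)] with β h1 h2 h3 h4
  refine h1.trans (Eq.trans ?_ h3.symm)
  rw [hatFun_reflectTest, Pi.neg_apply, h4]
  exact congrArg (fun z : ℂ => -conj z) h2.symm

theorem hatMinus_reflectTest (h : 𝓢(ℝ, ℂ)) : hatMinus (reflectTest h) = -star (hatMinus h) := by
  apply Lp.ext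
  filter_upwards [(memLp_hatFun (σ := -1) (by simp) (reflectTest h)).coeFn_toLp,
    (memLp_hatFun (σ := -1) (by simp) h).coeFn_toLp, Lp.coeFn_neg (star (hatMinus h)),
    Lp.coeFn_star (hatMinus h)] with β h1 h2 h3 h4
  refine h1.trans (Eq.trans ?_ h3.symm)
  rw [hatFun_reflectTest, Pi.neg_apply, h4]
  exact congrArg (fun z : ℂ => -conj z) h2.symm

theorem reflectTest_reflectTest {E : Type*} [NormedAddCommGroup E] [NormedSpace ℝ E]
    (h : 𝓢(E, ℂ)) : reflectTest (reflectTest h) = h := by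
  ext x
  rw [reflectTest_apply, reflectTest_apply, neg_neg, Complex.conj_conj]

theorem reflectTest_neg {E : Type*} [NormedAddCommGroup E] [NormedSpace ℝ E]
    (h : 𝓢(E, ℂ)) : reflectTest (-h) = -reflectTest h := by
  ext x
  rw [reflectTest_apply, neg_apply, neg_apply, reflectTest_apply, map_neg]

theorem leftTest_neg_reflectTest (g : 𝓢(ℝ × ℝ, ℂ)) (ξ : ℝ) :
    leftTest (-reflectTest g) ξ = -conj (leftTest g (-ξ)) := by
  unfold leftTest
  rw [map_mul, ← integral_conj, map_div₀, map_one, map_ofNat, ← mul_neg, ← integral_neg,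
    ← integral_neg_eq_self]
  congr 2
  funext η
  rw [Pi.neg_apply, reflectTest_apply]
  congr 3
  ext <;> simp <;> ring

theorem rightTest_neg_reflectTest (g : 𝓢(ℝ × ℝ, ℂ)) (ξ : ℝ) :
    rightTest (-reflectTest g) ξ = -conj (rightTest g (-ξ)) := by
  unfold rightTest
  rw [map_mul, ← integral_conj, map_div₀, map_one, map_ofNat, ← mul_neg, ← integral_neg,
    ← integral_neg_eq_self]
  congr 2
  funext η
  rw [Pi.neg_apply, reflectTest_apply]
  congr 3
  ext <;> simp <;> ring

/-- The inner derivative of x ↦ -x gives a sign, so the primitive belonging to f^j is -g^j. -/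
theorem reflectTest_eq_fderiv {f g : 𝓢(ℝ × ℝ, ℂ)} {v : ℝ × ℝ}
    (hf : ∀ x, f x = fderiv ℝ g x v) (x : ℝ × ℝ) :
    reflectTest f x = fderiv ℝ (-reflectTest g) x v := by
  have h1 : HasFDerivAt (fun y : ℝ × ℝ => g (-y))
      ((fderiv ℝ g (-x)).comp (-ContinuousLinearMap.id ℝ (ℝ × ℝ))) x :=
    (g.differentiableAt.hasFDerivAt (x := -x)).comp x (hasFDerivAt_id x).neg
  have h2 : HasFDerivAt (⇑(-reflectTest g)) (-((Complex.conjCLE : ℂ →L[ℝ] ℂ).comp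
      ((fderiv ℝ g (-x)).comp (-ContinuousLinearMap.id ℝ (ℝ × ℝ))))) x :=
    ((Complex.conjCLE : ℂ →L[ℝ] ℂ).hasFDerivAt.comp x h1).neg
  rw [h2.fderiv, reflectTest_apply, hf]
  simp

/-- With β = log |p|, `coordMomentum` is exp β on the negative half-line and (-1)^k exp β on the
positive one. Multiplying the Fourier integrals of g_l and g_r, it produces `hatFun` up to
-(2π)^(-1/2). Square integrability of the mass shell functions is a consequence. -/
theorem massShell_fderiv_ae {σ : ℝ} {f g : 𝓢(ℝ × ℝ, ℂ)} {k : Fin 2}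
    (hf : ∀ x, f x = fderiv ℝ g x (coordVec k)) {gl gr : 𝓢(ℝ, ℂ)}
    (hgl : ∀ ξ, gl ξ = leftTest g ξ) (hgr : ∀ ξ, gr ξ = rightTest g ξ)
    {a b : Lp ℂ 2 (volume : Measure ℝ)} (ha : a =ᵐ[volume] hatFun σ gl)
    (hb : b =ᵐ[volume] hatFun σ gr) :
    (-(1 / Real.sqrt (2 * Real.pi) : ℂ) • (leftEmbed a + (-1 : ℂ) ^ (k : ℕ) • rightEmbed b) :
      Lp ℂ 2 masslessMeasure) =ᵐ[masslessMeasure] massShell σ f := by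
  have h0 : ∀ᵐ p ∂masslessMeasure, p ≠ 0 :=
    compl_mem_ae_iff.2 (withDensity_absolutelyContinuous _ _ (measure_singleton 0))
  have ha' : ∀ᵐ p ∂masslessMeasure, p < 0 → a (Real.log (-p)) = hatFun σ gl (Real.log (-p)) :=
    (ae_restrict_iff' measurableSet_Iio).1
      (measurePreserving_log_neg.quasiMeasurePreserving.ae ha)
  have hb' : ∀ᵐ p ∂masslessMeasure, 0 < p → b (Real.log p) = hatFun σ gr (Real.log p) :=
    (ae_restrict_iff' measurableSet_Ioi).1 (measurePreserving_log.quasiMeasurePreserving.ae hb)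
  have hpi : ((Real.sqrt (2 * Real.pi) : ℝ) : ℂ) * ((Real.sqrt (2 * Real.pi) : ℝ) : ℂ) =
      2 * Real.pi := by
    rw [← Complex.ofReal_mul, Real.mul_self_sqrt (by positivity)]
    push_cast
    rfl
  have hs : ((Real.sqrt (2 * Real.pi) : ℝ) : ℂ) ≠ 0 := by
    rw [Complex.ofReal_ne_zero]
    positivity
  filter_upwards [h0, ha', hb', (memLp_leftEmbed a).coeFn_toLp, (memLp_rightEmbed b).coeFn_toLp,
    Lp.coeFn_smul (-(1 / Real.sqrt (2 * Real.pi) : ℂ))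
      (leftEmbed a + (-1 : ℂ) ^ (k : ℕ) • rightEmbed b),
    Lp.coeFn_add (leftEmbed a) ((-1 : ℂ) ^ (k : ℕ) • rightEmbed b),
    Lp.coeFn_smul ((-1 : ℂ) ^ (k : ℕ)) (rightEmbed b)] with p p0 e1 e2 e3 e4 e5 e6 e7
  have e3 : leftEmbed a p = _ := e3
  have e4 : rightEmbed b p = _ := e4
  rw [e5, Pi.smul_apply, e6, Pi.add_apply, e7, Pi.smul_apply, e3, e4, massShell_fderiv σ hf]
  rcases lt_or_gt_of_ne p0 with hp | hp
  · have hpe : p = -Real.exp (Real.log (-p)) := by rw [Real.exp_log (neg_pos.2 hp), neg_neg]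
    have hq : coordMomentum k p = Real.exp (Real.log (-p)) := by
      unfold coordMomentum
      rw [abs_of_neg hp, Real.exp_log (neg_pos.2 hp), ite_self]
    rw [if_pos hp, if_neg hp.not_gt, e1 hp, hq]
    conv_rhs => rw [hpe, massShell_neg_exp σ g hgl]
    rw [← hpe, hatFun, ← hpi, smul_zero, add_zero, smul_eq_mul]
    field_simp
  · have hpe : p = Real.exp (Real.log p) := (Real.exp_log hp).symm
    have hq : (coordMomentum k p : ℂ) = (-1) ^ (k : ℕ) * Real.exp (Real.log p) := by
      unfold coordMomentum
      rw [abs_of_pos hp, Real.exp_log hp]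
      fin_cases k <;> simp
    rw [if_neg hp.not_gt, if_pos hp, e2 hp, hq]
    have hm := massShell_exp σ g hgr (Real.log p)
    rw [← hpe] at hm ⊢
    rw [hm, hatFun, ← hpe, ← hpi, zero_add, smul_eq_mul, smul_eq_mul]
    field_simp

theorem massShellVec_eq {σ : ℝ} {f : 𝓢(ℝ × ℝ, ℂ)} {φ : Lp ℂ 2 masslessMeasure}
    (h : φ =ᵐ[masslessMeasure] massShell σ f) : massShellVec σ f = φ := by
  have hm : MemLp (massShell σ f) 2 masslessMeasure := (memLp_congr_ae h).1 (Lp.memLp φ)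
  rw [massShellVec, dif_pos hm]
  exact Lp.ext (hm.coeFn_toLp.trans h.symm)

/-! ### The fields under the unitary. -/

section Fields

open scoped TensorProduct

variable {S : ScatteringFunctionWithLimit}

theorem chiralField_neg (h : 𝓢(ℝ, ℂ)) : chiralField S (-h) = -chiralField S h := by
  unfold chiralField yDagger yOp
  rw [hatPlus_neg, hatMinus_neg, creation_neg, annihilation_neg, ← neg_add]

theorem isOddFor_chiralField (h : 𝓢(ℝ, ℂ)) : IsOddFor S.norm_atInfinity (chiralField S h) :=
  (isOddFor_creation _ _).add (isOddFor_annihilation _ S.atInfinity_sq _)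

/-- The overall sign stems from `hatFun_reflectTest`; it accounts for the sign of the left moving
term of the massless field. -/
theorem chiralFieldPrime_eq (h : 𝓢(ℝ, ℂ)) :
    chiralFieldPrime S h =
      -(yDaggerPrime S (hatPlus h) + reflected (yOp S (star (hatMinus h)))) := by
  unfold chiralFieldPrime chiralField yDaggerPrime yDagger yOp
  rw [hatPlus_reflectTest, hatMinus_reflectTest, creation_neg, annihilation_neg, ← neg_add,
    reflected_neg, reflected_add]

/-- Creation and annihilation operators are both complex linear in their argument, and the two
frequency parts have the same coefficients, so the pieces recombine into chiral fields. -/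
theorem intertwined_masslessField {f g : 𝓢(ℝ × ℝ, ℂ)} {k : Fin 2}
    (hf : ∀ x, f x = fderiv ℝ g x (coordVec k)) {gl gr : 𝓢(ℝ, ℂ)}
    (hgl : ∀ ξ, gl ξ = leftTest g ξ) (hgr : ∀ ξ, gr ξ = rightTest g ξ) :
    Intertwined (masslessField S f) (-(1 / Real.sqrt (2 * Real.pi) : ℂ) •
      (-TensorProduct.map (chiralFieldPrime S gl) LinearMap.id + (-1 : ℂ) ^ (k : ℕ) •
        TensorProduct.map (chiralNumberPow S) (chiralField S gr))) := by
  have hp := massShellVec_eq (massShell_fderiv_ae (σ := 1) hf hgl hgr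
    (memLp_hatFun (σ := 1) (by simp) gl).coeFn_toLp
    (memLp_hatFun (σ := 1) (by simp) gr).coeFn_toLp)
  have hm := massShellVec_eq (massShell_fderiv_ae (σ := -1) hf hgl hgr
    (memLp_hatFun (σ := -1) (by simp) gl).coeFn_toLp
    (memLp_hatFun (σ := -1) (by simp) gr).coeFn_toLp)
  have h1 := ((intertwined_zDagger_leftEmbed (S := S) (hatPlus gl)).add
    ((intertwined_zDagger_rightEmbed (hatPlus gr)).smul ((-1 : ℂ) ^ (k : ℕ)))).smul
    (-(1 / Real.sqrt (2 * Real.pi) : ℂ))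
  have h2 := ((intertwined_zOp_leftEmbed (S := S) (hatMinus gl)).add
    ((intertwined_zOp_rightEmbed (hatMinus gr)).smul ((-1 : ℂ) ^ (k : ℕ)))).smul
    (-(1 / Real.sqrt (2 * Real.pi) : ℂ))
  have h := h1.add h2
  have hA : masslessField S f = -(1 / Real.sqrt (2 * Real.pi) : ℂ) •
      (zDagger S (leftEmbed (hatPlus gl)) +
        (-1 : ℂ) ^ (k : ℕ) • zDagger S (rightEmbed (hatPlus gr))) +
      -(1 / Real.sqrt (2 * Real.pi) : ℂ) • (zOp S (leftEmbed (hatMinus gl)) +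
        (-1 : ℂ) ^ (k : ℕ) • zOp S (rightEmbed (hatMinus gr))) := by
    unfold masslessField zDagger zOp
    rw [hp, hm, creation_smul, creation_add, creation_smul, annihilation_smul, annihilation_add,
      annihilation_smul]
    rfl
  rw [hA]
  convert h using 1
  rw [chiralFieldPrime_eq, chiralField, ← neg_one_smul ℂ (_ + _), TensorProduct.map_smul_left,
    TensorProduct.map_add_left, TensorProduct.map_add_right]
  module

/-- The unprimed identity is applied to f^j with primitive -g^j and conjugated with the twisted
reflection. The twist adds ε^N to the left moving term and removes it from the right moving one. -/
theorem intertwined_masslessFieldPrime {f g : 𝓢(ℝ × ℝ, ℂ)} {k : Fin 2}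
    (hf : ∀ x, f x = fderiv ℝ g x (coordVec k)) {gl gr : 𝓢(ℝ, ℂ)}
    (hgl : ∀ ξ, gl ξ = leftTest g ξ) (hgr : ∀ ξ, gr ξ = rightTest g ξ) :
    Intertwined (masslessFieldPrime S f) (-(1 / Real.sqrt (2 * Real.pi) : ℂ) •
      (TensorProduct.map (chiralField S gl) (chiralNumberPow S) - (-1 : ℂ) ^ (k : ℕ) •
        TensorProduct.map LinearMap.id (chiralFieldPrime S gr))) := by
  have h := intertwined_masslessField (S := S) (f := reflectTest f) (g := -reflectTest g) (k := k)
    (gl := -reflectTest gl) (gr := -reflectTest gr) (reflectTest_eq_fderiv hf)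
    (fun ξ => (congrArg (fun z : ℂ => -conj z) (hgl (-ξ))).trans
      (leftTest_neg_reflectTest g ξ).symm)
    (fun ξ => (congrArg (fun z : ℂ => -conj z) (hgr (-ξ))).trans
      (rightTest_neg_reflectTest g ξ).symm)
  have hX : chiralFieldPrime S (-reflectTest gl) = -reflected (chiralField S gl) := by
    rw [chiralFieldPrime, reflectTest_neg, reflectTest_reflectTest, chiralField_neg,
      reflected_neg]
  refine h.reflected fun t => ?_
  -- The coefficients are real and hence unaffected by the antilinear reflection.
  have hc : conj (-(1 / Real.sqrt (2 * Real.pi) : ℂ)) = -(1 / Real.sqrt (2 * Real.pi) : ℂ) := by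
    rw [map_neg, map_div₀, map_one, Complex.conj_ofReal]
  have hk : conj ((-1 : ℂ) ^ (k : ℕ)) = (-1 : ℂ) ^ (k : ℕ) := by simp
  have hl := twisted_reflection_map_left S.norm_atInfinity S.atInfinity_sq S.conj_atInfinity
    ((isOddFor_chiralField gl).reflected S.conj_atInfinity) t
  have hr := twisted_reflection_map_right S.norm_atInfinity S.atInfinity_sq S.conj_atInfinity
    (isOddFor_chiralField (reflectTest gr)) t
  rw [reflected_reflected] at hl
  rw [hX, chiralField_neg, ← neg_one_smul ℂ (reflected _), TensorProduct.map_smul_left,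
    ← neg_one_smul ℂ (chiralField S (reflectTest gr)), TensorProduct.map_smul_right]
  simp only [LinearMap.smul_apply, LinearMap.add_apply, LinearMap.sub_apply, LinearMap.neg_apply,
    map_smulₛₗ, map_add, map_neg, map_one, hc, hk, RingHom.id_apply] at hl hr ⊢
  rw [hl, chiralNumberPow, hr, chiralFieldPrime]
  module

end Fields

end Zamolodchikov

theorem mainTheorem3 (S : ScatteringFunctionWithLimit) :
    ∃ V : HilbertTensor (ChiralFock S) (ChiralFock S) ≃ₗᵢ[ℂ] MasslessFock S,
      -- the Zamolodchikov creation operators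
      (∀ ψ : Lp ℂ 2 (volume : Measure ℝ),
        ConjugateOnFinite S V (zDagger S (leftEmbed ψ))
          (TensorProduct.map (yDaggerPrime S ψ) LinearMap.id) ∧
        ConjugateOnFinite S V (zDagger S (rightEmbed ψ))
          (TensorProduct.map (chiralNumberPow S) (yDagger S ψ))) ∧
      -- the Poincaré transformations
      (∀ (x : ℝ × ℝ) (θ : ℝ) (Ψ : HilbertTensor (ChiralFock S) (ChiralFock S)),
        V.symm (masslessU S x θ (V Ψ)) =
          tensorOp (chiralU S (x.1 + x.2) θ).toContinuousLinearMap
            (chiralU S (x.1 - x.2) (-θ)).toContinuousLinearMap Ψ) ∧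
      -- the reflection
      (∀ Ψ : HilbertTensor (ChiralFock S) (ChiralFock S),
        V.symm (masslessUj S (V Ψ)) =
          doubleNumberPow volume (chiralFactor S) S.atInfinity S.norm_atInfinity
            (antitensorOp (chiralUj S) (chiralUj S) Ψ)) ∧
      -- the fields
      (∀ (f g : 𝓢(ℝ × ℝ, ℂ)) (k : Fin 2), (∀ x, f x = fderiv ℝ g x (coordVec k)) →
        MemLp (massShell 1 f) 2 masslessMeasure ∧ MemLp (massShell (-1) f) 2 masslessMeasure ∧
        ∃ gl gr : 𝓢(ℝ, ℂ), (∀ ξ, gl ξ = leftTest g ξ) ∧ (∀ ξ, gr ξ = rightTest g ξ) ∧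
          ConjugateOnFinite S V (masslessField S f)
            (-(1 / Real.sqrt (2 * Real.pi) : ℂ) •
              (-TensorProduct.map (chiralFieldPrime S gl) LinearMap.id +
                (-1 : ℂ) ^ (k : ℕ) •
                  TensorProduct.map (chiralNumberPow S) (chiralField S gr))) ∧
          ConjugateOnFinite S V (masslessFieldPrime S f)
            (-(1 / Real.sqrt (2 * Real.pi) : ℂ) •
              (TensorProduct.map (chiralField S gl) (chiralNumberPow S) -
                (-1 : ℂ) ^ (k : ℕ) •
                  TensorProduct.map LinearMap.id (chiralFieldPrime S gr)))) := by
  refine ⟨pairUnitary S, fun ψ => ⟨(intertwined_zDagger_leftEmbed ψ).conjugateOnFinite,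
    (intertwined_zDagger_rightEmbed ψ).conjugateOnFinite⟩, fun x θ Ψ => ?_, fun Ψ => ?_,
    fun f g k hf => ?_⟩
  · rw [LinearIsometryEquiv.symm_apply_eq, masslessU_pairUnitary]
  · rw [LinearIsometryEquiv.symm_apply_eq, masslessUj_pairUnitary]
  · have hgl : ∀ ξ, leftSchwartz g ξ = leftTest g ξ := fun _ => rfl
    have hgr : ∀ ξ, leftSchwartz (spaceReflected g) ξ = rightTest g ξ :=
      leftTest_spaceReflected g
    refine ⟨(memLp_congr_ae (massShell_fderiv_ae hf hgl hgr
        (memLp_hatFun (by simp) _).coeFn_toLp (memLp_hatFun (by simp) _).coeFn_toLp)).1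
        (Lp.memLp _),
      (memLp_congr_ae (massShell_fderiv_ae hf hgl hgr
        (memLp_hatFun (by simp) _).coeFn_toLp (memLp_hatFun (by simp) _).coeFn_toLp)).1
        (Lp.memLp _),
      leftSchwartz g, leftSchwartz (spaceReflected g), hgl, hgr,
      (intertwined_masslessField hf hgl hgr).conjugateOnFinite,
      (intertwined_masslessFieldPrime hf hgl hgr).conjugateOnFinite⟩
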